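/- **Setting.** Let $d\ge 1$ and let $\mathcal H_0\neq\{0\}$ be a finite dimensional Hilbert space, attached to each site of $\mathbb Z^d$. Let $(Q_A)$, $A\subset\mathbb Z^d$ finite, be a translation invariant, finite range family of self-adjoint operators, $Q_A$ acting on $\bigotimes_{x\in A}\mathcal H_x$. Let $\kappa_0$ be a self-adjoint operator acting on a finite cluster of sites, with $\|\kappa_0\|\le 1$, and let $\kappa_x$ be its translates. Let $\eta=(\eta_x)_{x\in\mathbb Z^d}$ be i.i.d. real random variables of finite variance, with average denoted $\mathrm{Av}$, and let $\varepsilon\ge 0$. On $\Gamma_K=[-K,K]^d\cap\mathbb Z^d$ with periodic boundary conditions put $$H^{h,\eta}_K=\sum_A Q_A+\sum_{x\in\Gamma_K}(h+\varepsilon\eta_x)\kappa_x ,\qquad F^h_K(\eta)=-\tfrac1\beta\log\mathrm{Tr}\,e^{-\beta H_K^{h,\eta}}\quad(0<\beta<\infty),$$ and for $\beta=\infty$ let $F_K^h(\eta)$ be the ground state energy of $H_K^{h,\eta}$. Let $\langle\cdot\rangle^h_K(\eta)$ be the corresponding Gibbs state (for $\beta=\infty$, its limit as $\beta\to\infty$).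 For a finite set $\Lambda$ of sites let $\langle\cdot\rangle_{\eta_\Lambda}$ denote the average over the $\eta_x$, $x\notin\Lambda$, with $\eta_\Lambda=(\eta_x)_{x\in\Lambda}$ held fixed. Let $r_L\eta$ be $\eta$ with $\eta_x$ replaced by $0$ for $x\in\Gamma_L$, let $(T_x\eta)_y=\eta_{y-x}$, and put $$g^{\delta}_{L,K}(\eta_L)=\tfrac12\Big\langle F^{h+\delta}_K(\eta)-F^{h+\delta}_K(r_L\eta)-F^{h-\delta}_K(\eta)+F^{h-\delta}_K(r_L\eta)\Big\rangle_{\eta_{\Gamma_L}} .$$ Let $\|f\|_{\mathrm{Lip}}=\sup |f(\eta)-f(\eta')|/\|\eta-\eta'\|_1$, the supremum being over $0<\|\eta-\eta'\|_1<\infty$, where $\|\eta\|_1=\sum_x|\eta_x|$. **Lemma.** Let $0<\beta\le\infty$; if $\beta=\infty$, assume in addition that the distribution of $\eta_0$ is absolutely continuous. Then there is a function $\mathcal F:\mathbb R\to\mathbb R$ (the free energy density) such that, almost surely, $F_K^h(\eta)/|\Gamma_K|\to\mathcal F(h)$ as $K\to\infty$ for all $h$; and for every $h\in\mathbb R$ there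 are sequences $K_j\to\infty$ and $\delta_i\to0$, $\delta_i>0$, such that the limits $$G_L(\eta)=\lim_{i\to\infty}\lim_{j\to\infty}\Big(g^{\delta_i}_{L,K_j}-\mathrm{Av}\big[g^{\delta_i}_{L,K_j}\big]\Big)$$ exist for all $L\ge 0$ and all $\eta$, and have the following properties. 1. $G_L$ is integrable and $\mathrm{Av}\,G_L=0$. 2. $G_L(\eta)$ depends on the values of $\eta_x$ only for $x\in\Gamma_L$. 3. $\|G_L\|_{\mathrm{Lip}}\le\varepsilon$. 4. $\langle G_L\rangle_{\eta_\Lambda}=G_{L'}(T_x\eta)$ for all $\eta$ whenever $\Lambda=\Gamma_{L'}-x\subset\Gamma_L$. 5. The one-site function $t\mapsto G_0(t)$ (recall $\Gamma_0=\{0\}$) has a distributional derivative $G_0'$, i.e. a locally integrable function with $\int_a^bG_0'(t)\,dt=G_0(b)-G_0(a)$ for all $a,b$, which for $\beta<\infty$ is Lipschitz with constant at most $\beta\varepsilon^2$. 6. For the same $G_0'$: $G_0'(\eta_0)$ is integrable, $\mathcal F$ has one-sided derivatives at $h$, and $\mathrm{Av}\,G_0'(\eta_0)=\frac{\varepsilon}{2}\Big(\frac{\partial\mathcal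 F}{\partial h+}-\frac{\partial\mathcal F}{\partial h-}\Big)$. 7. If the system satisfies the weak FKG condition, i.e. for all large $K$ and all $x\in\Gamma_K$ the quantity $\langle\kappa_x\rangle_K^h(\eta)$ is nondecreasing in $h$ and in all the $\eta_y$, $y\in\Gamma_K$, jointly, then $G_0$ is nondecreasing. If these quantities are instead all nonincreasing (the weak FKG condition for $-\kappa$), then $G_0$ is nonincreasing. -/

import Mathlib

open MeasureTheory Filter Topology
open scoped ENNReal

noncomputable section

namespace DisorderedLattice

/-- Field configurations `η = (η_x)`, one real number for each site `x ∈ ℤ^d`. -/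
abbrev Fields (d : ℕ) : Type := (Fin d → ℤ) → ℝ

/-- The box `Γ_L = [-L, L]^d ∩ ℤ^d`. -/
def box (d L : ℕ) : Finset (Fin d → ℤ) := Finset.Icc (fun _ => -(L : ℤ)) (fun _ => (L : ℤ))

/-- The translate `A + x` of a finite set of sites. -/
def translateSet {d : ℕ} (x : Fin d → ℤ) (A : Finset (Fin d → ℤ)) : Finset (Fin d → ℤ) :=
  A.map (addRightEmbedding x)

/-- The site `a + x` of `A + x`, for `a ∈ A`. -/
def translateSite {d : ℕ} (x : Fin d → ℤ) (A : Finset (Fin d → ℤ)) (a : A) : translateSet x A :=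
  ⟨(a : Fin d → ℤ) + x, Finset.mem_map_of_mem (addRightEmbedding x) a.2⟩

/-- Periodic box with `(2K+1)^d` sites, i.e. `Γ_K` with opposite faces identified. -/
abbrev Torus (d K : ℕ) : Type := Fin d → ZMod (2 * K + 1)

/-- Reduction of a site of `ℤ^d` modulo the periods. -/
def proj {d : ℕ} (K : ℕ) (x : Fin d → ℤ) : Torus d K := fun i => (x i : ZMod (2 * K + 1))

/-- The representative in `Γ_K = [-K, K]^d` of a site of the torus. -/
def rep {d K : ℕ} (v : Torus d K) : Fin d → ℤ := fun i => (v i).valMinAbs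

section Quantum

variable {σ : Type*}

/-- The local state space is `ℂ^σ`, so the state space of a set `V` of sites is
`⨂_{v ∈ V} ℂ^σ`, with orthonormal basis indexed by `V → σ`, and operators on it are matrices
indexed by `V → σ`.  For an injection `f : A → V` the matrix `embedOp f M` is `M ⊗ 1`: it acts
as `M` on the sites `f a` (`a ∈ A`) and as the identity on the other sites. -/
def embedOp {A V : Type*} (f : A → V) (M : Matrix (A → σ) (A → σ) ℂ) :
    Matrix (V → σ) (V → σ) ℂ :=
  open Classical in
  Matrix.of fun s t => if ∀ v, v ∉ Set.range f → s v = t v then M (s ∘ f) (t ∘ f) else 0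

/-- A translation invariant quantum lattice system on `ℤ^d` with local state space `ℂ^σ`:
a translation invariant finite range interaction `Q`, and a local observable `kappa`
(the operator `κ_0`) acting on a finite cluster of sites and normalized by `‖κ_0‖ ≤ 1`. -/
structure LatticeSystem (d : ℕ) (σ : Type*) [Fintype σ] [DecidableEq σ] where
  /-- The interaction term `Q_A`, an operator on the sites in `A`. -/
  Q : (A : Finset (Fin d → ℤ)) → Matrix (A → σ) (A → σ) ℂ
  Q_isHermitian : ∀ A, (Q A).IsHermitian
  Q_translate : ∀ (x : Fin d → ℤ) (A : Finset (Fin d → ℤ)) (s t : translateSet x A → σ),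
    Q (translateSet x A) s t = Q A (s ∘ translateSite x A) (t ∘ translateSite x A)
  /-- The range of the interaction. -/
  range : ℕ
  Q_finiteRange : ∀ A, (∃ a ∈ A, ∃ b ∈ A, ∃ i, (range : ℤ) < |a i - b i|) → Q A = 0
  /-- The cluster of sites on which `κ_0` acts. -/
  cluster : Finset (Fin d → ℤ)
  /-- The operator `κ_0`. -/
  kappa : Matrix (cluster → σ) (cluster → σ) ℂ
  kappa_isHermitian : kappa.IsHermitian
  kappa_norm_le : ‖Matrix.toEuclideanCLM (𝕜 := ℂ) kappa‖ ≤ 1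

namespace LatticeSystem

variable [Fintype σ] [DecidableEq σ] {d : ℕ} (S : LatticeSystem d σ)

/-- The copy of `Q_A` on the torus, with `A` moved by `v`. -/
def torusQ (K : ℕ) (v : Torus d K) (A : Finset (Fin d → ℤ)) :
    Matrix (Torus d K → σ) (Torus d K → σ) ℂ :=
  embedOp (fun a : A => v + proj K (a : Fin d → ℤ)) (S.Q A)

/-- The operator `κ_v` on the torus. -/
def torusKappa (K : ℕ) (v : Torus d K) : Matrix (Torus d K → σ) (Torus d K → σ) ℂ :=
  embedOp (fun a : S.cluster => v + proj K (a : Fin d → ℤ)) S.kappa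

/-- The Hamiltonian `∑_A Q_A + ∑_x (h + ε η_x) κ_x` in `Γ_K` with periodic boundary conditions.
The first sum is over the nonempty finite sets `A` of sites modulo the periods: it is written as
a sum over the sites `v` and the sets `A ∋ 0`, with the weight `1/|A|` since a set of `|A|`
sites arises in this way from each of its points.  Finite range forces the relevant `A ∋ 0` to
lie in `[-R, R]^d`. -/
def hamiltonian (ε h : ℝ) (K : ℕ) (η : Fields d) :
    Matrix (Torus d K → σ) (Torus d K → σ) ℂ :=
  (∑ v : Torus d K, ∑ A ∈ (box d S.range).powerset with 0 ∈ A,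
      ((A.card : ℂ)⁻¹) • S.torusQ K v A)
    + ∑ v : Torus d K, ((h + ε * η (rep v) : ℝ) : ℂ) • S.torusKappa K v

/-- The finite volume free energy `F_K^h(η)` with periodic boundary conditions: `-β⁻¹ log Z` for
`β < ∞`, and the ground state energy for `β = ∞`. -/
def freeEnergy (β : ℝ≥0∞) (ε h : ℝ) (K : ℕ) (η : Fields d) : ℝ :=
  open Classical in
  if β = ⊤ then sInf (spectrum ℝ (S.hamiltonian ε h K η))
  else -(β.toReal)⁻¹ *
    Real.log (NormedSpace.exp (((-β.toReal : ℝ) : ℂ) • S.hamiltonian ε h K η)).trace.re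

/-- The Gibbs expectation `⟨κ_v⟩` at inverse temperature `b < ∞`. -/
def gibbsKappa (b ε h : ℝ) (K : ℕ) (η : Fields d) (v : Torus d K) : ℝ :=
  (S.torusKappa K v * NormedSpace.exp (((-b : ℝ) : ℂ) • S.hamiltonian ε h K η)).trace.re /
    (NormedSpace.exp (((-b : ℝ) : ℂ) • S.hamiltonian ε h K η)).trace.re

/-- The equilibrium expectation `⟨κ_v⟩_K^h(η)` at `β ≤ ∞`; at `β = ∞` it is the zero temperature
limit of the Gibbs expectations (the average over the space of ground states). -/
def stateKappa (β : ℝ≥0∞) (ε h : ℝ) (K : ℕ) (η : Fields d) (v : Torus d K) : ℝ :=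
  open Classical in
  if β = ⊤ then limUnder atTop (fun b : ℝ => S.gibbsKappa b ε h K η v)
  else S.gibbsKappa β.toReal ε h K η v

/-- The weak FKG condition: on all large periodic boxes, every `⟨κ_x⟩` is nondecreasing in the
uniform field `h` and in the random fields. -/
def WeakFKG (β : ℝ≥0∞) (ε : ℝ) : Prop :=
  ∀ᶠ K : ℕ in atTop, ∀ (v : Torus d K) (h h' : ℝ) (η η' : Fields d), h' ≤ h →
    (∀ y ∈ box d K, η' y ≤ η y) → S.stateKappa β ε h' K η' v ≤ S.stateKappa β ε h K η v

/-- The weak FKG condition for `-κ`: on all large periodic boxes, every `⟨κ_x⟩` is nonincreasing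
in the uniform field `h` and in the random fields. -/
def WeakFKGNeg (β : ℝ≥0∞) (ε : ℝ) : Prop :=
  ∀ᶠ K : ℕ in atTop, ∀ (v : Torus d K) (h h' : ℝ) (η η' : Fields d), h' ≤ h →
    (∀ y ∈ box d K, η' y ≤ η y) → S.stateKappa β ε h K η v ≤ S.stateKappa β ε h' K η' v

end LatticeSystem

end Quantum

/-- The law of independent fields `η_x`, each with distribution `ν`. -/
def fieldLaw (d : ℕ) (ν : Measure ℝ) : Measure (Fields d) :=
  Measure.infinitePi fun _ : Fin d → ℤ => ν

/-- The configuration that equals `η` on `Λ` and `ω` off `Λ`. -/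
def splice {d : ℕ} (Λ : Finset (Fin d → ℤ)) (η ω : Fields d) : Fields d :=
  fun x => if x ∈ Λ then η x else ω x

/-- The conditional average of `f` over the fields outside `Λ`, with `η_Λ` held constant. -/
def condAv {d : ℕ} (ν : Measure ℝ) (Λ : Finset (Fin d → ℤ)) (f : Fields d → ℝ) (η : Fields d) :
    ℝ :=
  ∫ ω, f (splice Λ η ω) ∂(fieldLaw d ν)

/-- `r_L η`: the field `η` with `η_x` set to `0` for all `x ∈ Γ_L`. -/
def resetField {d : ℕ} (L : ℕ) (η : Fields d) : Fields d := splice (box d L) 0 η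

/-- The translate `(T_x η)_y = η_{y - x}`. -/
def shiftField {d : ℕ} (x : Fin d → ℤ) (η : Fields d) : Fields d := fun y => η (y - x)

/-- The `ℓ¹` norm of a configuration, possibly infinite. -/
def l1 {d : ℕ} (η : Fields d) : ℝ≥0∞ := ∑' x, ENNReal.ofReal |η x|

/-- The `ℓ¹`-Lipschitz seminorm. -/
def lipSeminorm {d : ℕ} (f : Fields d → ℝ) : ℝ≥0∞ :=
  ⨆ (η : Fields d) (η' : Fields d) (_ : 0 < l1 (η - η')) (_ : l1 (η - η') < ⊤),
    ENNReal.ofReal |f η - f η'| / l1 (η - η')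

section Statement

variable {σ : Type*} [Fintype σ] [DecidableEq σ] {d : ℕ} (S : LatticeSystem d σ)

/-- `𝓕` is the infinite volume free energy density, as a function of `h`: almost surely, for all
`h`, it is the limit of `F_K^h(η) / |Γ_K|`. -/
def IsFreeEnergyDensity (ν : Measure ℝ) (β : ℝ≥0∞) (ε : ℝ) (𝓕 : ℝ → ℝ) : Prop :=
  ∀ᵐ η ∂(fieldLaw d ν), ∀ h : ℝ,
    Tendsto (fun K : ℕ => S.freeEnergy β ε h K η / ((box d K).card : ℝ)) atTop (𝓝 (𝓕 h))

/-- The free energy second difference `g_{L,K}^δ(η_L)`. -/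
def secondDiff (ν : Measure ℝ) (β : ℝ≥0∞) (ε h : ℝ) (L K : ℕ) (δ : ℝ) (η : Fields d) : ℝ :=
  (1 / 2) * condAv ν (box d L)
    (fun η => S.freeEnergy β ε (h + δ) K η - S.freeEnergy β ε (h + δ) K (resetField L η)
      - S.freeEnergy β ε (h - δ) K η + S.freeEnergy β ε (h - δ) K (resetField L η)) η

/-- `g_{L,K}^δ` minus its average over the random fields. -/
def centeredDiff (ν : Measure ℝ) (β : ℝ≥0∞) (ε h : ℝ) (L K : ℕ) (δ : ℝ) (η : Fields d) : ℝ :=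
  secondDiff S ν β ε h L K δ η - ∫ η', secondDiff S ν β ε h L K δ η' ∂(fieldLaw d ν)

end Statement

/-- `g` is a distributional derivative of the function `f` of one real variable. -/
def IsDistribDeriv (f g : ℝ → ℝ) : Prop :=
  LocallyIntegrable g volume ∧ ∀ a b : ℝ, ∫ t in a..b, g t = f b - f a

/-- The one-site member of the family `G`, as a function of the single variable `η_0`. -/
def oneSite {d : ℕ} (G : ℕ → Fields d → ℝ) : ℝ → ℝ := fun t => G 0 (fun _ => t)

end DisorderedLattice

end

/-! Everything rests on concavity. On the torus the free energy is a concave function of the local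
fields θ_v = h + ε η_v, and the expectations ⟨κ_v⟩ form a supergradient (`peierls_bogoliubov`,
`LatticeSystem.freeOf_ham_le`). Since |⟨κ_v⟩| ≤ 1 in large boxes, F_K is ε-Lipschitz in η for the ℓ¹
norm. The case β = ∞ is reached from finite inverse temperatures by a pointwise limit, in which
inequalities survive.

Free energy density. Cutting a torus into smaller tori costs only boundary terms, so the mean
densities converge. The variance of a Lipschitz function of independent fields is of order |Γ_K|;
this gives almost sure convergence along K = n², boundary estimates fill the gaps between squares,
and Lipschitz dependence on h passes from rational h to all h.

The functions G_L. The reset terms in g depend only on the fields outside Γ_L, so centering removes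
them and leaves half the difference of the functions C^{h±δ}, where C^h = Av[F^h | η_{Γ_L}] − Av F^h
(`LatticeSystem.centeredDiff_eq`). These are Lipschitz uniformly in K and δ and bounded at η = 0,
hence compact for pointwise convergence (`exists_subseq_tendsto`). A diagonal extraction serves both
signs, all δ_i and all L at once. Mean zero, locality, the Lipschitz bound and covariance hold in
finite volume, the last by translation invariance of the torus, and pass to the limit by dominated
convergence.

The derivative of G_0. With all fields but η_0 averaged out, C^{h±δ} are concave functions of one
variable with slopes ε Av⟨κ_0⟩, and so are their limits. If p and q are supergradients of the two
limits, then G_0' = (p − q)/2. For β < ∞ each of p, q is Lipschitz with constant 2βε²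
(`gibbs_variation_le`); as both are nonincreasing, half their difference has constant βε². Slopes of
convergent concave functions converge wherever the limit slope is continuous. This holds everywhere
if β < ∞, and off a countable set if β = ∞, which is negligible for an absolutely continuous law. So
the mean of p is a limit of ε Av⟨κ_0⟩ at h + δ. Since Av⟨κ_0⟩ is also a supergradient of the mean
free energy density, it is squeezed between slopes of the limiting density to the right of h, and
the mean of p is ε times the right derivative. The mean of q is ε times the left derivative in the
same way. Weak FKG orders the two slopes before the limit, hence the increments of the two concave
functions. -/

set_option linter.unusedSectionVars false

namespace DisorderedLattice

/-! ### Trace inequalities for two Hermitian matrices -/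

section HermitianTraces

open Matrix

variable {n : Type*} [Fintype n] [DecidableEq n]

/-- The matrix with eigenvectors the columns of `U` and eigenvalues `f i`. -/
noncomputable def conjDiag (U : Matrix n n ℂ) (f : n → ℝ) : Matrix n n ℂ :=
  U * diagonal (fun i => (f i : ℂ)) * star U

lemma conjDiag_mul {U : Matrix n n ℂ} (hU : star U * U = 1) (f g : n → ℝ) :
    conjDiag U f * conjDiag U g = conjDiag U (fun i => f i * g i) := by
  have : conjDiag U f * conjDiag U g
      = U * diagonal (fun i => (f i : ℂ)) * (star U * U) * diagonal (fun i => (g i : ℂ)) * star U := by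
    simp only [conjDiag, mul_assoc]
  rw [this, hU, mul_one, mul_assoc U, diagonal_mul_diagonal]
  simp [conjDiag]

lemma conjDiag_one {U : Matrix n n ℂ} (hU : U * star U = 1) :
    conjDiag U (fun _ => 1) = 1 := by
  simp [conjDiag, hU]

lemma trace_conjDiag_mul_conjDiag (U V : Matrix n n ℂ) (f g : n → ℝ) :
    (conjDiag U f * conjDiag V g).trace
      = ((∑ i, ∑ j, Complex.normSq ((star U * V) i j) * (f i * g j) : ℝ) : ℂ) := by
  have h : (conjDiag U f * conjDiag V g).trace
      = (diagonal (fun i => (f i : ℂ)) * (star U * V) * diagonal (fun i => (g i : ℂ))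
        * star (star U * V)).trace := by
    simp only [conjDiag, star_mul, star_star, mul_assoc]
    rw [trace_mul_comm]
    simp only [mul_assoc]
  rw [h, trace]
  push_cast
  refine Finset.sum_congr rfl fun i _ => ?_
  rw [diag_apply, mul_apply]
  refine Finset.sum_congr rfl fun j _ => ?_
  rw [mul_diagonal, diagonal_mul, star_apply, Complex.normSq_eq_conj_mul_self]
  simp only [RCLike.star_def]
  ring

lemma exists_conjDiag {A : Matrix n n ℂ} (hA : A.IsHermitian) :
    ∃ U : Matrix n n ℂ, star U * U = 1 ∧ U * star U = 1 ∧ A = conjDiag U hA.eigenvalues ∧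
      ∀ r : ℝ, NormedSpace.exp ((r : ℂ) • A)
        = conjDiag U (fun i => Real.exp (r * hA.eigenvalues i)) := by
  have hs := hA.spectral_theorem
  have h1 : star (hA.eigenvectorUnitary : Matrix n n ℂ) * (hA.eigenvectorUnitary : Matrix n n ℂ) = 1 :=
    Unitary.star_mul_self_of_mem hA.eigenvectorUnitary.2
  have h2 : (hA.eigenvectorUnitary : Matrix n n ℂ) * star (hA.eigenvectorUnitary : Matrix n n ℂ) = 1 :=
    Unitary.mul_star_self_of_mem hA.eigenvectorUnitary.2
  rw [Unitary.conjStarAlgAut_apply] at hs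
  have hA' : A = conjDiag (hA.eigenvectorUnitary : Matrix n n ℂ) hA.eigenvalues := hs
  refine ⟨hA.eigenvectorUnitary, h1, h2, hA', fun r => ?_⟩
  generalize hA.eigenvalues = a at hA'
  generalize (hA.eigenvectorUnitary : Matrix n n ℂ) = U at *
  have hU : IsUnit U := ⟨⟨U, star U, h2, h1⟩, rfl⟩
  have hinv : star U = U⁻¹ := (inv_eq_right_inv h2).symm
  have : (r : ℂ) • A = U * diagonal (fun i => ((r * a i : ℝ) : ℂ)) * U⁻¹ := by
    rw [hA', conjDiag, hinv, ← smul_mul_assoc, ← mul_smul_comm, ← diagonal_smul]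
    congr; ext i; simp
  rw [this, exp_conj _ _ hU, conjDiag, hinv, exp_diagonal]
  congr
  ext i
  simp [Pi.coe_exp, Complex.exp_eq_exp_ℂ]

/-- Joint spectral representation of the traces built from two Hermitian matrices. -/
lemma exists_joint_spectral {A A' : Matrix n n ℂ} (hA : A.IsHermitian) (hA' : A'.IsHermitian) :
    ∃ (c : n → n → ℝ) (a a' : n → ℝ), (∀ i j, 0 ≤ c i j) ∧
      (NormedSpace.exp A).trace.re = ∑ i, ∑ j, c i j * Real.exp (a i) ∧
      (NormedSpace.exp A').trace.re = ∑ i, ∑ j, c i j * Real.exp (a' j) ∧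
      ((A' - A) * NormedSpace.exp A).trace.re
        = ∑ i, ∑ j, c i j * ((a' j - a i) * Real.exp (a i)) ∧
      ((A' - A) * NormedSpace.exp A').trace.re
        = ∑ i, ∑ j, c i j * ((a' j - a i) * Real.exp (a' j)) ∧
      ((A' - A) * (A' - A) * NormedSpace.exp A).trace.re
        = ∑ i, ∑ j, c i j * ((a' j - a i) ^ 2 * Real.exp (a i)) ∧
      ((A' - A) * (A' - A) * NormedSpace.exp A').trace.re
        = ∑ i, ∑ j, c i j * ((a' j - a i) ^ 2 * Real.exp (a' j)) := by
  obtain ⟨U, hU, hU', hAU, hE⟩ := exists_conjDiag hA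
  obtain ⟨V, hV, hV', hAV, hE'⟩ := exists_conjDiag hA'
  have e1 := hE 1
  have e2 := hE' 1
  simp only [Complex.ofReal_one, one_smul, one_mul] at e1 e2
  set a := hA.eigenvalues
  set a' := hA'.eigenvalues
  -- The weights are the squared overlaps of the two eigenbases. They are doubly stochastic, so a
  -- trace involving one matrix alone is also a double sum with the same weights.
  have key : ∀ f g : n → ℝ, (conjDiag U f * conjDiag V g).trace.re
      = ∑ i, ∑ j, Complex.normSq ((star U * V) i j) * (f i * g j) := by
    intro f g
    rw [trace_conjDiag_mul_conjDiag, Complex.ofReal_re]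
  have keyU : ∀ f : n → ℝ, (conjDiag U f).trace.re
      = ∑ i, ∑ j, Complex.normSq ((star U * V) i j) * f i := by
    intro f
    have := key f (fun _ => 1)
    simpa only [conjDiag_one hV', mul_one] using this
  have keyV : ∀ f : n → ℝ, (conjDiag V f).trace.re
      = ∑ i, ∑ j, Complex.normSq ((star U * V) i j) * f j := by
    intro f
    have := key (fun _ => 1) f
    simpa only [conjDiag_one hU', one_mul] using this
  have key' : ∀ f g : n → ℝ, (conjDiag V g * conjDiag U f).trace.re
      = ∑ i, ∑ j, Complex.normSq ((star U * V) i j) * (f i * g j) := by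
    intro f g
    rw [trace_mul_comm, key]
  refine ⟨fun i j => Complex.normSq ((star U * V) i j), a, a', fun i j => Complex.normSq_nonneg _,
    ?_, ?_, ?_, ?_, ?_, ?_⟩
  · rw [e1, keyU]
  · rw [e2, keyV]
  · rw [e1, hAU, hAV, sub_mul, conjDiag_mul hU, trace_sub, Complex.sub_re, key', keyU,
      ← Finset.sum_sub_distrib]
    refine Finset.sum_congr rfl fun i _ => ?_
    rw [← Finset.sum_sub_distrib]
    exact Finset.sum_congr rfl fun j _ => by ring
  · rw [e2, hAU, hAV, sub_mul, conjDiag_mul hV, trace_sub, Complex.sub_re, key, keyV,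
      ← Finset.sum_sub_distrib]
    refine Finset.sum_congr rfl fun i _ => ?_
    rw [← Finset.sum_sub_distrib]
    exact Finset.sum_congr rfl fun j _ => by ring
  · have : ((A' - A) * (A' - A) * NormedSpace.exp A).trace.re
        = ((A' * A') * NormedSpace.exp A).trace.re - (A' * (A * NormedSpace.exp A)).trace.re
          - (A' * (NormedSpace.exp A * A)).trace.re + (A * (A * NormedSpace.exp A)).trace.re := by
      have h : (A * A' * NormedSpace.exp A).trace = (A' * (NormedSpace.exp A * A)).trace := by
        rw [mul_assoc, trace_mul_comm, mul_assoc]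
      rw [← h]
      simp only [← Complex.sub_re, ← Complex.add_re, ← trace_sub, ← trace_add]
      congr 2
      noncomm_ring
    rw [this, e1, hAU, hAV]
    simp only [conjDiag_mul hU, conjDiag_mul hV]
    simp only [key', keyU, ← Finset.sum_sub_distrib, ← Finset.sum_add_distrib]
    exact Finset.sum_congr rfl fun i _ => Finset.sum_congr rfl fun j _ => by ring
  · have : ((A' - A) * (A' - A) * NormedSpace.exp A').trace.re
        = (A' * (A' * NormedSpace.exp A')).trace.re - (A * (NormedSpace.exp A' * A')).trace.re
          - (A * (A' * NormedSpace.exp A')).trace.re + ((A * A) * NormedSpace.exp A').trace.re := by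
      have h : (A' * A * NormedSpace.exp A').trace = (A * (NormedSpace.exp A' * A')).trace := by
        rw [mul_assoc, trace_mul_comm, mul_assoc]
      rw [← h]
      simp only [← Complex.sub_re, ← Complex.add_re, ← trace_sub, ← trace_add]
      congr 2
      noncomm_ring
    rw [this, e2, hAU, hAV]
    simp only [conjDiag_mul hU, conjDiag_mul hV]
    simp only [key, keyV, ← Finset.sum_sub_distrib, ← Finset.sum_add_distrib]
    exact Finset.sum_congr rfl fun i _ => Finset.sum_congr rfl fun j _ => by ring

open scoped Matrix.Norms.L2Operator

lemma norm_entry_le_l2_opNorm (B : Matrix n n ℂ) (i j : n) : ‖B i j‖ ≤ ‖B‖ := by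
  have h := l2_opNorm_mulVec B (EuclideanSpace.single j (1 : ℂ))
  rw [PiLp.norm_single, norm_one, mul_one] at h
  refine le_trans ?_ h
  refine le_trans (le_of_eq ?_) (PiLp.norm_apply_le _ i)
  simp

lemma trace_exp_pos [Nonempty n] {A : Matrix n n ℂ} (hA : A.IsHermitian) :
    0 < (NormedSpace.exp A).trace.re := by
  obtain ⟨U, hU, hU', -, hE⟩ := exists_conjDiag hA
  have e1 := hE 1
  simp only [Complex.ofReal_one, one_smul, one_mul] at e1
  rw [e1, conjDiag, trace_mul_comm, ← mul_assoc, hU, one_mul, trace_diagonal, Complex.re_sum]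
  exact Finset.sum_pos (fun i _ => by rw [Complex.ofReal_re]; exact Real.exp_pos _)
    Finset.univ_nonempty

/-- Spectral form of the weighted trace `Tr (B e^{rA})`. -/
lemma exists_trace_mul_exp {A : Matrix n n ℂ} (hA : A.IsHermitian) :
    ∃ b : Matrix n n ℂ → n → ℝ, (∀ B i, |b B i| ≤ ‖B‖) ∧ (∀ i, b 1 i = 1) ∧
      ∀ (B : Matrix n n ℂ) (r : ℝ), (B * NormedSpace.exp ((r : ℂ) • A)).trace.re
        = ∑ i, b B i * Real.exp (r * hA.eigenvalues i) := by
  obtain ⟨U, hU, hU', -, hE⟩ := exists_conjDiag hA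
  refine ⟨fun B i => ((star U * B * U) i i).re, fun B i => ?_, fun i => ?_, fun B r => ?_⟩
  · let W : unitary (Matrix n n ℂ) := ⟨U, Unitary.mem_iff.2 ⟨hU, hU'⟩⟩
    calc |((star U * B * U) i i).re| ≤ ‖(star U * B * U) i i‖ := Complex.abs_re_le_norm _
      _ ≤ ‖star U * B * U‖ := norm_entry_le_l2_opNorm _ _ _
      _ = ‖((star W : unitary (Matrix n n ℂ)) : Matrix n n ℂ) * B * (W : Matrix n n ℂ)‖ := rfl
      _ = ‖B‖ := by rw [CStarRing.norm_mul_coe_unitary, CStarRing.norm_coe_unitary_mul]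
  · simp [hU]
  · rw [hE, conjDiag]
    have : (B * (U * diagonal (fun i => ((Real.exp (r * hA.eigenvalues i) : ℝ) : ℂ)) * star U)).trace
        = ((star U * B * U) * diagonal (fun i => ((Real.exp (r * hA.eigenvalues i) : ℝ) : ℂ))).trace := by
      rw [← mul_assoc, trace_mul_comm]
      simp only [mul_assoc]
    rw [this, trace, Complex.re_sum]
    refine Finset.sum_congr rfl fun i _ => ?_
    rw [diag_apply, mul_diagonal, Complex.re_mul_ofReal]

lemma abs_trace_mul_exp_le {A : Matrix n n ℂ} (hA : A.IsHermitian) (B : Matrix n n ℂ) :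
    |(B * NormedSpace.exp A).trace.re| ≤ ‖B‖ * (NormedSpace.exp A).trace.re := by
  obtain ⟨b, hb, hb1, h⟩ := exists_trace_mul_exp hA
  have e1 := h B 1
  have e2 := h 1 1
  simp only [Complex.ofReal_one, one_smul, one_mul] at e1 e2
  rw [e1, e2, Finset.mul_sum]
  refine (Finset.abs_sum_le_sum_abs _ _).trans (Finset.sum_le_sum fun i _ => ?_)
  rw [abs_mul, abs_of_pos (Real.exp_pos _), hb1, one_mul]
  exact mul_le_mul_of_nonneg_right (hb B i) (Real.exp_pos _).le

/-- The Peierls–Bogoliubov inequality. -/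
lemma peierls_bogoliubov [Nonempty n] {A A' : Matrix n n ℂ} (hA : A.IsHermitian)
    (hA' : A'.IsHermitian) :
    ((A' - A) * NormedSpace.exp A).trace.re / (NormedSpace.exp A).trace.re
      ≤ Real.log (NormedSpace.exp A').trace.re - Real.log (NormedSpace.exp A).trace.re := by
  obtain ⟨c, a, a', hc, hZ, hZ', hD, -⟩ := exists_joint_spectral hA hA'
  have pZ := trace_exp_pos hA
  have pZ' := trace_exp_pos hA'
  set Z := (NormedSpace.exp A).trace.re
  set Z' := (NormedSpace.exp A').trace.re
  set D := ((A' - A) * NormedSpace.exp A).trace.re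
  set k := D / Z with hk
  -- Jensen's inequality: c i j e^{a i}/Z are probabilities under which a' j − a i has mean k. The
  -- tangent line of exp at k supplies the bound.
  have main : Real.exp k * Z ≤ Z' := by
    have h1 : Real.exp k * (Z + D - k * Z) = ∑ i, ∑ j, c i j *
        (Real.exp (a i) * Real.exp k * (1 + (a' j - a i - k))) := by
      rw [hZ, hD]
      simp only [Finset.mul_sum, ← Finset.sum_sub_distrib, ← Finset.sum_add_distrib]
      exact Finset.sum_congr rfl fun i _ => Finset.sum_congr rfl fun j _ => by ring
    have h2 : k * Z = D := by rw [hk]; field_simp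
    rw [h2, add_sub_cancel_right] at h1
    rw [h1, hZ']
    refine Finset.sum_le_sum fun i _ => Finset.sum_le_sum fun j _ =>
      mul_le_mul_of_nonneg_left ?_ (hc i j)
    have : Real.exp (a' j) = Real.exp (a i) * Real.exp k * Real.exp (a' j - a i - k) := by
      rw [← Real.exp_add, ← Real.exp_add]; congr 1; ring
    rw [this]
    refine mul_le_mul_of_nonneg_left ?_ (by positivity)
    linarith [Real.add_one_le_exp (a' j - a i - k)]
  have := Real.log_le_log (by positivity) main
  rw [Real.log_mul (Real.exp_pos _).ne' pZ.ne', Real.log_exp] at this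
  linarith

/-- The logarithmic mean of two exponentials is at most their sum. The sharp inequality has an extra
factor 1/2; the loss of this 2 is recovered at the very end, where half of a difference of two
monotone slopes is taken. -/
lemma sub_mul_exp_sub_exp_le (x y : ℝ) :
    (x - y) * (Real.exp x - Real.exp y) ≤ (x - y) ^ 2 * (Real.exp x + Real.exp y) := by
  wlog h : y ≤ x generalizing x y
  · have := this y x (le_of_not_ge h)
    nlinarith
  have h1 : Real.exp x - Real.exp y ≤ (x - y) * Real.exp x := by
    have h2 := Real.add_one_le_exp (y - x)
    have h3 : Real.exp y = Real.exp x * Real.exp (y - x) := by rw [← Real.exp_add]; congr 1; ring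
    rw [h3]
    nlinarith [Real.exp_pos x]
  have h4 := mul_le_mul_of_nonneg_left h1 (sub_nonneg.2 h)
  nlinarith [mul_nonneg (sq_nonneg (x - y)) (Real.exp_pos y).le]

/-- One step of the estimate for the variation of a Gibbs expectation. -/
lemma gibbs_increment_le [Nonempty n] {A X : Matrix n n ℂ} (hA : A.IsHermitian)
    (hX : X.IsHermitian) :
    (X * NormedSpace.exp (A + X)).trace.re / (NormedSpace.exp (A + X)).trace.re
      - (X * NormedSpace.exp A).trace.re / (NormedSpace.exp A).trace.re
      ≤ 2 * ‖X‖ ^ 2 + 4 * ‖X‖ * ((X * NormedSpace.exp (A + X)).trace.re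
        / (NormedSpace.exp (A + X)).trace.re
      - (X * NormedSpace.exp A).trace.re / (NormedSpace.exp A).trace.re) := by
  have hA' := hA.add hX
  have pb := peierls_bogoliubov hA hA'
  have pb' := peierls_bogoliubov hA' hA
  have b1 := abs_trace_mul_exp_le hA X
  have b1' := abs_trace_mul_exp_le hA' X
  have b2 := (le_abs_self _).trans (abs_trace_mul_exp_le hA (X * X))
  have b2' := (le_abs_self _).trans (abs_trace_mul_exp_le hA' (X * X))
  obtain ⟨c, a, a', hc, hZ, hZ', hD, hD', hS, hS'⟩ := exists_joint_spectral hA hA'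
  have pZ := trace_exp_pos hA
  have pZ' := trace_exp_pos hA'
  have e : A - (A + X) = -X := by abel
  rw [e, neg_mul, trace_neg, Complex.neg_re, neg_div] at pb'
  rw [add_sub_cancel_left] at pb hD hD' hS hS'
  have hXX : ‖X * X‖ ≤ ‖X‖ ^ 2 := by rw [sq]; exact norm_mul_le _ _
  set Z := (NormedSpace.exp A).trace.re
  set Z' := (NormedSpace.exp (A + X)).trace.re
  set m := (X * NormedSpace.exp A).trace.re / Z with hm
  set m' := (X * NormedSpace.exp (A + X)).trace.re / Z' with hm'
  set q := (X * X * NormedSpace.exp A).trace.re / Z with hq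
  set q' := (X * X * NormedSpace.exp (A + X)).trace.re / Z' with hq'
  have bq : q ≤ ‖X‖ ^ 2 := (div_le_iff₀ pZ).2 (b2.trans (mul_le_mul_of_nonneg_right hXX pZ.le))
  have bq' : q' ≤ ‖X‖ ^ 2 :=
    (div_le_iff₀ pZ').2 (b2'.trans (mul_le_mul_of_nonneg_right hXX pZ'.le))
  have bm : |m| ≤ ‖X‖ := by rw [hm, abs_div, abs_of_pos pZ]; exact (div_le_iff₀ pZ).2 b1
  have bm' : |m'| ≤ ‖X‖ := by rw [hm', abs_div, abs_of_pos pZ']; exact (div_le_iff₀ pZ').2 b1'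
  set k := Real.log Z' - Real.log Z with hk
  -- With both exponents normalized by their log-partition functions, m' − m is the sum of (x −
  -- y)(e^x − e^y), and the right side is the sum of (x − y)²(e^x + e^y), that is, the second
  -- moments of X − k in the two states.
  have main : m' - m ≤ (q' - 2 * k * m' + k ^ 2) + (q - 2 * k * m + k ^ 2) := by
    have l1 : m' - m = ∑ i, ∑ j, c i j * (((a' j - Real.log Z') - (a i - Real.log Z)) *
        (Real.exp (a' j - Real.log Z') - Real.exp (a i - Real.log Z))) := by
      have : m' - m = (m' - k * (Z' / Z')) - (m - k * (Z / Z)) := by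
        rw [div_self pZ.ne', div_self pZ'.ne']; ring
      rw [this, hm, hm', hD, hD']
      nth_rewrite 2 [hZ]
      nth_rewrite 2 [hZ']
      simp only [Finset.sum_div, Finset.mul_sum, ← Finset.sum_sub_distrib, Real.exp_sub,
        Real.exp_log pZ, Real.exp_log pZ']
      exact Finset.sum_congr rfl fun i _ => Finset.sum_congr rfl fun j _ => by rw [hk]; ring
    have l2 : (q' - 2 * k * m' + k ^ 2) + (q - 2 * k * m + k ^ 2)
        = ∑ i, ∑ j, c i j * (((a' j - Real.log Z') - (a i - Real.log Z)) ^ 2 *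
        (Real.exp (a' j - Real.log Z') + Real.exp (a i - Real.log Z))) := by
      have : (q' - 2 * k * m' + k ^ 2) + (q - 2 * k * m + k ^ 2)
          = (q' - 2 * k * m' + k ^ 2 * (Z' / Z')) + (q - 2 * k * m + k ^ 2 * (Z / Z)) := by
        rw [div_self pZ.ne', div_self pZ'.ne']; ring
      rw [this, hm, hm', hD, hD', hq, hq', hS, hS']
      nth_rewrite 3 [hZ]
      nth_rewrite 3 [hZ']
      simp only [Finset.sum_div, Finset.mul_sum, ← Finset.sum_sub_distrib,
        ← Finset.sum_add_distrib, Real.exp_sub, Real.exp_log pZ, Real.exp_log pZ']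
      exact Finset.sum_congr rfl fun i _ => Finset.sum_congr rfl fun j _ => by rw [hk]; ring
    rw [l1, l2]
    exact Finset.sum_le_sum fun i _ => Finset.sum_le_sum fun j _ =>
      mul_le_mul_of_nonneg_left (sub_mul_exp_sub_exp_le _ _) (hc i j)
  -- The shift k lies between the two means, so replacing each mean by k in the variances costs at
  -- most (m' − m)², a second-order term.
  have hk1 : m ≤ k := pb
  have hk2 : k ≤ m' := by linarith
  have hd : m' - m ≤ 2 * ‖X‖ := by linarith [abs_le.1 bm, abs_le.1 bm']
  have h1 : (k - m) ^ 2 ≤ (m' - m) ^ 2 := by gcongr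
  have h2 : (m' - k) ^ 2 ≤ (m' - m) ^ 2 := by gcongr
  have h3 : (m' - m) ^ 2 ≤ 2 * ‖X‖ * (m' - m) := by
    rw [sq]; exact mul_le_mul_of_nonneg_right hd (by linarith)
  nlinarith [sq_nonneg m', sq_nonneg m]

/-- A Gibbs expectation of `X` moves by at most `2 ‖X‖²` when `X` is added to the exponent. -/
lemma gibbs_variation_le [Nonempty n] {A X : Matrix n n ℂ} (hA : A.IsHermitian)
    (hX : X.IsHermitian) :
    (X * NormedSpace.exp (A + X)).trace.re / (NormedSpace.exp (A + X)).trace.re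
      - (X * NormedSpace.exp A).trace.re / (NormedSpace.exp A).trace.re ≤ 2 * ‖X‖ ^ 2 := by
  set μ : ℝ → ℝ := fun s => (X * NormedSpace.exp (A + (s : ℂ) • X)).trace.re
    / (NormedSpace.exp (A + (s : ℂ) • X)).trace.re with hμ
  have hsm : ∀ s : ℝ, ((s : ℂ) • X).IsHermitian := fun s => by
    rw [Matrix.IsHermitian, conjTranspose_smul, hX.eq]; simp
  -- Split the path from A to A + X into N equal steps. On a step X/N the quadratic error of
  -- `gibbs_increment_le` is absorbed on the left, turning N into N − 4‖X‖. The sum of N steps tends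
  -- to 2‖X‖², without differentiating the matrix exponential.
  have step : ∀ N : ℕ, 0 < N → 4 * ‖X‖ < N → ∀ s : ℝ,
      μ (s + 1 / N) - μ s ≤ 2 * ‖X‖ ^ 2 / (N - 4 * ‖X‖) := by
    intro N hN hN' s
    have hN0 : (0 : ℝ) < N := by exact_mod_cast hN
    have h := gibbs_increment_le (hA.add (hsm s)) (hsm (1 / N))
    have e : A + (s : ℂ) • X + ((1 / N : ℝ) : ℂ) • X = A + ((s + 1 / N : ℝ) : ℂ) • X := by
      rw [add_assoc, ← add_smul]; push_cast; rfl
    have hn : ‖((1 / N : ℝ) : ℂ) • X‖ = ‖X‖ / N := by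
      rw [norm_smul, Complex.norm_real, Real.norm_of_nonneg (by positivity)]; ring
    rw [e, hn] at h
    have hr : ∀ Y : Matrix n n ℂ, ((((1 / N : ℝ) : ℂ) • X) * Y).trace.re = (X * Y).trace.re / N := by
      intro Y
      rw [smul_mul_assoc, trace_smul, smul_eq_mul, Complex.re_ofReal_mul]; ring
    simp only [hr] at h
    have h' : (μ (s + 1 / N) - μ s) / N
        ≤ 2 * (‖X‖ / N) ^ 2 + 4 * (‖X‖ / N) * ((μ (s + 1 / N) - μ s) / N) := by
      simp only [hμ]
      convert h using 1 <;> ring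
    rw [le_div_iff₀ (by linarith)]
    generalize μ (s + 1 / N) - μ s = D at h' ⊢
    have h2 := mul_le_mul_of_nonneg_right h' (sq_nonneg (N : ℝ))
    field_simp at h2
    nlinarith
  have tele : ∀ N : ℕ, 0 < N → 4 * ‖X‖ < N → ∀ k : ℕ,
      μ (k / N) - μ 0 ≤ k * (2 * ‖X‖ ^ 2 / (N - 4 * ‖X‖)) := by
    intro N hN hN' k
    induction k with
    | zero => simp
    | succ k ih =>
      have := step N hN hN' (k / N)
      rw [← add_div] at this
      push_cast
      linarith
  have fin : ∀ᶠ N : ℕ in atTop, μ 1 - μ 0 ≤ N * (2 * ‖X‖ ^ 2 / (N - 4 * ‖X‖)) := by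
    obtain ⟨N0, hN0⟩ := exists_nat_gt (4 * ‖X‖)
    filter_upwards [eventually_ge_atTop (N0 + 1)] with N hN
    have h1 : 4 * ‖X‖ < N := hN0.trans_le (by exact_mod_cast (Nat.le_succ N0).trans hN)
    have h2 : 0 < N := by omega
    have := tele N h2 h1 N
    rwa [div_self (by exact_mod_cast h2.ne')] at this
  have lim : Tendsto (fun N : ℕ => (N : ℝ) * (2 * ‖X‖ ^ 2 / (N - 4 * ‖X‖))) atTop
      (𝓝 (2 * ‖X‖ ^ 2)) := by
    have h1 : Tendsto (fun N : ℕ => 2 * ‖X‖ ^ 2 * ((N : ℝ) / (N + (-(4 * ‖X‖))))) atTop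
        (𝓝 (2 * ‖X‖ ^ 2 * 1)) :=
      (tendsto_natCast_div_add_atTop (-(4 * ‖X‖))).const_mul _
    rw [mul_one] at h1
    refine h1.congr fun N => ?_
    rw [← sub_eq_add_neg]; ring
  have := ge_of_tendsto lim fin
  simpa [hμ] using this

end HermitianTraces

end DisorderedLattice

namespace DisorderedLattice

/-! ### Free energies and equilibrium states for 0 < β ≤ ∞, as limits along `tempFilter` -/

section EquilibriumStates

open Matrix
open scoped Matrix.Norms.L2Operator

variable {n : Type*} [Fintype n] [DecidableEq n]

/-- Free energy of the Hamiltonian `H` at finite inverse temperature `b`. -/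
noncomputable def freeAt (b : ℝ) (H : Matrix n n ℂ) : ℝ :=
  -b⁻¹ * Real.log (NormedSpace.exp (((-b : ℝ) : ℂ) • H)).trace.re

/-- Gibbs expectation of `B` at finite inverse temperature `b`. -/
noncomputable def gibbsAt (b : ℝ) (H B : Matrix n n ℂ) : ℝ :=
  (B * NormedSpace.exp (((-b : ℝ) : ℂ) • H)).trace.re /
    (NormedSpace.exp (((-b : ℝ) : ℂ) • H)).trace.re

open Classical in
/-- Free energy at inverse temperature `β ≤ ∞`. -/
noncomputable def freeOf (β : ℝ≥0∞) (H : Matrix n n ℂ) : ℝ :=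
  if β = ⊤ then sInf (spectrum ℝ H) else freeAt β.toReal H

open Classical in
/-- Equilibrium expectation at inverse temperature `β ≤ ∞`. -/
noncomputable def stateOf (β : ℝ≥0∞) (H B : Matrix n n ℂ) : ℝ :=
  if β = ⊤ then limUnder atTop (fun b : ℝ => gibbsAt b H B) else gibbsAt β.toReal H B

open Classical in
/-- The filter of finite inverse temperatures that approach `β`. -/
noncomputable def tempFilter (β : ℝ≥0∞) : Filter ℝ := if β = ⊤ then atTop else pure β.toReal

instance (β : ℝ≥0∞) : (tempFilter β).NeBot := by
  unfold tempFilter; split_ifs <;> infer_instance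

instance (β : ℝ≥0∞) : (tempFilter β).IsCountablyGenerated := by
  unfold tempFilter; split_ifs <;> infer_instance

lemma tempFilter_pos {β : ℝ≥0∞} (hβ : β ≠ 0) : ∀ᶠ b in tempFilter β, 0 < b := by
  unfold tempFilter
  split_ifs with h
  · exact eventually_gt_atTop 0
  · exact ENNReal.toReal_pos hβ h

/-- At β = ∞ the conventions `(⊤).toReal = 0` and `0⁻¹ = 0` give the correct limiting temperature.
-/
lemma tendsto_tempFilter_inv (β : ℝ≥0∞) :
    Tendsto (fun b : ℝ => b⁻¹) (tempFilter β) (𝓝 (β.toReal)⁻¹) := by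
  unfold tempFilter
  split_ifs with h
  · simpa [h] using tendsto_inv_atTop_zero
  · exact tendsto_pure_nhds _ _

lemma isHermitian_real_smul {H : Matrix n n ℂ} (hH : H.IsHermitian) (r : ℝ) :
    ((r : ℂ) • H).IsHermitian := by
  rw [Matrix.IsHermitian, conjTranspose_smul, hH.eq]; simp

lemma trace_exp_eq_sum {H : Matrix n n ℂ} (hH : H.IsHermitian) (r : ℝ) :
    (NormedSpace.exp ((r : ℂ) • H)).trace.re = ∑ i, Real.exp (r * hH.eigenvalues i) := by
  obtain ⟨b, -, hb1, h⟩ := exists_trace_mul_exp hH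
  simpa [hb1] using h 1 r

/-- At β = ∞, the partition function lies between e^{−b a} and n e^{−b a} with a the lowest
eigenvalue, so the entropy correction is at most b⁻¹ log n. -/
lemma tendsto_freeAt [Nonempty n] {H : Matrix n n ℂ} (hH : H.IsHermitian) {β : ℝ≥0∞} :
    Tendsto (fun b => freeAt b H) (tempFilter β) (𝓝 (freeOf β H)) := by
  unfold tempFilter freeOf
  split_ifs with h
  swap
  · exact tendsto_pure_nhds _ _
  rw [hH.spectrum_real_eq_range_eigenvalues]
  set a := hH.eigenvalues with ha
  obtain ⟨i0, -, hi0⟩ := Finset.exists_min_image Finset.univ a Finset.univ_nonempty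
  have hmin : sInf (Set.range a) = a i0 := by
    refine le_antisymm (csInf_le (Set.finite_range a).bddBelow ⟨i0, rfl⟩)
      (le_csInf (Set.range_nonempty a) ?_)
    rintro _ ⟨i, rfl⟩
    exact hi0 i (Finset.mem_univ i)
  rw [hmin]
  have hlim : Tendsto (fun b : ℝ => a i0 - b⁻¹ * Real.log (Fintype.card n)) atTop
      (𝓝 (a i0 - 0 * Real.log (Fintype.card n))) :=
    tendsto_const_nhds.sub (tendsto_inv_atTop_zero.mul_const _)
  rw [zero_mul, sub_zero] at hlim
  refine tendsto_of_tendsto_of_tendsto_of_le_of_le' hlim tendsto_const_nhds ?_ ?_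
  · filter_upwards [eventually_gt_atTop 0] with b hb
    unfold freeAt
    rw [trace_exp_eq_sum hH]
    have h1 : ∑ i, Real.exp (-b * a i) ≤ Fintype.card n * Real.exp (-b * a i0) := by
      rw [← nsmul_eq_mul, ← Finset.card_univ, ← Finset.sum_const]
      refine Finset.sum_le_sum fun i hi => Real.exp_le_exp.2 ?_
      have := hi0 i hi
      nlinarith
    have h2 : 0 < ∑ i, Real.exp (-b * a i) :=
      Finset.sum_pos (fun i _ => Real.exp_pos _) Finset.univ_nonempty
    have h3 := Real.log_le_log h2 h1
    rw [Real.log_mul (by simp) (Real.exp_pos _).ne', Real.log_exp] at h3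
    have h4 := mul_le_mul_of_nonneg_left h3 (inv_pos.2 hb).le
    have h5 : b⁻¹ * (Real.log (Fintype.card n) + -b * a i0)
        = b⁻¹ * Real.log (Fintype.card n) - a i0 := by field_simp; ring
    linarith
  · filter_upwards [eventually_gt_atTop 0] with b hb
    unfold freeAt
    rw [trace_exp_eq_sum hH]
    have h1 : Real.exp (-b * a i0) ≤ ∑ i, Real.exp (-b * a i) :=
      Finset.single_le_sum (f := fun i => Real.exp (-b * a i))
        (fun i _ => (Real.exp_pos _).le) (Finset.mem_univ i0)
    have h3 := Real.log_le_log (Real.exp_pos _) h1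
    rw [Real.log_exp] at h3
    have h4 := mul_le_mul_of_nonneg_left h3 (inv_pos.2 hb).le
    have h5 : b⁻¹ * (-b * a i0) = - a i0 := by field_simp
    linarith

/-- Convergence makes the `limUnder` in `stateOf` meaningful. Once the ground state factor is
divided out, the weights of the excited levels vanish and those of the ground states equal 1. -/
lemma tendsto_gibbsAt [Nonempty n] {H : Matrix n n ℂ} (hH : H.IsHermitian) (B : Matrix n n ℂ)
    {β : ℝ≥0∞} : Tendsto (fun b => gibbsAt b H B) (tempFilter β) (𝓝 (stateOf β H B)) := by
  unfold tempFilter stateOf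
  split_ifs with h
  swap
  · exact tendsto_pure_nhds _ _
  refine tendsto_nhds_limUnder ?_
  obtain ⟨w, -, hw1, hw⟩ := exists_trace_mul_exp hH
  set a := hH.eigenvalues with ha
  obtain ⟨i0, -, hi0⟩ := Finset.exists_min_image Finset.univ a Finset.univ_nonempty
  have hexp : ∀ i, Tendsto (fun b : ℝ => Real.exp (-b * (a i - a i0))) atTop
      (𝓝 (if a i = a i0 then 1 else 0)) := by
    intro i
    split_ifs with hi
    · simp [hi]
    · have hlt : 0 < a i - a i0 :=
        sub_pos.2 (lt_of_le_of_ne (hi0 i (Finset.mem_univ i)) (Ne.symm hi))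
      refine Real.tendsto_exp_atBot.comp ?_
      simp only [neg_mul]
      exact tendsto_neg_atTop_atBot.comp (tendsto_id.atTop_mul_const hlt)
  have hnum : ∀ f : n → ℝ, Tendsto (fun b : ℝ => ∑ i, f i * Real.exp (-b * (a i - a i0))) atTop
      (𝓝 (∑ i, f i * (if a i = a i0 then 1 else 0))) := fun f =>
    tendsto_finsetSum _ fun i _ => (hexp i).const_mul _
  have hden : (∑ i, (1 : ℝ) * (if a i = a i0 then 1 else 0)) ≠ 0 := by
    refine (Finset.sum_pos' (fun i _ => by positivity) ⟨i0, Finset.mem_univ _, by simp⟩).ne'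
  refine ⟨_, ((hnum (w B)).div (hnum fun _ => 1) hden).congr fun b => ?_⟩
  have e1 := hw 1 (-b)
  rw [one_mul] at e1
  rw [Pi.div_apply, gibbsAt, hw, e1]
  have hsc : ∀ f : n → ℝ, ∑ i, f i * Real.exp (-b * (a i - a i0))
      = Real.exp (b * a i0) * ∑ i, f i * Real.exp (-b * a i) := by
    intro f
    rw [Finset.mul_sum]
    refine Finset.sum_congr rfl fun i _ => ?_
    rw [mul_left_comm, ← Real.exp_add]
    congr 2; ring
  rw [hsc, hsc, mul_div_mul_left _ _ (Real.exp_pos _).ne']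
  simp only [hw1]

/-- Concavity of the free energy in supergradient form: `peierls_bogoliubov` for −bH and −b(H + B),
reversed on dividing by −b. -/
lemma freeAt_add_le [Nonempty n] {H B : Matrix n n ℂ} (hH : H.IsHermitian) (hB : B.IsHermitian)
    {b : ℝ} (hb : 0 < b) : freeAt b (H + B) ≤ freeAt b H + gibbsAt b H B := by
  have h := peierls_bogoliubov (isHermitian_real_smul hH (-b))
    (isHermitian_real_smul (hH.add hB) (-b))
  rw [← smul_sub, add_sub_cancel_left, smul_mul_assoc, trace_smul, smul_eq_mul,
    Complex.re_ofReal_mul] at h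
  have h2 := mul_le_mul_of_nonneg_left h (inv_pos.2 hb).le
  unfold freeAt gibbsAt
  rw [mul_div_assoc, ← mul_assoc, mul_neg, inv_mul_cancel₀ hb.ne'] at h2
  linarith

lemma freeOf_add_le [Nonempty n] {H B : Matrix n n ℂ} (hH : H.IsHermitian) (hB : B.IsHermitian)
    {β : ℝ≥0∞} (hβ : β ≠ 0) : freeOf β (H + B) ≤ freeOf β H + stateOf β H B :=
  le_of_tendsto_of_tendsto (tendsto_freeAt (hH.add hB))
    ((tendsto_freeAt hH).add (tendsto_gibbsAt hH B))
    ((tempFilter_pos hβ).mono fun _ hb => freeAt_add_le hH hB hb)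

lemma abs_stateOf_le [Nonempty n] {H : Matrix n n ℂ} (hH : H.IsHermitian) (B : Matrix n n ℂ)
    (β : ℝ≥0∞) : |stateOf β H B| ≤ ‖B‖ := by
  refine le_of_tendsto (tendsto_gibbsAt hH B).abs (Eventually.of_forall fun b => ?_)
  have hZ := trace_exp_pos (isHermitian_real_smul hH (-b))
  rw [gibbsAt, abs_div, abs_of_pos hZ, div_le_iff₀ hZ]
  exact abs_trace_mul_exp_le (isHermitian_real_smul hH (-b)) B

lemma stateOf_add [Nonempty n] {H : Matrix n n ℂ} (hH : H.IsHermitian) (B C : Matrix n n ℂ)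
    (β : ℝ≥0∞) : stateOf β H (B + C) = stateOf β H B + stateOf β H C := by
  refine tendsto_nhds_unique (tendsto_gibbsAt hH (B + C))
    (((tendsto_gibbsAt hH B).add (tendsto_gibbsAt hH C)).congr fun b => ?_)
  simp only [gibbsAt, add_mul, trace_add, Complex.add_re, add_div]

lemma stateOf_smul [Nonempty n] {H : Matrix n n ℂ} (hH : H.IsHermitian) (r : ℝ)
    (B : Matrix n n ℂ) (β : ℝ≥0∞) : stateOf β H ((r : ℂ) • B) = r * stateOf β H B := by
  refine tendsto_nhds_unique (tendsto_gibbsAt hH _)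
    (((tendsto_gibbsAt hH B).const_mul r).congr fun b => ?_)
  simp only [gibbsAt, smul_mul_assoc, trace_smul, smul_eq_mul, Complex.re_ofReal_mul, mul_div_assoc]

lemma stateOf_sum [Nonempty n] {H : Matrix n n ℂ} (hH : H.IsHermitian) {ι : Type*} (s : Finset ι)
    (B : ι → Matrix n n ℂ) (β : ℝ≥0∞) :
    stateOf β H (∑ i ∈ s, B i) = ∑ i ∈ s, stateOf β H (B i) := by
  classical
  induction s using Finset.induction_on with
  | empty =>
    have := stateOf_add hH 0 0 β
    simp only [add_zero] at this
    simp only [Finset.sum_empty]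
    linarith
  | insert a s ha ih => rw [Finset.sum_insert ha, Finset.sum_insert ha, stateOf_add hH, ih]

/-- `gibbs_variation_le` with increment −bB bounds b times the left side by 2b²‖B‖². -/
lemma stateOf_sub_stateOf_add_le [Nonempty n] {H B : Matrix n n ℂ} (hH : H.IsHermitian)
    (hB : B.IsHermitian) {β : ℝ≥0∞} (hβ : β ≠ 0) (hβ' : β ≠ ⊤) :
    stateOf β H B - stateOf β (H + B) B ≤ 2 * β.toReal * ‖B‖ ^ 2 := by
  have hb := ENNReal.toReal_pos hβ hβ'
  simp only [stateOf, hβ', if_false, gibbsAt]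
  generalize β.toReal = b at hb
  have h := gibbs_variation_le (isHermitian_real_smul hH (-b)) (isHermitian_real_smul hB (-b))
  simp only [← smul_add, smul_mul_assoc, trace_smul, smul_eq_mul, Complex.re_ofReal_mul, norm_smul,
    Complex.norm_real, norm_neg, Real.norm_of_nonneg hb.le, mul_div_assoc] at h
  rw [mul_pow] at h
  refine le_of_mul_le_mul_left ?_ hb
  linarith

lemma abs_freeOf_sub_le [Nonempty n] {H H' : Matrix n n ℂ} (hH : H.IsHermitian)
    (hH' : H'.IsHermitian) {β : ℝ≥0∞} (hβ : β ≠ 0) :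
    |freeOf β H - freeOf β H'| ≤ ‖H - H'‖ := by
  have h1 := freeOf_add_le hH' (hH.sub hH') hβ
  have h2 := freeOf_add_le hH (hH'.sub hH) hβ
  have b1 := abs_stateOf_le hH' (H - H') β
  have b2 := abs_stateOf_le hH (H' - H) β
  rw [add_sub_cancel] at h1 h2
  rw [norm_sub_rev] at b2
  rw [abs_le] at *
  constructor <;> linarith

lemma continuous_gibbsAt [Nonempty n] {X : Type*} [TopologicalSpace X] {H : X → Matrix n n ℂ}
    (hc : Continuous H) (hH : ∀ x, (H x).IsHermitian) (b : ℝ) (B : Matrix n n ℂ) :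
    Continuous fun x => gibbsAt b (H x) B := by
  have he : Continuous fun x => NormedSpace.exp (((-b : ℝ) : ℂ) • H x) := by
    let _ : NormedAlgebra ℚ (Matrix n n ℂ) := NormedAlgebra.restrictScalars ℚ ℂ _
    have hc' : Continuous fun x => ((-b : ℝ) : ℂ) • H x :=
      continuous_matrix fun i j => (hc.matrix_elem i j).const_smul (((-b : ℝ) : ℂ))
    exact NormedSpace.exp_continuous.comp hc'
  refine Continuous.div ?_ ?_ fun x => (trace_exp_pos (isHermitian_real_smul (hH x) (-b))).ne'
  · exact Complex.continuous_re.comp ((continuous_const.mul he).matrix_trace)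
  · exact Complex.continuous_re.comp he.matrix_trace

/-- At β = ∞ the state may jump at level crossings, so continuity can fail; it is still a pointwise
limit of continuous functions. -/
lemma measurable_stateOf [Nonempty n] {X : Type*} [TopologicalSpace X] [MeasurableSpace X]
    [OpensMeasurableSpace X] {H : X → Matrix n n ℂ} (hc : Continuous H)
    (hH : ∀ x, (H x).IsHermitian) (β : ℝ≥0∞) (B : Matrix n n ℂ) :
    Measurable fun x => stateOf β (H x) B :=
  measurable_of_tendsto_metrizable' (tempFilter β)
    (fun b => (continuous_gibbsAt hc hH b B).measurable)
    (tendsto_pi_nhds.2 fun x => tendsto_gibbsAt (hH x) B)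

/-- Free energy relative to the normalized trace. -/
noncomputable def nfree (β : ℝ≥0∞) (H : Matrix n n ℂ) : ℝ :=
  freeOf β H + (β.toReal)⁻¹ * Real.log (Fintype.card n)

lemma tendsto_nfree [Nonempty n] {H : Matrix n n ℂ} (hH : H.IsHermitian) (β : ℝ≥0∞) :
    Tendsto (fun b : ℝ => -b⁻¹ * Real.log
        ((NormedSpace.exp (((-b : ℝ) : ℂ) • H)).trace.re / Fintype.card n))
      (tempFilter β) (𝓝 (nfree β H)) := by
  refine ((tendsto_freeAt hH).add ((tendsto_tempFilter_inv β).mul_const _)).congr fun b => ?_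
  rw [Real.log_div (trace_exp_pos (isHermitian_real_smul hH (-b))).ne' (by simp), freeAt]
  ring

lemma abs_nfree_sub_le [Nonempty n] {H H' : Matrix n n ℂ} (hH : H.IsHermitian)
    (hH' : H'.IsHermitian) {β : ℝ≥0∞} (hβ : β ≠ 0) :
    |nfree β H - nfree β H'| ≤ ‖H - H'‖ := by
  unfold nfree
  rw [add_sub_add_right_eq_sub]
  exact abs_freeOf_sub_le hH hH' hβ

end EquilibriumStates

/-! ### The embedding M ↦ M ⊗ 1 and its effect on traces, norms and free energies -/

section Embedding

open Matrix
open scoped Matrix.Norms.L2Operator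

variable {σ A V W : Type*} [Fintype σ] [DecidableEq σ] [Fintype A] [DecidableEq A]
  [Fintype V] [DecidableEq V] [Fintype W] [DecidableEq W]

open Classical in
lemma sum_agree_off_range {f : A → V} (hf : Function.Injective f) (t : V → σ)
    {M : Type*} [AddCommMonoid M] (g : (A → σ) → M) :
    (∑ u : V → σ, if ∀ v, v ∉ Set.range f → u v = t v then g (u ∘ f) else 0) = ∑ w, g w := by
  rw [← Finset.sum_filter]
  refine Finset.sum_nbij' (fun u => u ∘ f) (fun w => Function.extend f w t) ?_ ?_ ?_ ?_ ?_
  · simp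
  · intro w _
    rw [Finset.mem_filter]
    refine ⟨Finset.mem_univ _, fun v hv => Function.extend_apply' _ _ _ hv⟩
  · intro u hu
    rw [Finset.mem_filter] at hu
    ext v
    by_cases hv : v ∈ Set.range f
    · obtain ⟨a, rfl⟩ := hv
      rw [hf.extend_apply, Function.comp_apply]
    · rw [Function.extend_apply' _ _ _ hv, hu.2 v hv]
  · intro w _
    exact Function.extend_comp hf _ _
  · simp

lemma embedOp_apply_of_agree {f : A → V} (M : Matrix (A → σ) (A → σ) ℂ) {s t : V → σ}
    (h : ∀ v, v ∉ Set.range f → s v = t v) : embedOp f M s t = M (s ∘ f) (t ∘ f) := by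
  simp only [embedOp, of_apply, if_pos h]

lemma embedOp_apply_of_not {f : A → V} (M : Matrix (A → σ) (A → σ) ℂ) {s t : V → σ}
    (h : ¬ ∀ v, v ∉ Set.range f → s v = t v) : embedOp f M s t = 0 := by
  simp only [embedOp, of_apply, if_neg h]

lemma embedOp_mul {f : A → V} (hf : Function.Injective f) (M N : Matrix (A → σ) (A → σ) ℂ) :
    embedOp f (M * N) = embedOp f M * embedOp f N := by
  classical
  ext s t
  rw [mul_apply]
  by_cases h : ∀ v, v ∉ Set.range f → s v = t v
  · rw [embedOp_apply_of_agree _ h, mul_apply, ← sum_agree_off_range hf t]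
    refine Finset.sum_congr rfl fun u _ => ?_
    split_ifs with hu
    · rw [embedOp_apply_of_agree _ hu,
        embedOp_apply_of_agree _ fun v hv => (h v hv).trans (hu v hv).symm]
    · rw [embedOp_apply_of_not N hu, mul_zero]
  · rw [embedOp_apply_of_not _ h]
    refine (Finset.sum_eq_zero fun u _ => ?_).symm
    by_cases hu : ∀ v, v ∉ Set.range f → u v = t v
    · rw [embedOp_apply_of_not M, zero_mul]
      exact fun hs => h fun v hv => (hs v hv).trans (hu v hv)
    · rw [embedOp_apply_of_not N hu, mul_zero]

lemma embedOp_one (f : A → V) :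
    embedOp f (1 : Matrix (A → σ) (A → σ) ℂ) = 1 := by
  ext s t
  by_cases h : ∀ v, v ∉ Set.range f → s v = t v
  · rw [embedOp_apply_of_agree _ h, one_apply, one_apply]
    congr 1
    refine propext ⟨fun e => funext fun v => ?_, fun e => by rw [e]⟩
    by_cases hv : v ∈ Set.range f
    · obtain ⟨a, rfl⟩ := hv
      exact congrFun e a
    · exact h v hv
  · rw [embedOp_apply_of_not _ h, one_apply_ne]
    rintro rfl
    exact h fun _ _ => rfl

/-- `M ↦ M ⊗ 1` as a unital `*`-homomorphism. -/
noncomputable def embedHom (f : A → V) (hf : Function.Injective f) :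
    Matrix (A → σ) (A → σ) ℂ →⋆ₐ[ℂ] Matrix (V → σ) (V → σ) ℂ where
  toFun := embedOp f
  map_one' := embedOp_one f
  map_mul' := embedOp_mul hf
  map_zero' := by
    ext s t
    simp [embedOp]
  map_add' M N := by
    ext s t
    by_cases h : ∀ v, v ∉ Set.range f → s v = t v
    · simp only [Matrix.add_apply, embedOp_apply_of_agree _ h]
    · simp only [Matrix.add_apply, embedOp_apply_of_not _ h, add_zero]
  commutes' r := by
    rw [Algebra.algebraMap_eq_smul_one, Algebra.algebraMap_eq_smul_one, ← embedOp_one f]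
    ext s t
    by_cases h : ∀ v, v ∉ Set.range f → s v = t v
    · simp only [Matrix.smul_apply, embedOp_apply_of_agree _ h]
    · simp only [Matrix.smul_apply, embedOp_apply_of_not _ h, smul_zero]
  map_star' M := by
    ext s t
    rw [star_apply]
    by_cases h : ∀ v, v ∉ Set.range f → s v = t v
    · rw [embedOp_apply_of_agree _ h, embedOp_apply_of_agree _ fun v hv => (h v hv).symm, star_apply]
    · rw [embedOp_apply_of_not _ h, embedOp_apply_of_not, star_zero]
      exact fun h' => h fun v hv => (h' v hv).symm

lemma embedOp_sum {f : A → V} (hf : Function.Injective f) {ι : Type*} (s : Finset ι)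
    (M : ι → Matrix (A → σ) (A → σ) ℂ) :
    embedOp f (∑ i ∈ s, M i) = ∑ i ∈ s, embedOp f (M i) :=
  map_sum (embedHom f hf) M s

lemma embedOp_add {f : A → V} (hf : Function.Injective f) (M N : Matrix (A → σ) (A → σ) ℂ) :
    embedOp f (M + N) = embedOp f M + embedOp f N :=
  map_add (embedHom f hf) M N

lemma embedOp_smul {f : A → V} (hf : Function.Injective f) (c : ℂ)
    (M : Matrix (A → σ) (A → σ) ℂ) : embedOp f (c • M) = c • embedOp f M :=
  map_smul (embedHom f hf) c M

lemma embedOp_isHermitian (f : A → V) {M : Matrix (A → σ) (A → σ) ℂ}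
    (hM : M.IsHermitian) : (embedOp f M).IsHermitian := by
  ext s t
  rw [conjTranspose_apply]
  by_cases h : ∀ v, v ∉ Set.range f → s v = t v
  · rw [embedOp_apply_of_agree _ h, embedOp_apply_of_agree _ fun v hv => (h v hv).symm, hM.apply]
  · rw [embedOp_apply_of_not _ h, embedOp_apply_of_not, star_zero]
    exact fun h' => h fun v hv => (h' v hv).symm

lemma norm_embedOp_le {f : A → V} (hf : Function.Injective f) (M : Matrix (A → σ) (A → σ) ℂ) :
    ‖embedOp f M‖ ≤ ‖M‖ :=
  NonUnitalStarAlgHom.norm_apply_le (embedHom f hf) M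

lemma embedOp_embedOp {f : A → V} {g : V → W} (hg : Function.Injective g)
    (M : Matrix (A → σ) (A → σ) ℂ) : embedOp g (embedOp f M) = embedOp (g ∘ f) M := by
  ext s t
  by_cases h : ∀ v, v ∉ Set.range (g ∘ f) → s v = t v
  · have h1 : ∀ v, v ∉ Set.range g → s v = t v := fun v hv => h v fun ⟨a, ha⟩ => hv ⟨f a, ha⟩
    have h2 : ∀ v, v ∉ Set.range f → (s ∘ g) v = (t ∘ g) v := fun v hv =>
      h (g v) fun ⟨a, ha⟩ => hv ⟨a, hg ha⟩
    rw [embedOp_apply_of_agree _ h, embedOp_apply_of_agree _ h1, embedOp_apply_of_agree _ h2]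
    rfl
  · rw [embedOp_apply_of_not _ h]
    by_cases h1 : ∀ v, v ∉ Set.range g → s v = t v
    · rw [embedOp_apply_of_agree _ h1, embedOp_apply_of_not]
      intro h2
      refine h fun v hv => ?_
      by_cases hvg : v ∈ Set.range g
      · obtain ⟨u, rfl⟩ := hvg
        exact h2 u fun ⟨a, ha⟩ => hv ⟨a, by rw [← ha]; rfl⟩
      · exact h1 v hvg
    · rw [embedOp_apply_of_not _ h1]

/-- Double counting of the pairs (t, u) of configurations that agree off the range of f; the product
form needs no count of the sites outside the range. -/
lemma trace_embedOp {f : A → V} (hf : Function.Injective f) (M : Matrix (A → σ) (A → σ) ℂ) :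
    (Fintype.card (A → σ) : ℂ) * (embedOp f M).trace = Fintype.card (V → σ) * M.trace := by
  classical
  have h1 : (embedOp f M).trace = ∑ s : V → σ, M (s ∘ f) (s ∘ f) :=
    Finset.sum_congr rfl fun s _ => embedOp_apply_of_agree M fun _ _ => rfl
  have h2 : ∑ t : V → σ, ∑ u : V → σ,
      (if ∀ v, v ∉ Set.range f → u v = t v then M (u ∘ f) (u ∘ f) else 0)
      = Fintype.card (V → σ) * M.trace := by
    simp only [sum_agree_off_range hf _ fun w => M w w, Finset.sum_const, Finset.card_univ,
      nsmul_eq_mul]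
    rfl
  rw [← h2, Finset.sum_comm, h1, Finset.mul_sum]
  refine Finset.sum_congr rfl fun u _ => ?_
  have h3 : ∑ t : V → σ, (if ∀ v, v ∉ Set.range f → t v = u v then (1 : ℂ) else 0)
      = Fintype.card (A → σ) := by
    rw [sum_agree_off_range hf u fun _ => (1 : ℂ)]
    simp
  rw [← h3, Finset.sum_mul]
  refine Finset.sum_congr rfl fun t _ => ?_
  simp only [ite_mul, one_mul, zero_mul]
  congr 1
  exact propext ⟨fun h v hv => (h v hv).symm, fun h v hv => (h v hv).symm⟩

lemma exp_embedOp {f : A → V} (hf : Function.Injective f) (M : Matrix (A → σ) (A → σ) ℂ) :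
    NormedSpace.exp (embedOp f M) = embedOp f (NormedSpace.exp M) := by
  have hc : Continuous (embedHom (σ := σ) f hf) :=
    (embedHom (σ := σ) f hf).toAlgHom.toLinearMap.continuous_of_finiteDimensional
  let _ : NormedAlgebra ℚ (Matrix (A → σ) (A → σ) ℂ) := NormedAlgebra.restrictScalars ℚ ℂ _
  let _ : NormedAlgebra ℚ (Matrix (V → σ) (V → σ) ℂ) := NormedAlgebra.restrictScalars ℚ ℂ _
  exact (NormedSpace.map_exp (embedHom f hf) hc M).symm

variable [Nonempty σ]

lemma trace_embedOp_re_div {f : A → V} (hf : Function.Injective f)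
    (M : Matrix (A → σ) (A → σ) ℂ) :
    (embedOp f M).trace.re / Fintype.card (V → σ) = M.trace.re / Fintype.card (A → σ) := by
  have h := congrArg Complex.re (trace_embedOp hf M)
  rw [← Complex.ofReal_natCast, ← Complex.ofReal_natCast, Complex.re_ofReal_mul,
    Complex.re_ofReal_mul] at h
  have h1 : (Fintype.card (A → σ) : ℝ) ≠ 0 := by exact_mod_cast Fintype.card_ne_zero
  have h2 : (Fintype.card (V → σ) : ℝ) ≠ 0 := by exact_mod_cast Fintype.card_ne_zero
  rw [div_eq_div_iff h2 h1]
  linarith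

/-- The reason for the normalized trace: idle sites do not contribute, so free energies of regions
of different size can be compared without a log-dimension term. -/
lemma nfree_embedOp {f : A → V} (hf : Function.Injective f) {H : Matrix (A → σ) (A → σ) ℂ}
    (hH : H.IsHermitian) (β : ℝ≥0∞) : nfree β (embedOp f H) = nfree β H := by
  refine tendsto_nhds_unique (tendsto_nfree (embedOp_isHermitian f hH) β)
    ((tendsto_nfree hH β).congr fun b => ?_)
  rw [← embedOp_smul hf, exp_embedOp hf, trace_embedOp_re_div hf]

lemma stateOf_embedOp {f : A → V} (hf : Function.Injective f) {H : Matrix (A → σ) (A → σ) ℂ}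
    (hH : H.IsHermitian) (B : Matrix (A → σ) (A → σ) ℂ) (β : ℝ≥0∞) :
    stateOf β (embedOp f H) (embedOp f B) = stateOf β H B := by
  refine tendsto_nhds_unique (tendsto_gibbsAt (embedOp_isHermitian f hH) _)
    ((tendsto_gibbsAt hH B).congr fun b => ?_)
  have h1 : (Fintype.card (A → σ) : ℝ) ≠ 0 := by exact_mod_cast Fintype.card_ne_zero
  have h2 : (Fintype.card (V → σ) : ℝ) ≠ 0 := by exact_mod_cast Fintype.card_ne_zero
  rw [gibbsAt, gibbsAt, ← embedOp_smul hf, exp_embedOp hf, ← embedOp_mul hf,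
    ← div_div_div_cancel_right₀ h2 (embedOp f _).trace.re, trace_embedOp_re_div hf,
    trace_embedOp_re_div hf, div_div_div_cancel_right₀ h1]

end Embedding

/-! ### Tensor products over blocks and additivity of the free energy -/

section Tensor

open Matrix

variable {σ I T : Type*} [Fintype σ] [DecidableEq σ] [Fintype I] [DecidableEq I]
  [Fintype T] [DecidableEq T]

/-- The tensor product of operators on the blocks `{i} × T`. -/
def tensorOp (M : I → Matrix (T → σ) (T → σ) ℂ) : Matrix (I × T → σ) (I × T → σ) ℂ :=
  Matrix.of fun s t => ∏ i, M i (fun v => s (i, v)) (fun v => t (i, v))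

lemma sum_prod_blocks (g : I → (T → σ) → ℂ) :
    ∑ u : I × T → σ, ∏ i, g i (fun v => u (i, v)) = ∏ i, ∑ w, g i w := by
  classical
  rw [Finset.prod_univ_sum, Fintype.piFinset_univ]
  exact Fintype.sum_equiv (Equiv.curry I T σ) _ _ fun u => rfl

lemma tensorOp_mul (M N : I → Matrix (T → σ) (T → σ) ℂ) :
    tensorOp M * tensorOp N = tensorOp (fun i => M i * N i) := by
  ext s t
  simp only [mul_apply, tensorOp, of_apply, ← Finset.prod_mul_distrib]
  exact sum_prod_blocks fun i w => M i (fun v => s (i, v)) w * N i w (fun v => t (i, v))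

lemma trace_tensorOp (M : I → Matrix (T → σ) (T → σ) ℂ) :
    (tensorOp M).trace = ∏ i, (M i).trace :=
  sum_prod_blocks fun i w => M i w w

lemma embedOp_block (i : I) (M : Matrix (T → σ) (T → σ) ℂ) :
    embedOp (fun v => (i, v)) M = tensorOp (Function.update 1 i M) := by
  ext s t
  simp only [tensorOp, of_apply]
  rw [← Finset.mul_prod_erase _ _ (Finset.mem_univ i), Function.update_self]
  have hr : ∀ j ∈ Finset.univ.erase i, Function.update (1 : I → Matrix (T → σ) (T → σ) ℂ) i M j
      (fun v => s (j, v)) (fun v => t (j, v))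
      = if (fun v => s (j, v)) = (fun v => t (j, v)) then 1 else 0 := by
    intro j hj
    rw [Function.update_of_ne (Finset.ne_of_mem_erase hj), Pi.one_apply, one_apply]
  rw [Finset.prod_congr rfl hr, Finset.prod_ite_zero, Finset.prod_const_one]
  by_cases h : ∀ v, v ∉ Set.range (fun v : T => (i, v)) → s v = t v
  · rw [embedOp_apply_of_agree _ h, if_pos, mul_one]
    · rfl
    · intro j hj
      ext v
      refine h (j, v) ?_
      rintro ⟨w, hw⟩
      exact Finset.ne_of_mem_erase hj (congrArg Prod.fst hw).symm
  · rw [embedOp_apply_of_not _ h, if_neg, mul_zero]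
    intro h'
    refine h ?_
    rintro ⟨j, v⟩ hv
    have hj : j ≠ i := fun e => hv ⟨v, by rw [e]⟩
    exact congrFun (h' j (Finset.mem_erase.2 ⟨hj, Finset.mem_univ _⟩)) v

lemma tensorOp_one : tensorOp (fun _ : I => (1 : Matrix (T → σ) (T → σ) ℂ)) = 1 := by
  ext s t
  simp only [tensorOp, of_apply, one_apply]
  rw [Finset.prod_ite_zero, Finset.prod_const_one]
  congr 1
  refine propext ⟨fun h => funext fun ⟨i, v⟩ => congrFun (h i (Finset.mem_univ i)) v,
    fun h _ _ => by rw [h]⟩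

open scoped Matrix.Norms.L2Operator

lemma commute_embedOp_block {i j : I} (hij : i ≠ j) (M N : Matrix (T → σ) (T → σ) ℂ) :
    Commute (embedOp (fun v => (i, v)) M) (embedOp (fun v => (j, v)) N) := by
  rw [Commute, SemiconjBy, embedOp_block, embedOp_block, tensorOp_mul, tensorOp_mul]
  congr 1
  ext1 k
  by_cases hk : k = i
  · subst hk
    rw [Function.update_self, Function.update_of_ne hij, Pi.one_apply, one_mul, mul_one]
  · rw [Function.update_of_ne hk, Pi.one_apply, one_mul, mul_one]

/-- Operators on different blocks commute, so the exponential factorizes one block at a time. -/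
lemma exp_sum_embedOp_block (H : I → Matrix (T → σ) (T → σ) ℂ) (s : Finset I) :
    NormedSpace.exp (∑ i ∈ s, embedOp (fun v => (i, v)) (H i))
      = tensorOp (fun i => if i ∈ s then NormedSpace.exp (H i) else 1) := by
  induction s using Finset.induction_on with
  | empty => simp [tensorOp_one]
  | insert a s ha ih =>
    have hc : Commute (embedOp (fun v => (a, v)) (H a))
        (∑ i ∈ s, embedOp (fun v => (i, v)) (H i)) :=
      Commute.sum_right _ _ _ fun i hi =>
        commute_embedOp_block (fun e => ha (by rw [e]; exact hi)) _ _
    rw [Finset.sum_insert ha, Matrix.exp_add_of_commute _ _ hc, ih,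
      exp_embedOp (Prod.mk_right_injective a), embedOp_block, tensorOp_mul]
    congr 1
    ext1 k
    by_cases hk : k = a
    · subst hk
      simp [ha]
    · simp [hk]

lemma nfree_sum_embedOp_block [Nonempty σ] {H : I → Matrix (T → σ) (T → σ) ℂ}
    (hH : ∀ i, (H i).IsHermitian) (β : ℝ≥0∞) :
    nfree β (∑ i, embedOp (fun v => (i, v)) (H i)) = ∑ i, nfree β (H i) := by
  have hS : (∑ i, embedOp (fun v => (i, v)) (H i)).IsHermitian := by
    rw [Matrix.IsHermitian, conjTranspose_sum]
    exact Finset.sum_congr rfl fun i _ => embedOp_isHermitian _ (hH i)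
  refine tendsto_nhds_unique (tendsto_nfree hS β)
    ((tendsto_finsetSum _ fun i _ => tendsto_nfree (hH i) β).congr fun b => ?_)
  rw [Finset.smul_sum]
  simp only [← embedOp_smul (Prod.mk_right_injective _)]
  rw [exp_sum_embedOp_block, trace_tensorOp, ← Finset.mul_sum]
  simp only [Finset.mem_univ, if_true]
  -- Traces of Hermitian matrices are real, so taking real parts commutes with the product over
  -- blocks.
  have him : ∀ i, (NormedSpace.exp (((-b : ℝ) : ℂ) • H i)).trace
      = (((NormedSpace.exp (((-b : ℝ) : ℂ) • H i)).trace.re : ℝ) : ℂ) := by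
    intro i
    have h1 : (NormedSpace.exp (((-b : ℝ) : ℂ) • H i)).IsHermitian :=
      (isHermitian_real_smul (hH i) (-b)).exp
    refine (Complex.conj_eq_iff_re.1 ?_).symm
    rw [starRingEnd_apply, ← trace_conjTranspose, h1.eq]
  have hprod : (∏ i, (NormedSpace.exp (((-b : ℝ) : ℂ) • H i)).trace).re
      = ∏ i, (NormedSpace.exp (((-b : ℝ) : ℂ) • H i)).trace.re := by
    rw [Finset.prod_congr rfl fun i _ => him i, ← Complex.ofReal_prod, Complex.ofReal_re]
  have hcard : (Fintype.card (I × T → σ) : ℝ) = ∏ _i : I, (Fintype.card (T → σ) : ℝ) := by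
    rw [Finset.prod_const, Finset.card_univ, Fintype.card_fun, Fintype.card_fun, Fintype.card_prod,
      mul_comm, pow_mul]
    push_cast; rfl
  rw [hprod, hcard, ← Finset.prod_div_distrib, Real.log_prod]
  intro i _
  refine div_ne_zero (trace_exp_pos (isHermitian_real_smul (hH i) (-b))).ne' ?_
  exact_mod_cast Fintype.card_ne_zero

end Tensor

end DisorderedLattice

namespace DisorderedLattice

/-! ### Boxes, periodic boxes, and copies of a small torus inside a larger one -/

section TorusGeometry

variable {d : ℕ}

lemma mem_box {L : ℕ} {x : Fin d → ℤ} : x ∈ box d L ↔ ∀ i, -(L : ℤ) ≤ x i ∧ x i ≤ L := by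
  simp only [box, Finset.mem_Icc, Pi.le_def]
  exact ⟨fun h i => ⟨h.1 i, h.2 i⟩, fun h => ⟨fun i => (h i).1, fun i => (h i).2⟩⟩

lemma box_subset_box {L M : ℕ} (h : L ≤ M) : box d L ⊆ box d M := fun x hx => by
  rw [mem_box] at *
  intro i
  have := hx i
  omega

lemma card_box (L : ℕ) : (box d L).card = (2 * L + 1) ^ d := by
  rw [box, Pi.card_Icc]
  simp only [Int.card_Icc, Finset.prod_const, Finset.card_univ, Fintype.card_fin]
  congr 1
  omega

lemma exists_subset_box (A : Finset (Fin d → ℤ)) : ∃ L, A ⊆ box d L := by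
  refine ⟨A.sup fun x => Finset.univ.sup fun i => (x i).natAbs, fun x hx => mem_box.2 fun i => ?_⟩
  have h1 : (x i).natAbs ≤ Finset.univ.sup fun i => (x i).natAbs :=
    Finset.le_sup (f := fun i => (x i).natAbs) (Finset.mem_univ i)
  have h2 : (Finset.univ.sup fun i => (x i).natAbs)
      ≤ A.sup fun x => Finset.univ.sup fun i => (x i).natAbs :=
    Finset.le_sup (f := fun x : Fin d → ℤ => Finset.univ.sup fun i => (x i).natAbs) hx
  omega

lemma box_zero : box d 0 = {0} := by
  ext x
  rw [mem_box, Finset.mem_singleton, funext_iff]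
  refine forall_congr' fun i => ?_
  simp only [Nat.cast_zero, neg_zero, Pi.zero_apply]
  exact ⟨fun h => le_antisymm h.2 h.1, fun h => by rw [h]; simp⟩

variable {K : ℕ}

lemma proj_rep (v : Torus d K) : proj K (rep v) = v :=
  funext fun i => ZMod.coe_valMinAbs (v i)

lemma rep_injective : Function.Injective (rep : Torus d K → Fin d → ℤ) :=
  Function.LeftInverse.injective proj_rep

lemma rep_mem_box (v : Torus d K) : rep v ∈ box d K := by
  refine mem_box.2 fun i => ?_
  have := ZMod.natAbs_valMinAbs_le (v i)
  simp only [rep]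
  omega

lemma rep_proj {x : Fin d → ℤ} (hx : x ∈ box d K) : rep (proj K x) = x := by
  funext i
  have h := mem_box.1 hx i
  refine (ZMod.valMinAbs_spec _ _).2 ⟨rfl, ?_, ?_⟩ <;> push_cast <;> omega

lemma proj_add (x y : Fin d → ℤ) : proj K (x + y) = proj K x + proj K y := by
  funext i
  simp [proj]

lemma proj_zero : proj K (0 : Fin d → ℤ) = 0 := by
  funext i
  simp [proj]

lemma rep_zero : rep (0 : Torus d K) = 0 := by
  rw [← proj_zero, rep_proj (mem_box.2 fun i => by simp)]

lemma rep_add_proj {v : Torus d K} {x : Fin d → ℤ} (h : rep v + x ∈ box d K) :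
    rep (v + proj K x) = rep v + x := by
  conv_lhs => rw [← proj_rep v]
  rw [← proj_add, rep_proj h]

lemma image_rep_univ : (Finset.univ : Finset (Torus d K)).map ⟨rep, rep_injective⟩ = box d K := by
  ext x
  simp only [Finset.mem_map, Finset.mem_univ, true_and, Function.Embedding.coeFn_mk]
  exact ⟨fun ⟨v, hv⟩ => hv ▸ rep_mem_box v, fun hx => ⟨proj K x, rep_proj hx⟩⟩

lemma sum_rep {M : Type*} [AddCommMonoid M] (g : (Fin d → ℤ) → M) :
    ∑ v : Torus d K, g (rep v) = ∑ x ∈ box d K, g x := by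
  rw [← image_rep_univ, Finset.sum_map]
  rfl

lemma card_torus : Fintype.card (Torus d K) = (2 * K + 1) ^ d := by
  simp [ZMod.card]

lemma card_filter_rep_mem_box {L : ℕ} (h : L ≤ K) :
    (Finset.univ.filter fun v : Torus d K => rep v ∈ box d L).card = (2 * L + 1) ^ d := by
  rw [← card_box, ← Finset.card_map ⟨rep, rep_injective⟩]
  congr 1
  ext x
  simp only [Finset.mem_map, Finset.mem_filter, Finset.mem_univ, true_and,
    Function.Embedding.coeFn_mk]
  exact ⟨fun ⟨v, hv, e⟩ => e ▸ hv, fun hx =>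
    ⟨proj K x, by rw [rep_proj (box_subset_box h hx)]; exact hx, rep_proj (box_subset_box h hx)⟩⟩

/-- Translated copies of the box `Γ_M` inside the torus of `Γ_K`: the site `v` of copy `i`. -/
def blockSite {I : Type*} (K M : ℕ) (c : I → Torus d K) (p : I × Torus d M) : Torus d K :=
  c p.1 + proj K (rep p.2)

/-- A step of size at most R from a site at depth R in the block does not wrap around the small
torus, so the block and the large torus agree on it. -/
lemma blockSite_add_proj {I : Type*} {M R : ℕ} (c : I → Torus d K) (i : I) {v : Torus d M}
    (hRM : R ≤ M) (hv : rep v ∈ box d (M - R)) {a : Fin d → ℤ} (ha : a ∈ box d R) :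
    blockSite K M c (i, v + proj M a) = blockSite K M c (i, v) + proj K a := by
  have h : rep v + a ∈ box d M := by
    rw [mem_box] at *
    intro k
    have h1 := hv k
    have h2 := ha k
    simp only [Pi.add_apply]
    omega
  simp only [blockSite, rep_add_proj h, proj_add, add_assoc]

lemma blockSite_unit_injective {M : ℕ} (h : M ≤ K) :
    Function.Injective (blockSite K M (fun _ : Unit => (0 : Torus d K))) := by
  rintro ⟨_, v⟩ ⟨_, w⟩ e
  simp only [blockSite, zero_add] at e
  have := congrArg rep e
  rw [rep_proj (box_subset_box h (rep_mem_box v)), rep_proj (box_subset_box h (rep_mem_box w))]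
    at this
  rw [rep_injective this]

/-- The cubes of side 2M + 1 centred at multiples of 2M + 1, m in each direction, fit into one
period of the large torus and are disjoint. -/
lemma blockSite_tiling_injective {M m : ℕ} (h : m * (2 * M + 1) ≤ 2 * K + 1) :
    Function.Injective (blockSite K M
      (fun i : Fin d → Fin m => proj K fun k => ((2 * M + 1 : ℕ) : ℤ) * (i k : ℕ))) := by
  rintro ⟨i, v⟩ ⟨j, w⟩ e
  simp only [blockSite, ← proj_add] at e
  have key : ∀ k, (i k : ℕ) = j k ∧ rep v k = rep w k := by
    intro k
    have e1 := congrFun e k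
    simp only [proj, Pi.add_apply] at e1
    rw [ZMod.intCast_eq_intCast_iff_dvd_sub] at e1
    obtain ⟨z, hz⟩ := e1
    have hv := mem_box.1 (rep_mem_box v) k
    have hw := mem_box.1 (rep_mem_box w) k
    generalize rep v k = a at *
    generalize rep w k = b at *
    have hi := (i k).2
    have hj := (j k).2
    generalize ((i k : Fin m) : ℕ) = p at *
    generalize ((j k : Fin m) : ℕ) = q at *
    have h' : (m : ℤ) * (2 * M + 1) ≤ 2 * K + 1 := by exact_mod_cast h
    have hp : (p : ℤ) + 1 ≤ m := by exact_mod_cast hi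
    have hq : (q : ℤ) + 1 ≤ m := by exact_mod_cast hj
    have hp0 : (0 : ℤ) ≤ p := by positivity
    have hq0 : (0 : ℤ) ≤ q := by positivity
    push_cast at hz
    have hM : (0 : ℤ) ≤ M := by positivity
    -- Two coordinates in the tiling differ by less than one period 2K + 1, so congruence forces
    -- equality. The cube index is then determined, because offsets within a cube differ by at most
    -- 2M.
    have hz0 : z = 0 := by
      have b1 : (2 * (M : ℤ) + 1) * q + b - ((2 * M + 1) * p + a) < 2 * K + 1 := by nlinarith
      have b2 : -(2 * (K : ℤ) + 1) < (2 * (M : ℤ) + 1) * q + b - ((2 * M + 1) * p + a) := by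
        nlinarith
      rw [hz] at b1 b2
      have hK : (0 : ℤ) < 2 * K + 1 := by positivity
      have c1 : z < 1 := by nlinarith
      have c2 : -1 < z := by nlinarith
      omega
    rw [hz0, mul_zero] at hz
    have hpq : (p : ℤ) = q := by
      rcases lt_trichotomy (p : ℤ) q with hlt | heq | hgt
      · nlinarith
      · exact heq
      · nlinarith
    refine ⟨by exact_mod_cast hpq, ?_⟩
    rw [hpq] at hz
    linarith
  refine Prod.ext (funext fun k => Fin.ext (key k).1) (rep_injective (funext fun k => (key k).2))

end TorusGeometry

/-! ### The Hamiltonian as a sum of local terms; locality, concavity and block decomposition -/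

section Hamiltonian

open Matrix
open scoped Matrix.Norms.L2Operator

variable {σ : Type*} [Fintype σ] [DecidableEq σ] {d : ℕ} (S : LatticeSystem d σ)

namespace LatticeSystem

/-- A radius that contains the interaction range and the cluster of `κ_0`. -/
noncomputable def radius : ℕ := max S.range (exists_subset_box S.cluster).choose

lemma range_le_radius : S.range ≤ S.radius := le_max_left _ _

lemma cluster_subset : S.cluster ⊆ box d S.radius :=
  (exists_subset_box S.cluster).choose_spec.trans (box_subset_box (le_max_right _ _))

/-- The terms of the Hamiltonian attached to the site `v`, in the field `r`. -/
noncomputable def siteTerm (K : ℕ) (v : Torus d K) (r : ℝ) :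
    Matrix (Torus d K → σ) (Torus d K → σ) ℂ :=
  (∑ A ∈ (box d S.range).powerset with 0 ∈ A, ((A.card : ℂ)⁻¹) • S.torusQ K v A)
    + (r : ℂ) • S.torusKappa K v

/-- The Hamiltonian on the torus with field `θ v` at the site `v`. -/
noncomputable def ham (K : ℕ) (θ : Torus d K → ℝ) : Matrix (Torus d K → σ) (Torus d K → σ) ℂ :=
  ∑ v, S.siteTerm K v (θ v)

lemma hamiltonian_eq_ham (ε h : ℝ) (K : ℕ) (η : Fields d) :
    S.hamiltonian ε h K η = S.ham K fun v => h + ε * η (rep v) := by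
  simp only [hamiltonian, ham, siteTerm, Finset.sum_add_distrib]

lemma freeEnergy_eq (β : ℝ≥0∞) (ε h : ℝ) (K : ℕ) (η : Fields d) :
    S.freeEnergy β ε h K η = freeOf β (S.ham K fun v => h + ε * η (rep v)) := by
  rw [← hamiltonian_eq_ham]
  rfl

lemma stateKappa_eq (β : ℝ≥0∞) (ε h : ℝ) (K : ℕ) (η : Fields d) (v : Torus d K) :
    S.stateKappa β ε h K η v
      = stateOf β (S.ham K fun v => h + ε * η (rep v)) (S.torusKappa K v) := by
  rw [← hamiltonian_eq_ham]
  rfl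

lemma torusKappa_isHermitian (K : ℕ) (v : Torus d K) : (S.torusKappa K v).IsHermitian :=
  embedOp_isHermitian _ S.kappa_isHermitian

lemma siteTerm_isHermitian (K : ℕ) (v : Torus d K) (r : ℝ) : (S.siteTerm K v r).IsHermitian := by
  refine Matrix.IsHermitian.add ?_ (isHermitian_real_smul (S.torusKappa_isHermitian K v) r)
  rw [Matrix.IsHermitian, conjTranspose_sum]
  refine Finset.sum_congr rfl fun A _ => ?_
  have h := isHermitian_real_smul
    (embedOp_isHermitian (fun a : A => v + proj K (a : Fin d → ℤ)) (S.Q_isHermitian A))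
    ((A.card : ℝ)⁻¹)
  push_cast at h
  exact h

lemma ham_isHermitian (K : ℕ) (θ : Torus d K → ℝ) : (S.ham K θ).IsHermitian := by
  rw [ham, Matrix.IsHermitian, conjTranspose_sum]
  exact Finset.sum_congr rfl fun v _ => S.siteTerm_isHermitian K v _

variable {S}

lemma injective_add_proj {K : ℕ} (hK : S.radius ≤ K) (v : Torus d K) {A : Finset (Fin d → ℤ)}
    (hA : A ⊆ box d S.radius) :
    Function.Injective fun a : A => v + proj K (a : Fin d → ℤ) := by
  intro a b e
  have e1 := congrArg rep (add_left_cancel e)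
  rw [rep_proj (box_subset_box hK (hA a.2)), rep_proj (box_subset_box hK (hA b.2))] at e1
  exact Subtype.ext e1

lemma norm_torusKappa_le {K : ℕ} (hK : S.radius ≤ K) (v : Torus d K) :
    ‖S.torusKappa K v‖ ≤ 1 := by
  refine (norm_embedOp_le (injective_add_proj hK v S.cluster_subset) _).trans ?_
  rw [← l2_opNorm_toEuclideanCLM]
  exact S.kappa_norm_le

variable (S) in
/-- A bound for the norm of the interaction terms attached to one site. -/
noncomputable def siteBound : ℝ := ∑ A ∈ (box d S.range).powerset with 0 ∈ A, ‖S.Q A‖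

lemma subset_box_of_mem {A : Finset (Fin d → ℤ)}
    (hA : A ∈ (box d S.range).powerset.filter fun A => 0 ∈ A) : A ⊆ box d S.radius :=
  (Finset.mem_powerset.1 (Finset.mem_filter.1 hA).1).trans (box_subset_box S.range_le_radius)

variable (S) in
lemma siteBound_nonneg : 0 ≤ S.siteBound := Finset.sum_nonneg fun _ _ => norm_nonneg _

lemma norm_siteTerm_le {K : ℕ} (hK : S.radius ≤ K) (v : Torus d K) (r : ℝ) :
    ‖S.siteTerm K v r‖ ≤ S.siteBound + |r| := by
  refine (norm_add_le _ _).trans (add_le_add ((norm_sum_le _ _).trans ?_) ?_)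
  · refine Finset.sum_le_sum fun A hA => ?_
    rw [norm_smul]
    have h1 : ‖((A.card : ℂ)⁻¹)‖ ≤ 1 := by
      rw [norm_inv, Complex.norm_natCast]
      exact Nat.cast_inv_le_one _
    calc _ ≤ 1 * ‖S.Q A‖ := mul_le_mul h1
          (norm_embedOp_le (injective_add_proj hK v (subset_box_of_mem hA)) _)
          (norm_nonneg _) zero_le_one
      _ = _ := one_mul _
  · rw [norm_smul, Complex.norm_real, Real.norm_eq_abs]
    exact mul_le_of_le_one_right (abs_nonneg _) (norm_torusKappa_le hK v)

/-- A local term sees only the sites within `radius`, so an injection that respects these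
displacements carries local terms to local terms. It serves for translations of a torus and for
blocks. -/
lemma embedOp_siteTerm {K M : ℕ} {e : Torus d M → Torus d K} (he : Function.Injective e)
    {v : Torus d M} (hv : ∀ a ∈ box d S.radius, e (v + proj M a) = e v + proj K a) (r : ℝ) :
    embedOp e (S.siteTerm M v r) = S.siteTerm K (e v) r := by
  have key : ∀ (A : Finset (Fin d → ℤ)) (_ : A ⊆ box d S.radius) (N : Matrix (A → σ) (A → σ) ℂ),
      embedOp e (embedOp (fun a : A => v + proj M (a : Fin d → ℤ)) N)
        = embedOp (fun a : A => e v + proj K (a : Fin d → ℤ)) N := by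
    intro A hA N
    rw [embedOp_embedOp he]
    congr 1
    funext a
    exact hv a (hA a.2)
  rw [siteTerm, siteTerm, embedOp_add he, embedOp_sum he]
  congr 1
  · refine Finset.sum_congr rfl fun A hA => ?_
    rw [embedOp_smul he]
    congr 1
    exact key A (subset_box_of_mem hA) _
  · rw [embedOp_smul he]
    congr 1
    exact key _ S.cluster_subset _

variable (S) in
lemma embedOp_translate_ham {K : ℕ} (w : Torus d K) (θ : Torus d K → ℝ) :
    embedOp (fun v => v + w) (S.ham K fun v => θ (v + w)) = S.ham K θ := by
  have he : Function.Injective fun v : Torus d K => v + w := add_left_injective w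
  rw [ham, embedOp_sum he]
  refine Fintype.sum_equiv (Equiv.addRight w) _ _ fun v => ?_
  exact embedOp_siteTerm he (fun a _ => add_right_comm _ _ _) _

variable (S) in
lemma embedOp_translate_torusKappa {K : ℕ} (v w : Torus d K) :
    embedOp (fun v => v + w) (S.torusKappa K v) = S.torusKappa K (v + w) := by
  rw [torusKappa, torusKappa, embedOp_embedOp (add_left_injective w)]
  congr 1
  funext a
  exact add_right_comm _ _ _

variable (S) in
lemma ham_add {K : ℕ} (θ τ : Torus d K → ℝ) :
    S.ham K (θ + τ) = S.ham K θ + ∑ v, (τ v : ℂ) • S.torusKappa K v := by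
  rw [ham, ham, ← Finset.sum_add_distrib]
  refine Finset.sum_congr rfl fun v _ => ?_
  rw [siteTerm, siteTerm, Pi.add_apply, Complex.ofReal_add, add_smul, add_assoc]

variable (S) in
lemma continuous_ham (K : ℕ) : Continuous (S.ham K) := by
  refine continuous_matrix fun s t => ?_
  simp only [ham, siteTerm, Matrix.sum_apply, Matrix.add_apply, Matrix.smul_apply, smul_eq_mul]
  fun_prop

variable [Nonempty σ]

variable (S) in
lemma freeOf_ham_translate {K : ℕ} (β : ℝ≥0∞) (w : Torus d K) (θ : Torus d K → ℝ) :
    freeOf β (S.ham K fun v => θ (v + w)) = freeOf β (S.ham K θ) := by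
  have h := nfree_embedOp (add_left_injective w) (S.ham_isHermitian K fun v => θ (v + w)) β
  rw [embedOp_translate_ham] at h
  exact (add_right_cancel h).symm

variable (S) in
lemma stateOf_ham_translate {K : ℕ} (β : ℝ≥0∞) (v w : Torus d K) (θ : Torus d K → ℝ) :
    stateOf β (S.ham K fun v => θ (v + w)) (S.torusKappa K v)
      = stateOf β (S.ham K θ) (S.torusKappa K (v + w)) := by
  have h := stateOf_embedOp (add_left_injective w) (S.ham_isHermitian K fun v => θ (v + w))
    (S.torusKappa K v) β
  rw [embedOp_translate_ham, embedOp_translate_torusKappa] at h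
  exact h.symm

variable (S) in
/-- The Gibbs expectations are supergradients of the free energy. -/
lemma freeOf_ham_le {β : ℝ≥0∞} (hβ : β ≠ 0) {K : ℕ} (θ θ' : Torus d K → ℝ) :
    freeOf β (S.ham K θ') ≤ freeOf β (S.ham K θ)
      + ∑ v, (θ' v - θ v) * stateOf β (S.ham K θ) (S.torusKappa K v) := by
  have hB : (∑ v, (((θ' - θ) v : ℝ) : ℂ) • S.torusKappa K v).IsHermitian := by
    rw [Matrix.IsHermitian, conjTranspose_sum]
    exact Finset.sum_congr rfl fun v _ => isHermitian_real_smul (S.torusKappa_isHermitian K v) _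
  have h := freeOf_add_le (S.ham_isHermitian K θ) hB hβ
  rw [← ham_add, add_sub_cancel, stateOf_sum (S.ham_isHermitian K θ)] at h
  simpa only [stateOf_smul (S.ham_isHermitian K θ), Pi.sub_apply] using h

lemma abs_stateOf_torusKappa_le {K : ℕ} (hK : S.radius ≤ K) (β : ℝ≥0∞) (θ : Torus d K → ℝ)
    (v : Torus d K) : |stateOf β (S.ham K θ) (S.torusKappa K v)| ≤ 1 :=
  (abs_stateOf_le (S.ham_isHermitian K θ) _ β).trans (norm_torusKappa_le hK v)

/-- Raising the field at v by r adds r κ_v, of norm at most r; the resulting bound 2βr² for r⟨κ_v⟩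
is divided by r. -/
lemma stateOf_sub_stateOf_update_le {β : ℝ≥0∞} (hβ : β ≠ 0) (hβ' : β ≠ ⊤) {K : ℕ}
    (hK : S.radius ≤ K) (θ : Torus d K → ℝ) (v : Torus d K) {r : ℝ} (hr : 0 ≤ r) :
    stateOf β (S.ham K θ) (S.torusKappa K v)
      - stateOf β (S.ham K (θ + Pi.single v r)) (S.torusKappa K v) ≤ 2 * β.toReal * r := by
  rcases hr.eq_or_lt with rfl | hr
  · simp
  have hH := S.ham_isHermitian K θ
  have hH' := S.ham_isHermitian K (θ + Pi.single v r)
  have h := stateOf_sub_stateOf_add_le hH (isHermitian_real_smul (S.torusKappa_isHermitian K v) r)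
    hβ hβ'
  have e : S.ham K (θ + Pi.single v r) = S.ham K θ + (r : ℂ) • S.torusKappa K v := by
    rw [ham_add]
    congr 1
    rw [Finset.sum_eq_single v (fun w _ hw => by rw [Pi.single_eq_of_ne hw]; simp)
      (fun h => absurd (Finset.mem_univ _) h), Pi.single_eq_same]
  rw [← e, stateOf_smul hH, stateOf_smul hH', norm_smul, Complex.norm_real,
    Real.norm_of_nonneg hr.le] at h
  have hn : (r * ‖S.torusKappa K v‖) ^ 2 ≤ r ^ 2 := by
    gcongr
    exact mul_le_of_le_one_right hr.le (norm_torusKappa_le hK v)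
  have h2 := h.trans (mul_le_mul_of_nonneg_left hn (by positivity))
  refine le_of_mul_le_mul_left ?_ hr
  linarith

/-- Decomposition of the torus into disjoint blocks, with an error from the sites that are not
well inside a block. -/
lemma abs_nfree_sub_sum_blocks_le {β : ℝ≥0∞} (hβ : β ≠ 0) {K M : ℕ} (hK : S.radius ≤ K)
    (hM : S.radius ≤ M) {I : Type*} [Fintype I] [DecidableEq I] (c : I → Torus d K)
    (hc : Function.Injective (blockSite K M c)) (θ : Torus d K → ℝ) :
    |nfree β (S.ham K θ) - ∑ i, nfree β (S.ham M fun v => θ (blockSite K M c (i, v)))|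
      ≤ 2 * ∑ u with u ∉ (Finset.univ.filter
          fun p : I × Torus d M => rep p.2 ∈ box d (M - S.radius)).image (blockSite K M c),
          (S.siteBound + |θ u|) := by
  set φ := blockSite K M c with hφ
  set J := Finset.univ.filter fun p : I × Torus d M => rep p.2 ∈ box d (M - S.radius) with hJ
  have hφi : ∀ i, Function.Injective fun v => φ (i, v) := fun i =>
    hc.comp (Prod.mk_right_injective i)
  -- In H' every block carries its own periodic boundary conditions and nothing acts elsewhere, so
  -- its normalized free energy is exactly the sum over blocks.
  set H' := embedOp φ (∑ i, embedOp (fun v => (i, v)) (S.ham M fun v => θ (φ (i, v)))) with hH'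
  have hherm : (∑ i, embedOp (fun v => (i, v)) (S.ham M fun v => θ (φ (i, v)))).IsHermitian := by
    rw [Matrix.IsHermitian, conjTranspose_sum]
    exact Finset.sum_congr rfl fun i _ => embedOp_isHermitian _ (S.ham_isHermitian _ _)
  have hn : nfree β H' = ∑ i, nfree β (S.ham M fun v => θ (φ (i, v))) := by
    rw [hH', nfree_embedOp hc hherm, nfree_sum_embedOp_block fun i => S.ham_isHermitian _ _]
  rw [← hn]
  refine (abs_nfree_sub_le (S.ham_isHermitian K θ) (embedOp_isHermitian _ hherm) hβ).trans ?_
  have e1 : H' = ∑ p : I × Torus d M,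
      embedOp (fun v => φ (p.1, v)) (S.siteTerm M p.2 (θ (φ p))) := by
    rw [hH', embedOp_sum hc, Fintype.sum_prod_type]
    refine Finset.sum_congr rfl fun i _ => ?_
    rw [embedOp_embedOp hc, ham]
    exact embedOp_sum (hφi i) _ _
  have e2 : ∀ p ∈ J, embedOp (fun v => φ (p.1, v)) (S.siteTerm M p.2 (θ (φ p)))
      = S.siteTerm K (φ p) (θ (φ p)) := fun p hp =>
    embedOp_siteTerm (hφi p.1) (fun a ha =>
      blockSite_add_proj c p.1 hM (Finset.mem_filter.1 hp).2 ha) _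
  -- The terms at sites deep inside a block cancel. What remains are the original terms at the other
  -- sites and the wrapped terms of the blocks; both obey the same bound, hence the factor 2.
  have e3 : S.ham K θ - H'
      = ∑ u with u ∉ J.image φ, S.siteTerm K u (θ u)
        - ∑ p ∈ Jᶜ, embedOp (fun v => φ (p.1, v)) (S.siteTerm M p.2 (θ (φ p))) := by
    rw [e1, ← Finset.sum_add_sum_compl J, Finset.sum_congr rfl e2, ham,
      ← Finset.sum_filter_add_sum_filter_not Finset.univ (fun u => u ∈ J.image φ),
      Finset.filter_univ_mem, Finset.sum_image fun _ _ _ _ h => hc h]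
    abel
  rw [e3]
  refine (norm_sub_le _ _).trans ?_
  have b1 : ‖∑ u with u ∉ J.image φ, S.siteTerm K u (θ u)‖
      ≤ ∑ u with u ∉ J.image φ, (S.siteBound + |θ u|) :=
    (norm_sum_le _ _).trans (Finset.sum_le_sum fun u _ => norm_siteTerm_le hK u _)
  have b2 : ‖∑ p ∈ Jᶜ, embedOp (fun v => φ (p.1, v)) (S.siteTerm M p.2 (θ (φ p)))‖
      ≤ ∑ u with u ∉ J.image φ, (S.siteBound + |θ u|) := by
    calc _ ≤ ∑ p ∈ Jᶜ, (S.siteBound + |θ (φ p)|) :=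
          (norm_sum_le _ _).trans (Finset.sum_le_sum fun p _ =>
            (norm_embedOp_le (hφi p.1) _).trans (norm_siteTerm_le hM _ _))
      _ = ∑ u ∈ Jᶜ.image φ, (S.siteBound + |θ u|) :=
          (Finset.sum_image (f := fun u => S.siteBound + |θ u|) fun _ _ _ _ h => hc h).symm
      _ ≤ _ := by
          refine Finset.sum_le_sum_of_subset_of_nonneg ?_
            fun u _ _ => add_nonneg S.siteBound_nonneg (abs_nonneg _)
          intro u hu
          obtain ⟨p, hp, rfl⟩ := Finset.mem_image.1 hu
          refine Finset.mem_filter.2 ⟨Finset.mem_univ _, fun h => ?_⟩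
          obtain ⟨q, hq, e⟩ := Finset.mem_image.1 h
          exact Finset.mem_compl.1 hp (hc e ▸ hq)
  linarith

end LatticeSystem

end Hamiltonian

end DisorderedLattice

namespace DisorderedLattice

/-! ### The law of independent fields under reindexing and resampling -/

section ProductLaw

variable {d : ℕ} (ν : Measure ℝ) [IsProbabilityMeasure ν]

instance : IsProbabilityMeasure (fieldLaw d ν) := by unfold fieldLaw; infer_instance

/-- Reading i.i.d. variables along distinct sites gives i.i.d. variables; it is enough to compare
cylinder sets. -/
lemma measurePreserving_comp_injective {ι κ : Type*} {g : ι → κ} (hg : Function.Injective g) :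
    MeasurePreserving (fun (η : κ → ℝ) i => η (g i)) (Measure.infinitePi fun _ : κ => ν)
      (Measure.infinitePi fun _ : ι => ν) := by
  classical
  have hm : Measurable fun (η : κ → ℝ) i => η (g i) :=
    measurable_pi_lambda _ fun i => measurable_pi_apply _
  refine ⟨hm, Measure.eq_infinitePi _ fun s t ht => ?_⟩
  rw [Measure.map_apply hm (MeasurableSet.pi s.countable_toSet fun i _ => ht i)]
  have e : (fun (η : κ → ℝ) i => η (g i)) ⁻¹' (Set.pi s t)
      = Set.pi (s.map ⟨g, hg⟩) (fun k => ⋂ i ∈ g ⁻¹' {k}, t i) := by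
    ext η
    simp only [Set.mem_preimage, Set.mem_pi, SetLike.mem_coe, Finset.mem_map,
      Function.Embedding.coeFn_mk, forall_exists_index, and_imp, forall_apply_eq_imp_iff₂,
      Set.mem_iInter, Set.mem_singleton_iff]
    refine forall₂_congr fun i _ => ⟨fun h j hj => ?_, fun h => h i rfl⟩
    rw [hg hj]; exact h
  have hone : ∀ i, (⋂ j ∈ g ⁻¹' {g i}, t j) = t i := by
    intro i
    ext x
    simp only [Set.mem_iInter, Set.mem_preimage, Set.mem_singleton_iff]
    refine ⟨fun h => h i rfl, fun h j hj => ?_⟩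
    rw [hg hj]; exact h
  rw [e, Measure.infinitePi_pi, Finset.prod_map]
  · simp only [Function.Embedding.coeFn_mk, hone]
  · intro k hk
    obtain ⟨i, _, rfl⟩ := Finset.mem_map.1 hk
    rw [Function.Embedding.coeFn_mk, hone]
    exact ht i

lemma measurable_splice (Λ : Finset (Fin d → ℤ)) :
    Measurable fun p : Fields d × Fields d => splice Λ p.1 p.2 := by
  refine measurable_pi_lambda _ fun x => ?_
  unfold splice
  split_ifs
  · exact (measurable_pi_apply x).comp measurable_fst
  · exact (measurable_pi_apply x).comp measurable_snd

/-- Resampling the fields off Λ from an independent copy preserves the law; this is why `condAv` has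
the averaging property of a conditional expectation. -/
lemma measurePreserving_splice (Λ : Finset (Fin d → ℤ)) :
    MeasurePreserving (fun p : Fields d × Fields d => splice Λ p.1 p.2)
      ((fieldLaw d ν).prod (fieldLaw d ν)) (fieldLaw d ν) := by
  refine ⟨measurable_splice Λ, Measure.eq_infinitePi _ fun s t ht => ?_⟩
  rw [Measure.map_apply (measurable_splice Λ)
    (MeasurableSet.pi s.countable_toSet fun i _ => ht i)]
  have e : (fun p : Fields d × Fields d => splice Λ p.1 p.2) ⁻¹' (Set.pi s t)
      = (Set.pi (s.filter (· ∈ Λ)) t) ×ˢ (Set.pi (s.filter (· ∉ Λ)) t) := by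
    ext p
    simp only [Set.mem_preimage, Set.mem_pi, SetLike.mem_coe, Set.mem_prod, Finset.mem_filter,
      splice]
    constructor
    · exact fun h => ⟨fun i hi => by simpa [hi.2] using h i hi.1,
        fun i hi => by simpa [hi.2] using h i hi.1⟩
    · intro h i hi
      by_cases hΛ : i ∈ Λ
      · simpa [hΛ] using h.1 i ⟨hi, hΛ⟩
      · simpa [hΛ] using h.2 i ⟨hi, hΛ⟩
  rw [e, Measure.prod_prod, fieldLaw, Measure.infinitePi_pi _ fun i _ => ht i,
    Measure.infinitePi_pi _ fun i _ => ht i]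
  exact Finset.prod_filter_mul_prod_filter_not s (· ∈ Λ) _

lemma measurePreserving_eval (x : Fin d → ℤ) :
    MeasurePreserving (fun η : Fields d => η x) (fieldLaw d ν) ν :=
  measurePreserving_eval_infinitePi _ x

end ProductLaw

/-! ### Lipschitz functions of finitely many fields: conditional averages, variance, law of large
numbers -/

section SiteLipschitz

variable {d : ℕ}

/-- `f` depends on the fields in `s` only, in a Lipschitz way for the `ℓ¹` distance. -/
def SiteLipschitz (f : Fields d → ℝ) (s : Finset (Fin d → ℤ)) (c : ℝ) : Prop :=
  ∀ η η', |f η - f η'| ≤ c * ∑ x ∈ s, |η x - η' x|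

namespace SiteLipschitz

variable {f g : Fields d → ℝ} {s : Finset (Fin d → ℤ)} {c : ℝ}

lemma congr (hf : SiteLipschitz f s c) {η η' : Fields d} (h : ∀ x ∈ s, η x = η' x) :
    f η = f η' := by
  have h1 := hf η η'
  rw [Finset.sum_eq_zero fun x hx => by rw [h x hx, sub_self, abs_zero], mul_zero] at h1
  exact sub_eq_zero.1 (abs_nonpos_iff.1 h1)

lemma mono (hf : SiteLipschitz f s c) {t : Finset (Fin d → ℤ)} (hst : s ⊆ t) (hc : 0 ≤ c) :
    SiteLipschitz f t c := fun η η' =>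
  (hf η η').trans (mul_le_mul_of_nonneg_left
    (Finset.sum_le_sum_of_subset_of_nonneg hst fun _ _ _ => abs_nonneg _) hc)

lemma continuous (hf : SiteLipschitz f s c) : Continuous f := by
  refine continuous_iff_continuousAt.2 fun η => ?_
  refine tendsto_iff_norm_sub_tendsto_zero.2 ?_
  have h : Tendsto (fun η' : Fields d => c * ∑ x ∈ s, |η' x - η x|) (𝓝 η) (𝓝 0) := by
    have hc : Continuous fun η' : Fields d => c * ∑ x ∈ s, |η' x - η x| := by fun_prop
    have := hc.tendsto η
    simpa using this
  exact squeeze_zero (fun _ => norm_nonneg _) (fun η' => hf η' η) h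

lemma measurable (hf : SiteLipschitz f s c) : Measurable f := hf.continuous.measurable

lemma abs_le (hf : SiteLipschitz f s c) (η : Fields d) :
    |f η| ≤ |f 0| + c * ∑ x ∈ s, |η x| := by
  have h := hf η 0
  simp only [Pi.zero_apply, sub_zero] at h
  linarith [abs_sub_abs_le_abs_sub (f η) (f 0)]

variable (ν : Measure ℝ) [IsProbabilityMeasure ν]

lemma _root_.DisorderedLattice.memLp_eval (hν : MemLp id 2 ν) (x : Fin d → ℤ) :
    MemLp (fun η : Fields d => η x) 2 (fieldLaw d ν) :=
  hν.comp_measurePreserving (measurePreserving_eval ν x)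

variable {ν}

lemma memLp (hf : SiteLipschitz f s c) (hν : MemLp id 2 ν) :
    MemLp f 2 (fieldLaw d ν) := by
  have h1 : ∀ x ∈ s, MemLp (fun η : Fields d => |η x|) 2 (fieldLaw d ν) := fun x _ =>
    (memLp_eval ν hν x).abs
  have h2 : MemLp (fun η : Fields d => ∑ x ∈ s, |η x|) 2 (fieldLaw d ν) := memLp_finsetSum s h1
  have h3 : MemLp (fun _ : Fields d => |f 0|) 2 (fieldLaw d ν) := memLp_const _
  have h : MemLp (fun η : Fields d => |f 0| + c * ∑ x ∈ s, |η x|) 2 (fieldLaw d ν) :=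
    h3.add (h2.const_mul c)
  refine h.mono hf.measurable.aestronglyMeasurable (Eventually.of_forall fun η => ?_)
  exact (hf.abs_le η).trans (le_abs_self _)

lemma integrable (hf : SiteLipschitz f s c) (hν : MemLp id 2 ν) :
    Integrable f (fieldLaw d ν) := (hf.memLp hν).integrable one_le_two

lemma comp_splice_left (hf : SiteLipschitz f s c) (hc : 0 ≤ c) (Λ : Finset (Fin d → ℤ))
    (η : Fields d) : SiteLipschitz (fun ω => f (splice Λ η ω)) s c := fun ω ω' => by
  refine (hf _ _).trans (mul_le_mul_of_nonneg_left (Finset.sum_le_sum fun x _ => ?_) hc)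
  unfold splice
  split_ifs <;> simp

lemma comp_splice_right (hf : SiteLipschitz f s c) (hc : 0 ≤ c) (Λ : Finset (Fin d → ℤ))
    (ω : Fields d) : SiteLipschitz (fun η => f (splice Λ η ω)) (s ∩ Λ) c := fun η η' => by
  refine (hf _ _).trans (mul_le_mul_of_nonneg_left ?_ hc)
  rw [← Finset.sum_inter_add_sum_sdiff s Λ]
  have h0 : ∑ x ∈ s \ Λ, |splice Λ η ω x - splice Λ η' ω x| = 0 :=
    Finset.sum_eq_zero fun x hx => by simp [splice, (Finset.mem_sdiff.1 hx).2]
  rw [h0, add_zero]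
  exact le_of_eq (Finset.sum_congr rfl fun x hx => by simp [splice, (Finset.mem_inter.1 hx).2])

lemma condAv (hf : SiteLipschitz f s c) (hc : 0 ≤ c) (hν : MemLp id 2 ν)
    (Λ : Finset (Fin d → ℤ)) : SiteLipschitz (condAv ν Λ f) (s ∩ Λ) c := fun η η' => by
  have i1 := (hf.comp_splice_left hc Λ η).integrable hν
  have i2 := (hf.comp_splice_left hc Λ η').integrable hν
  unfold DisorderedLattice.condAv
  rw [← integral_sub i1 i2]
  refine (abs_integral_le_integral_abs).trans ?_
  calc _ ≤ ∫ _ω : Fields d, c * ∑ x ∈ s ∩ Λ, |η x - η' x| ∂(fieldLaw d ν) :=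
        integral_mono (i1.sub i2).abs (integrable_const _)
          fun ω => hf.comp_splice_right hc Λ ω η η'
    _ = _ := by simp

end SiteLipschitz

variable {ν : Measure ℝ} [IsProbabilityMeasure ν]

lemma integral_condAv {f : Fields d → ℝ} (hf : Integrable f (fieldLaw d ν))
    (Λ : Finset (Fin d → ℤ)) :
    ∫ η, condAv ν Λ f η ∂(fieldLaw d ν) = ∫ η, f η ∂(fieldLaw d ν) := by
  have h := measurePreserving_splice (d := d) ν Λ
  have hi : Integrable (fun p : Fields d × Fields d => f (splice Λ p.1 p.2))
      ((fieldLaw d ν).prod (fieldLaw d ν)) := h.integrable_comp_of_integrable hf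
  have e := integral_map h.measurable.aemeasurable
    (f := f) (by rw [h.map_eq]; exact hf.aestronglyMeasurable)
  rw [h.map_eq, integral_prod _ hi] at e
  exact e.symm

/-- Bound for the variance of a Lipschitz function of independent variables. -/
lemma integral_sq_sub_sq_integral_le (hν : MemLp id 2 ν) {c : ℝ} (hc : 0 ≤ c)
    (s : Finset (Fin d → ℤ)) : ∀ f : Fields d → ℝ, SiteLipschitz f s c →
    ∫ η, f η ^ 2 ∂(fieldLaw d ν) - (∫ η, f η ∂(fieldLaw d ν)) ^ 2
      ≤ c ^ 2 * s.card * (2 * (∫ t, t ^ 2 ∂ν + (∫ t, |t| ∂ν) ^ 2)) := by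
  induction s using Finset.induction_on with
  | empty =>
    intro f hf
    have h : ∀ η, f η = f 0 := fun η => hf.congr (by simp)
    simp only [h]
    simp
  | insert a s ha ih =>
    intro f hf
    -- Here g averages out the field at a. By orthogonality Var f = E(f − g)² + Var g, and g is
    -- Lipschitz in the remaining sites with the same constant, so induction adds one site at a
    -- time.
    set g : Fields d → ℝ := fun η => ∫ ω, f (splice {a} ω η) ∂(fieldLaw d ν) with hg
    have hint : ∀ η, Integrable (fun ω => f (splice {a} ω η)) (fieldLaw d ν) := fun η =>
      (hf.comp_splice_right hc {a} η).integrable hν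
    have hgs : SiteLipschitz g s c := fun η η' => by
      rw [hg]
      simp only
      rw [← integral_sub (hint η) (hint η')]
      refine (abs_integral_le_integral_abs).trans ?_
      calc _ ≤ ∫ _ω : Fields d, c * ∑ x ∈ s, |η x - η' x| ∂(fieldLaw d ν) := by
            refine integral_mono ((hint η).sub (hint η')).abs (integrable_const _) fun ω => ?_
            refine (hf _ _).trans (mul_le_mul_of_nonneg_left ?_ hc)
            rw [Finset.sum_insert ha]
            have e1 : splice {a} ω η a - splice {a} ω η' a = 0 := by simp [splice]
            rw [e1, abs_zero, zero_add]
            refine le_of_eq (Finset.sum_congr rfl fun x hx => ?_)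
            have hxa : x ≠ a := fun e => ha (e ▸ hx)
            simp [splice, hxa]
        _ = _ := by simp
    have f2 := hf.memLp hν
    have g2 := hgs.memLp hν
    have hmp := measurePreserving_splice (d := d) ν {a}
    have hga : ∀ ω η, g (splice {a} ω η) = g η := fun ω η => hgs.congr fun x hx => by
      have hxa : x ≠ a := fun e => ha (e ▸ hx)
      simp [splice, hxa]
    have hfg : Integrable (fun η => f η * g η) (fieldLaw d ν) := f2.integrable_mul g2
    have tower : ∀ u : Fields d → ℝ, Integrable u (fieldLaw d ν) →
        ∫ η, u η ∂(fieldLaw d ν)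
          = ∫ η, ∫ ω, u (splice {a} ω η) ∂(fieldLaw d ν) ∂(fieldLaw d ν) := by
      intro u hu
      have hi : Integrable (fun p : Fields d × Fields d => u (splice {a} p.1 p.2))
        ((fieldLaw d ν).prod (fieldLaw d ν)) := hmp.integrable_comp_of_integrable hu
      have e := integral_map hmp.measurable.aemeasurable
        (f := u) (by rw [hmp.map_eq]; exact hu.aestronglyMeasurable)
      rw [hmp.map_eq, integral_prod_symm _ hi] at e
      exact e
    have e1 : ∫ η, f η ∂(fieldLaw d ν) = ∫ η, g η ∂(fieldLaw d ν) := tower f (hf.integrable hν)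
    have e2 : ∫ η, f η * g η ∂(fieldLaw d ν) = ∫ η, g η ^ 2 ∂(fieldLaw d ν) := by
      rw [tower _ hfg]
      refine integral_congr_ae (Eventually.of_forall fun η => ?_)
      simp only [hga]
      rw [integral_mul_const, sq]
    have e3 : ∫ η, (f η - g η) ^ 2 ∂(fieldLaw d ν)
        = ∫ η, f η ^ 2 ∂(fieldLaw d ν) - ∫ η, g η ^ 2 ∂(fieldLaw d ν) := by
      have : ∀ η, (f η - g η) ^ 2 = f η ^ 2 - 2 * (f η * g η) + g η ^ 2 := fun η => by ring
      simp only [this]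
      have i1 : Integrable (fun η => f η ^ 2 - 2 * (f η * g η)) (fieldLaw d ν) :=
        f2.integrable_sq.sub (hfg.const_mul 2)
      rw [integral_add i1 g2.integrable_sq, integral_sub f2.integrable_sq (hfg.const_mul 2), integral_const_mul, e2]
      ring
    have ν1 : Integrable (fun t : ℝ => |t|) ν := (hν.integrable one_le_two).abs
    have ν2 : Integrable (fun t : ℝ => t ^ 2) ν := hν.integrable_sq
    have e4 : ∫ η, (f η - g η) ^ 2 ∂(fieldLaw d ν)
        ≤ c ^ 2 * (2 * (∫ t, t ^ 2 ∂ν + (∫ t, |t| ∂ν) ^ 2)) := by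
      have hev := measurePreserving_eval (d := d) ν a
      -- Resampling the field at a moves f by at most c(|η a| + |ω a|); the 2 comes from (x + y)² ≤
      -- 2(x² + y²).
      have pt : ∀ η, (f η - g η) ^ 2 ≤ c ^ 2 * (2 * (η a ^ 2 + (∫ t, |t| ∂ν) ^ 2)) := by
        intro η
        have b1 : |f η - g η| ≤ c * (|η a| + ∫ t, |t| ∂ν) := by
          have : f η - g η = ∫ ω, (f η - f (splice {a} ω η)) ∂(fieldLaw d ν) := by
            rw [integral_sub (integrable_const _) (hint η)]; simp [hg]
          rw [this]
          refine (abs_integral_le_integral_abs).trans ?_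
          have i1 : Integrable (fun ω : Fields d => |ω a|) (fieldLaw d ν) :=
            hev.integrable_comp_of_integrable ν1
          calc _ ≤ ∫ ω : Fields d, c * (|η a| + |ω a|) ∂(fieldLaw d ν) := by
                refine integral_mono ((integrable_const _).sub (hint η)).abs
                  (((integrable_const _).add i1).const_mul c) fun ω => ?_
                refine (hf _ _).trans (mul_le_mul_of_nonneg_left ?_ hc)
                rw [Finset.sum_insert ha, Finset.sum_eq_zero, add_zero]
                · have : splice {a} ω η a = ω a := by simp [splice]
                  rw [this]
                  exact abs_sub _ _
                · intro x hx
                  have hxa : x ≠ a := fun e => ha (e ▸ hx)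
                  simp [splice, hxa]
            _ = _ := by
                have e := integral_map hev.measurable.aemeasurable (f := fun t : ℝ => |t|)
                  (by rw [hev.map_eq]; exact ν1.aestronglyMeasurable)
                rw [hev.map_eq] at e
                rw [integral_const_mul, integral_add (integrable_const _) i1, e]
                simp
        have hm : 0 ≤ ∫ t, |t| ∂ν := integral_nonneg fun _ => abs_nonneg _
        calc (f η - g η) ^ 2 = |f η - g η| ^ 2 := (sq_abs _).symm
          _ ≤ (c * (|η a| + ∫ t, |t| ∂ν)) ^ 2 := by gcongr
          _ = c ^ 2 * (|η a| + ∫ t, |t| ∂ν) ^ 2 := by ring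
          _ ≤ _ := by
            gcongr
            rw [← sq_abs (η a)]
            nlinarith [sq_nonneg (|η a| - ∫ t, |t| ∂ν)]
      have i2 : Integrable (fun η : Fields d => η a ^ 2) (fieldLaw d ν) :=
        hev.integrable_comp_of_integrable ν2
      have e := integral_map hev.measurable.aemeasurable (f := fun t : ℝ => t ^ 2)
        (by rw [hev.map_eq]; exact ν2.aestronglyMeasurable)
      rw [hev.map_eq] at e
      calc _ ≤ ∫ η : Fields d, c ^ 2 * (2 * (η a ^ 2 + (∫ t, |t| ∂ν) ^ 2)) ∂(fieldLaw d ν) :=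
            integral_mono (f2.sub g2).integrable_sq
              (((i2.add (integrable_const _)).const_mul 2).const_mul _) pt
        _ = _ := by
            rw [integral_const_mul, integral_const_mul, integral_add i2 (integrable_const _), e]
            simp
    have h5 := ih g hgs
    rw [Finset.card_insert_of_notMem ha, e1]
    push_cast
    linarith

/-- A sequence with summable second moments tends to zero almost surely. -/
lemma ae_tendsto_zero_of_integral_sq_le {Ω : Type*} [MeasurableSpace Ω] {P : Measure Ω}
    {X : ℕ → Ω → ℝ} (hX : ∀ n, MemLp (X n) 2 P) {b : ℕ → ℝ} (hb : Summable b)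
    (h : ∀ᶠ n in atTop, ∫ ω, X n ω ^ 2 ∂P ≤ b n) :
    ∀ᵐ ω ∂P, Tendsto (fun n => X n ω) atTop (𝓝 0) := by
  obtain ⟨N, hN⟩ := eventually_atTop.1 h
  have hm : ∀ n, AEMeasurable (fun ω => ENNReal.ofReal (X (n + N) ω ^ 2)) P := fun n =>
    ((hX (n + N)).aestronglyMeasurable.aemeasurable.pow_const 2).ennreal_ofReal
  have hsum : ∫⁻ ω, ∑' n, ENNReal.ofReal (X (n + N) ω ^ 2) ∂P ≠ ⊤ := by
    rw [lintegral_tsum hm]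
    have hle : ∀ n, ∫⁻ ω, ENNReal.ofReal (X (n + N) ω ^ 2) ∂P ≤ ENNReal.ofReal (b (n + N)) := by
      intro n
      rw [← ofReal_integral_eq_lintegral_ofReal (hX _).integrable_sq
        (Eventually.of_forall fun _ => sq_nonneg _)]
      exact ENNReal.ofReal_le_ofReal (hN _ (Nat.le_add_left _ _))
    refine ne_top_of_le_ne_top ?_ (ENNReal.tsum_le_tsum hle)
    exact ((summable_nat_add_iff N).2 hb).tsum_ofReal_ne_top
  filter_upwards [ae_lt_top' (AEMeasurable.tsum hm) hsum] with ω hω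
  have h1 := ENNReal.tendsto_atTop_zero_of_tsum_ne_top hω.ne
  have h2 : Tendsto (fun n => X (n + N) ω ^ 2) atTop (𝓝 0) := by
    have := (ENNReal.tendsto_toReal ENNReal.zero_ne_top).comp h1
    refine this.congr fun n => ?_
    rw [Function.comp_apply, ENNReal.toReal_ofReal (sq_nonneg _)]
  have h3 : Tendsto (fun n => X (n + N) ω) atTop (𝓝 0) := by
    have := h2.sqrt
    rw [Real.sqrt_zero] at this
    simp only [Real.sqrt_sq_eq_abs] at this
    exact (tendsto_zero_iff_abs_tendsto_zero _).2 this
  exact (tendsto_add_atTop_iff_nat N).1 h3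

/-- A law of large numbers, along squares, for Lipschitz functions of the fields in a box. -/
lemma ae_tendsto_centered_div_card (hd : 1 ≤ d) (hν : MemLp id 2 ν) {c : ℝ} (hc : 0 ≤ c)
    {f : ℕ → Fields d → ℝ} {N : ℕ} (hf : ∀ K, N ≤ K → SiteLipschitz (f K) (box d K) c) :
    ∀ᵐ η ∂(fieldLaw d ν), Tendsto (fun n : ℕ =>
      (f (n ^ 2) η - ∫ ω, f (n ^ 2) ω ∂(fieldLaw d ν)) / (box d (n ^ 2)).card) atTop (𝓝 0) := by
  set D := 2 * (∫ t, t ^ 2 ∂ν + (∫ t, |t| ∂ν) ^ 2) with hD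
  have hD0 : 0 ≤ D := by
    have : 0 ≤ ∫ t, t ^ 2 ∂ν := integral_nonneg fun _ => sq_nonneg _
    positivity
  have hge : ∀ n : ℕ, N ≤ n → N ≤ n ^ 2 := fun n hn => hn.trans (Nat.le_self_pow two_ne_zero n)
  have key : ∀ᵐ η ∂(fieldLaw d ν), Tendsto (fun n : ℕ => (fun n η =>
      (f ((n + N) ^ 2) η - ∫ ω, f ((n + N) ^ 2) ω ∂(fieldLaw d ν))
        / ((box d ((n + N) ^ 2)).card : ℝ)) n η) atTop (𝓝 0) := by
    -- The variance of the density is of order 1/|Γ_K|, which is not summable over all K when d = 1.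
    -- Along K = k² it is at most a constant times k⁻² in every dimension.
    refine ae_tendsto_zero_of_integral_sq_le (b := fun n => c ^ 2 * D * (1 / ((n + N : ℕ) : ℝ) ^ 2))
      (fun n => ?_) ?_ ?_
    · exact (((hf _ (hge _ (Nat.le_add_left _ _))).memLp hν).sub (memLp_const _)).mul_const _
    · exact ((summable_nat_add_iff N).2 (Real.summable_one_div_nat_pow.2 one_lt_two)).mul_left _
    · filter_upwards [eventually_ge_atTop 1] with n hn
      have hL := hf _ (hge _ (Nat.le_add_left N n))
      have hn1 : 1 ≤ n + N := by omega
      generalize n + N = k at hL hn1 ⊢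
      have hv := integral_sq_sub_sq_integral_le hν hc _ _ hL
      have i2 := (hL.memLp hν).integrable_sq
      have i1 := hL.integrable hν
      set m := ∫ ω, f (k ^ 2) ω ∂(fieldLaw d ν)
      have e : ∫ η, ((f (k ^ 2) η - m) / ((box d (k ^ 2)).card : ℝ)) ^ 2 ∂(fieldLaw d ν)
          = (∫ η, f (k ^ 2) η ^ 2 ∂(fieldLaw d ν) - m ^ 2) / ((box d (k ^ 2)).card : ℝ) ^ 2 := by
        have : ∀ η, ((f (k ^ 2) η - m) / ((box d (k ^ 2)).card : ℝ)) ^ 2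
            = (f (k ^ 2) η ^ 2 - 2 * m * f (k ^ 2) η + m ^ 2)
              / ((box d (k ^ 2)).card : ℝ) ^ 2 := fun η => by rw [div_pow]; ring
        simp only [this]
        have i3 : Integrable (fun η => f (k ^ 2) η ^ 2 - 2 * m * f (k ^ 2) η) (fieldLaw d ν) :=
          i2.sub (i1.const_mul _)
        rw [integral_div, integral_add i3 (integrable_const _), integral_sub i2 (i1.const_mul _), integral_const_mul]
        simp only [integral_const, probReal_univ, smul_eq_mul, one_mul]
        ring
      rw [e]
      have hk : (0 : ℝ) < k := by exact_mod_cast hn1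
      have hB : ((k : ℝ) ^ 2) ≤ ((box d (k ^ 2)).card : ℝ) := by
        rw [card_box]
        have h1 : k ^ 2 ≤ (2 * k ^ 2 + 1) ^ d :=
          le_trans (by omega) (Nat.le_self_pow (by omega) (2 * k ^ 2 + 1))
        exact_mod_cast h1
      have hB0 : (0 : ℝ) < ((box d (k ^ 2)).card : ℝ) := lt_of_lt_of_le (by positivity) hB
      calc _ ≤ c ^ 2 * (box d (k ^ 2)).card * D / ((box d (k ^ 2)).card : ℝ) ^ 2 := by gcongr
        _ = c ^ 2 * D * (1 / ((box d (k ^ 2)).card : ℝ)) := by field_simp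
        _ ≤ _ := by gcongr
  filter_upwards [key] with η hη
  exact (tendsto_add_atTop_iff_nat N).1 hη

end SiteLipschitz

end DisorderedLattice

namespace DisorderedLattice

/-! ### Convergence criteria and volume ratios -/

section RealSequences

lemma exists_tendsto_of_forall_eventually_near {x : ℕ → ℝ}
    (h : ∀ e > 0, ∃ c, ∀ᶠ K in atTop, |x K - c| ≤ e) : ∃ l, Tendsto x atTop (𝓝 l) := by
  refine cauchySeq_tendsto_of_complete (Metric.cauchySeq_iff'.2 fun e he => ?_)
  obtain ⟨c, hc⟩ := h (e / 3) (by positivity)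
  obtain ⟨N, hN⟩ := eventually_atTop.1 hc
  refine ⟨N, fun n hn => ?_⟩
  have h1 := abs_le.1 (hN n hn)
  have h2 := abs_le.1 (hN N le_rfl)
  rw [Real.dist_eq, abs_lt]
  constructor <;> linarith

/-- The fraction of the side of the large torus that whole blocks of side 2M + 1 cover. -/
lemma tendsto_floor_ratio (M : ℕ) :
    Tendsto (fun K : ℕ => (((2 * K + 1) / (2 * M + 1) * (2 * M + 1) : ℕ) : ℝ) / (2 * K + 1 : ℕ))
      atTop (𝓝 1) := by
  have h0 : Tendsto (fun K : ℕ => (1 : ℝ) - (2 * M) * ((2 * K + 1 : ℕ) : ℝ)⁻¹) atTop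
      (𝓝 (1 - 2 * M * 0)) := by
    refine tendsto_const_nhds.sub (Tendsto.const_mul _ ?_)
    refine tendsto_inv_atTop_zero.comp (tendsto_natCast_atTop_atTop.comp ?_)
    exact tendsto_atTop_mono (fun K => by simp only [id]; omega) tendsto_id
  rw [mul_zero, sub_zero] at h0
  refine tendsto_of_tendsto_of_tendsto_of_le_of_le h0 tendsto_const_nhds (fun K => ?_) fun K => ?_
  · have hK : (0 : ℝ) < ((2 * K + 1 : ℕ) : ℝ) := by positivity
    have h1 : 2 * K + 1 ≤ (2 * K + 1) / (2 * M + 1) * (2 * M + 1) + 2 * M := by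
      have h2 := Nat.div_add_mod' (2 * K + 1) (2 * M + 1)
      have h3 := Nat.mod_lt (2 * K + 1) (show 0 < 2 * M + 1 by omega)
      omega
    have h1' : ((2 * K + 1 : ℕ) : ℝ)
        ≤ (((2 * K + 1) / (2 * M + 1) * (2 * M + 1) : ℕ) : ℝ) + 2 * M := by exact_mod_cast h1
    simp only
    rw [le_div_iff₀ hK, sub_mul, mul_assoc, inv_mul_cancel₀ hK.ne']
    linarith
  · refine div_le_one_of_le₀ ?_ (by positivity)
    exact_mod_cast Nat.div_mul_le_self _ _

lemma tendsto_box_ratio (d : ℕ) :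
    Tendsto (fun k : ℕ => (((2 * (k + 1) ^ 2 + 1) ^ d : ℕ) : ℝ) / ((2 * k ^ 2 + 1) ^ d : ℕ))
      atTop (𝓝 1) := by
  have h : Tendsto (fun k : ℕ => ((2 * (k + 1) ^ 2 + 1 : ℕ) : ℝ) / (2 * k ^ 2 + 1 : ℕ))
      atTop (𝓝 1) := by
    have h0 : Tendsto (fun k : ℕ => (1 : ℝ) + 6 * (k : ℝ)⁻¹) atTop (𝓝 (1 + 6 * 0)) :=
      tendsto_const_nhds.add ((tendsto_inv_atTop_zero.comp tendsto_natCast_atTop_atTop).const_mul _)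
    rw [mul_zero, add_zero] at h0
    refine tendsto_of_tendsto_of_tendsto_of_le_of_le' tendsto_const_nhds h0
      (Eventually.of_forall fun k => ?_) ?_
    · rw [le_div_iff₀ (by positivity), one_mul]
      exact_mod_cast (by gcongr; omega : 2 * k ^ 2 + 1 ≤ 2 * (k + 1) ^ 2 + 1)
    · filter_upwards [eventually_ge_atTop 1] with k hk
      have hk' : (1 : ℝ) ≤ k := by exact_mod_cast hk
      have hk0 : (0 : ℝ) < k := by linarith
      rw [div_le_iff₀ (by positivity)]
      push_cast
      have e : (1 + 6 * (k : ℝ)⁻¹) * (2 * k ^ 2 + 1) = 2 * k ^ 2 + 1 + 12 * k + 6 * (k : ℝ)⁻¹ := by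
        field_simp
        ring
      rw [e]
      have : 0 < (k : ℝ)⁻¹ := by positivity
      nlinarith
  have := h.pow d
  rw [one_pow] at this
  refine this.congr fun k => ?_
  push_cast
  rw [div_pow]

/-- Convergence of densities along the squares extends to the whole sequence, given a monotone
control of the increments. -/
lemma tendsto_div_of_tendsto_squares (d : ℕ) {x N : ℕ → ℝ} {R : ℕ} {l a : ℝ} (hN : Monotone N)
    (hx : ∀ K M, R ≤ M → M ≤ K → |x K - x M| ≤ 2 * (N K - N (M - R)))
    (h1 : Tendsto (fun n : ℕ => x (n ^ 2) / ((2 * n ^ 2 + 1) ^ d : ℕ)) atTop (𝓝 l))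
    (h2 : Tendsto (fun n : ℕ => N (n ^ 2) / ((2 * n ^ 2 + 1) ^ d : ℕ)) atTop (𝓝 a)) :
    Tendsto (fun K : ℕ => x K / ((2 * K + 1) ^ d : ℕ)) atTop (𝓝 l) := by
  have hr := tendsto_box_ratio d
  have hri := hr.inv₀ one_ne_zero
  rw [inv_one] at hri
  set B : ℕ → ℝ := fun K => ((2 * K + 1) ^ d : ℕ) with hB
  have hBpos : ∀ K, 0 < B K := fun K => by simp only [hB]; positivity
  have hBmono : Monotone B := fun K L h => by
    simp only [hB]
    exact_mod_cast Nat.pow_le_pow_left (by omega) d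
  -- The densities N/B converge along squares and consecutive volumes have ratio tending to 1, so
  -- the growth of N across neighbouring squares is negligible.
  have hE : Tendsto (fun n : ℕ => 2 * (N ((n + 1) ^ 2) - N ((n - 1) ^ 2)) / B (n ^ 2)) atTop
      (𝓝 0) := by
    refine (tendsto_add_atTop_iff_nat 1).1 ?_
    have t1 := ((tendsto_add_atTop_iff_nat 2).2 h2).mul ((tendsto_add_atTop_iff_nat 1).2 hr)
    have t2 := h2.mul hri
    have t3 := (t1.sub t2).const_mul 2
    rw [sub_self, mul_zero] at t3
    refine t3.congr fun k => ?_
    change 2 * (N ((k + 2) ^ 2) / B ((k + 2) ^ 2) * (B ((k + 1 + 1) ^ 2) / B ((k + 1) ^ 2))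
      - N (k ^ 2) / B (k ^ 2) * (B ((k + 1) ^ 2) / B (k ^ 2))⁻¹) = _
    have e1 := (hBpos ((k + 2) ^ 2)).ne'
    have e2 := (hBpos ((k + 1) ^ 2)).ne'
    have e3 := (hBpos (k ^ 2)).ne'
    rw [show k + 1 + 1 = k + 2 by ring, Nat.add_sub_cancel]
    field_simp
  have hs : Tendsto Nat.sqrt atTop atTop := by
    refine tendsto_atTop_atTop.2 fun b => ⟨b * b, fun a ha => Nat.le_sqrt.2 ha⟩
  have hratio : Tendsto (fun K => B (Nat.sqrt K ^ 2) / B K) atTop (𝓝 1) := by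
    refine tendsto_of_tendsto_of_tendsto_of_le_of_le (hri.comp hs) tendsto_const_nhds
      (fun K => ?_) fun K => ?_
    · change (B ((Nat.sqrt K + 1) ^ 2) / B (Nat.sqrt K ^ 2))⁻¹ ≤ _
      rw [inv_div]
      refine div_le_div_of_nonneg_left (hBpos _).le (hBpos _) (hBmono ?_)
      exact (Nat.lt_succ_sqrt' K).le
    · exact div_le_one_of_le₀ (hBmono (Nat.sqrt_le' K)) (hBpos _).le
  -- Compare K with the largest square s² ≤ K. Once s > R, the gap 2s − 1 below s² exceeds R, so s²
  -- − R ≥ (s − 1)² and the error is covered by `hE`.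
  have hdiff : Tendsto (fun K => (x K - x (Nat.sqrt K ^ 2)) / B (Nat.sqrt K ^ 2)) atTop (𝓝 0) := by
    refine squeeze_zero_norm' ?_ (hE.comp hs)
    filter_upwards [hs.eventually_ge_atTop (R + 1)] with K hK
    rw [Function.comp_apply, Real.norm_eq_abs, abs_div, abs_of_pos (hBpos _)]
    refine div_le_div_of_nonneg_right ?_ (hBpos _).le
    generalize hsK : Nat.sqrt K = s at hK ⊢
    have hle : s ^ 2 ≤ K := hsK ▸ Nat.sqrt_le' K
    have hlt : K ≤ (s + 1) ^ 2 := hsK ▸ (Nat.lt_succ_sqrt' K).le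
    have hRs : R ≤ s ^ 2 := by nlinarith
    refine (hx K (s ^ 2) hRs hle).trans ?_
    have b1 := hN hlt
    have b2 : N ((s - 1) ^ 2) ≤ N (s ^ 2 - R) := by
      refine hN ?_
      obtain ⟨t, rfl⟩ : ∃ t, s = t + 1 := ⟨s - 1, by omega⟩
      rw [Nat.add_sub_cancel]
      have : t ^ 2 + R ≤ (t + 1) ^ 2 := by nlinarith
      omega
    linarith
  have t := (hdiff.add (h1.comp hs)).mul hratio
  rw [zero_add, mul_one] at t
  refine t.congr fun K => ?_
  change ((x K - x (Nat.sqrt K ^ 2)) / B (Nat.sqrt K ^ 2)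
    + x (Nat.sqrt K ^ 2) / B (Nat.sqrt K ^ 2)) * (B (Nat.sqrt K ^ 2) / B K) = x K / B K
  have e1 := (hBpos (Nat.sqrt K ^ 2)).ne'
  have e2 := (hBpos K).ne'
  field_simp
  ring

end RealSequences

/-! ### Averages depend only on the number of distinct sites read -/

section IntegralComp

variable {d : ℕ} (ν : Measure ℝ) [IsProbabilityMeasure ν]

/-- Injectivity is the right generality: a translation of the torus permutes the representatives in
Γ_K but need not be a translation of the lattice. -/
lemma integral_comp_sites {T : Type*} {Ψ : (T → ℝ) → ℝ} (hΨ : Measurable Ψ)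
    {g g' : T → Fin d → ℤ} (hg : Function.Injective g) (hg' : Function.Injective g') :
    ∫ η, Ψ (fun v => η (g v)) ∂(fieldLaw d ν) = ∫ η, Ψ (fun v => η (g' v)) ∂(fieldLaw d ν) := by
  have h := measurePreserving_comp_injective ν hg
  have h' := measurePreserving_comp_injective ν hg'
  have e := integral_map (μ := fieldLaw d ν) h.measurable.aemeasurable (f := Ψ)
    hΨ.aestronglyMeasurable
  have e' := integral_map (μ := fieldLaw d ν) h'.measurable.aemeasurable (f := Ψ)
    hΨ.aestronglyMeasurable
  unfold fieldLaw at *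
  rw [h.map_eq] at e
  rw [h'.map_eq] at e'
  rw [← e, e']

lemma integrable_comp_sites {T : Type*} {Ψ : (T → ℝ) → ℝ} (hΨ : Measurable Ψ)
    {g g' : T → Fin d → ℤ} (hg : Function.Injective g) (hg' : Function.Injective g')
    (hi : Integrable (fun η => Ψ (fun v => η (g v))) (fieldLaw d ν)) :
    Integrable (fun η => Ψ (fun v => η (g' v))) (fieldLaw d ν) := by
  have h := measurePreserving_comp_injective ν hg
  have h' := measurePreserving_comp_injective ν hg'
  have h1 := (h.integrable_comp (g := Ψ) hΨ.aestronglyMeasurable).1 hi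
  exact (h'.integrable_comp (g := Ψ) hΨ.aestronglyMeasurable).2 h1

lemma integral_abs_eval {ν : Measure ℝ} [IsProbabilityMeasure ν] (hν : MemLp id 2 ν)
    (x : Fin d → ℤ) : ∫ η : Fields d, |η x| ∂(fieldLaw d ν) = ∫ t, |t| ∂ν := by
  have hev := measurePreserving_eval (d := d) ν x
  have ν1 : Integrable (fun t : ℝ => |t|) ν := (hν.integrable one_le_two).abs
  have e := integral_map hev.measurable.aemeasurable (f := fun t : ℝ => |t|)
    (by rw [hev.map_eq]; exact ν1.aestronglyMeasurable)
  rw [hev.map_eq] at e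
  exact e.symm

end IntegralComp

/-! ### Existence of the free energy density -/

namespace LatticeSystem

variable {σ : Type*} [Fintype σ] [DecidableEq σ] [Nonempty σ] {d : ℕ} {S : LatticeSystem d σ}
  {β : ℝ≥0∞} {ε : ℝ}

lemma abs_freeOf_ham_sub_le (hβ : β ≠ 0) {K : ℕ} (hK : S.radius ≤ K) (θ θ' : Torus d K → ℝ) :
    |freeOf β (S.ham K θ) - freeOf β (S.ham K θ')| ≤ ∑ v, |θ v - θ' v| := by
  have key : ∀ θ θ' : Torus d K → ℝ,
      freeOf β (S.ham K θ) - freeOf β (S.ham K θ') ≤ ∑ v, |θ v - θ' v| := by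
    intro θ θ'
    have h := S.freeOf_ham_le hβ θ' θ
    have h2 : ∑ v, (θ v - θ' v) * stateOf β (S.ham K θ') (S.torusKappa K v)
        ≤ ∑ v, |θ v - θ' v| := by
      refine Finset.sum_le_sum fun v _ => (le_abs_self _).trans ?_
      rw [abs_mul]
      exact mul_le_of_le_one_right (abs_nonneg _) (abs_stateOf_torusKappa_le hK β _ v)
    linarith
  refine abs_le.2 ⟨?_, key θ θ'⟩
  have := key θ' θ
  simp only [abs_sub_comm (θ' _)] at this
  linarith

lemma siteLipschitz_freeEnergy (hβ : β ≠ 0) (hε : 0 ≤ ε) (h : ℝ) {K : ℕ} (hK : S.radius ≤ K) :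
    SiteLipschitz (S.freeEnergy β ε h K) (box d K) ε := fun η η' => by
  rw [freeEnergy_eq, freeEnergy_eq, ← sum_rep (fun x => |η x - η' x|), Finset.mul_sum]
  refine (abs_freeOf_ham_sub_le hβ hK _ _).trans (le_of_eq (Finset.sum_congr rfl fun v _ => ?_))
  rw [add_sub_add_left_eq_sub, ← mul_sub, abs_mul, abs_of_nonneg hε]

lemma abs_freeEnergy_sub_le (hβ : β ≠ 0) (h h' : ℝ) {K : ℕ} (hK : S.radius ≤ K)
    (η : Fields d) :
    |S.freeEnergy β ε h K η - S.freeEnergy β ε h' K η| ≤ (box d K).card * |h - h'| := by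
  rw [freeEnergy_eq, freeEnergy_eq]
  refine (abs_freeOf_ham_sub_le hβ hK _ _).trans (le_of_eq ?_)
  simp only [add_sub_add_right_eq_sub, Finset.sum_const, Finset.card_univ, card_torus, card_box,
    nsmul_eq_mul]

variable (S β ε) in
/-- Finite volume free energy relative to the normalized trace. -/
noncomputable def normFreeEnergy (h : ℝ) (K : ℕ) (η : Fields d) : ℝ :=
  nfree β (S.ham K fun v => h + ε * η (rep v))

variable (S β ε) in
lemma normFreeEnergy_eq (h : ℝ) (K : ℕ) (η : Fields d) :
    S.normFreeEnergy β ε h K η = S.freeEnergy β ε h K η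
      + (box d K).card * ((β.toReal)⁻¹ * Real.log (Fintype.card σ)) := by
  rw [normFreeEnergy, nfree, freeEnergy_eq, Fintype.card_fun, card_torus, card_box]
  push_cast
  rw [Real.log_pow]
  push_cast
  ring

lemma siteLipschitz_normFreeEnergy (hβ : β ≠ 0) (hε : 0 ≤ ε) (h : ℝ) {K : ℕ}
    (hK : S.radius ≤ K) : SiteLipschitz (S.normFreeEnergy β ε h K) (box d K) ε := fun η η' => by
  rw [normFreeEnergy_eq, normFreeEnergy_eq, add_sub_add_right_eq_sub]
  exact siteLipschitz_freeEnergy hβ hε h hK η η'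

lemma continuous_freeOf_ham (hβ : β ≠ 0) {K : ℕ} (hK : S.radius ≤ K) :
    Continuous fun θ : Torus d K → ℝ => freeOf β (S.ham K θ) := by
  refine continuous_iff_continuousAt.2 fun θ => tendsto_iff_norm_sub_tendsto_zero.2 ?_
  have hc : Continuous fun θ' : Torus d K → ℝ => ∑ v, |θ' v - θ v| := by fun_prop
  have ht := hc.tendsto θ
  simp only [sub_self, abs_zero, Finset.sum_const_zero] at ht
  exact squeeze_zero (fun _ => norm_nonneg _) (fun θ' => abs_freeOf_ham_sub_le hβ hK θ' θ) ht

lemma continuous_nfree_ham (hβ : β ≠ 0) {K : ℕ} (hK : S.radius ≤ K) (ε h : ℝ) :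
    Continuous fun ξ : Torus d K → ℝ => nfree β (S.ham K fun v => h + ε * ξ v) :=
  ((continuous_freeOf_ham hβ hK).comp
    (by fun_prop : Continuous fun (ξ : Torus d K → ℝ) v => h + ε * ξ v)).add continuous_const

lemma siteBound_add_abs_le (hε : 0 ≤ ε) (h t : ℝ) :
    S.siteBound + |h + ε * t| ≤ S.siteBound + |h| + ε * |t| := by
  have := abs_add_le h (ε * t)
  rw [abs_mul, abs_of_nonneg hε] at this
  linarith

variable (S ε) in
/-- Bound for the norm of the part of the Hamiltonian in the box `Γ_L`. -/
noncomputable def boxBound (h : ℝ) (L : ℕ) (η : Fields d) : ℝ :=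
  ∑ x ∈ box d L, (S.siteBound + |h| + ε * |η x|)

lemma boxBound_mono (hε : 0 ≤ ε) (h : ℝ) (η : Fields d) :
    Monotone fun L => S.boxBound ε h L η := fun L M hLM =>
  Finset.sum_le_sum_of_subset_of_nonneg (box_subset_box hLM) fun x _ _ => by
    have := S.siteBound_nonneg
    positivity

lemma siteLipschitz_boxBound (hε : 0 ≤ ε) (h : ℝ) (L : ℕ) :
    SiteLipschitz (S.boxBound ε h L) (box d L) ε := fun η η' => by
  rw [boxBound, boxBound, ← Finset.sum_sub_distrib, Finset.mul_sum]
  refine (Finset.abs_sum_le_sum_abs _ _).trans (Finset.sum_le_sum fun x _ => ?_)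
  rw [add_sub_add_left_eq_sub, ← mul_sub, abs_mul, abs_of_nonneg hε]
  exact mul_le_mul_of_nonneg_left (abs_abs_sub_abs_le _ _) hε

/-- One block centred at the origin, so both volumes see the same realization η; the error comes
from the shell Γ_K \ Γ_{M − radius}. -/
lemma abs_normFreeEnergy_sub_le (hβ : β ≠ 0) (hε : 0 ≤ ε) (h : ℝ) (η : Fields d) {K M : ℕ}
    (hM : S.radius ≤ M) (hMK : M ≤ K) :
    |S.normFreeEnergy β ε h K η - S.normFreeEnergy β ε h M η|
      ≤ 2 * (S.boxBound ε h K η - S.boxBound ε h (M - S.radius) η) := by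
  have hsub : M - S.radius ≤ K := (Nat.sub_le _ _).trans hMK
  have hb := abs_nfree_sub_sum_blocks_le (S := S) hβ (hM.trans hMK) hM
    (fun _ : Unit => (0 : Torus d K)) (blockSite_unit_injective hMK)
    (fun v => h + ε * η (rep v))
  have hrep : ∀ v : Torus d M,
      rep (blockSite K M (fun _ : Unit => (0 : Torus d K)) ((), v)) = rep v := fun v => by
    simp only [blockSite, zero_add]
    exact rep_proj (box_subset_box hMK (rep_mem_box v))
  simp only [Finset.univ_unique, Finset.sum_singleton, PUnit.default_eq_unit, hrep] at hb
  refine hb.trans (mul_le_mul_of_nonneg_left ?_ zero_le_two)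
  rw [boxBound, boxBound, ← Finset.sum_sdiff (box_subset_box hsub), add_sub_cancel_right]
  have e : ∑ x ∈ box d K \ box d (M - S.radius), (S.siteBound + |h| + ε * |η x|)
      = ∑ u : Torus d K, if rep u ∉ box d (M - S.radius) then
        (S.siteBound + |h| + ε * |η (rep u)|) else 0 := by
    rw [sum_rep fun x => if x ∉ box d (M - S.radius) then
        (S.siteBound + |h| + ε * |η x|) else 0, ← Finset.sum_filter]
    congr 1
    ext x
    simp [Finset.mem_sdiff]
  rw [e, ← Finset.sum_filter]
  refine (Finset.sum_le_sum_of_subset_of_nonneg (fun u hu => ?_) fun u _ _ => ?_).trans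
    (Finset.sum_le_sum fun u _ => siteBound_add_abs_le hε h _)
  · refine Finset.mem_filter.2 ⟨Finset.mem_univ _, fun hbox => (Finset.mem_filter.1 hu).2 ?_⟩
    have hMbox := box_subset_box (Nat.sub_le M S.radius) hbox
    refine Finset.mem_image.2 ⟨((), proj M (rep u)), ?_, ?_⟩
    · rw [Finset.mem_filter]
      exact ⟨Finset.mem_product.2 ⟨Finset.mem_singleton_self _, Finset.mem_univ _⟩,
        by rw [rep_proj hMbox]; exact hbox⟩
    · simp only [blockSite, zero_add]
      rw [rep_proj hMbox, proj_rep]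
  · have := S.siteBound_nonneg
    positivity

variable {ν : Measure ℝ} [IsProbabilityMeasure ν]

/-- Mean free energies of different boxes, compared by a tiling of the larger torus. -/
lemma abs_integral_normFreeEnergy_sub_le (hν : MemLp id 2 ν) (hβ : β ≠ 0) (hε : 0 ≤ ε) (h : ℝ)
    {K M m : ℕ} (hK : S.radius ≤ K) (hM : S.radius ≤ M) (hm : m * (2 * M + 1) ≤ 2 * K + 1) :
    |∫ η, S.normFreeEnergy β ε h K η ∂(fieldLaw d ν)
        - (m : ℝ) ^ d * ∫ η, S.normFreeEnergy β ε h M η ∂(fieldLaw d ν)|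
      ≤ 2 * (((2 * K + 1 : ℕ) : ℝ) ^ d - (m : ℝ) ^ d * ((2 * (M - S.radius) + 1 : ℕ) : ℝ) ^ d)
        * (S.siteBound + |h| + ε * ∫ t, |t| ∂ν) := by
  set c : (Fin d → Fin m) → Torus d K := fun i => proj K fun k => ((2 * M + 1 : ℕ) : ℤ) * (i k : ℕ)
    with hc
  have hinj : Function.Injective (blockSite K M c) := blockSite_tiling_injective hm
  set bad := Finset.univ.filter fun u => u ∉ (Finset.univ.filter
    fun p : (Fin d → Fin m) × Torus d M => rep p.2 ∈ box d (M - S.radius)).image (blockSite K M c)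
    with hbad
  have pt : ∀ η : Fields d, |S.normFreeEnergy β ε h K η - ∑ i : Fin d → Fin m,
      nfree β (S.ham M fun v => h + ε * η (rep (blockSite K M c (i, v))))|
      ≤ 2 * ∑ u ∈ bad, (S.siteBound + |h| + ε * |η (rep u)|) := fun η =>
    (abs_nfree_sub_sum_blocks_le (S := S) hβ hK hM c hinj fun v => h + ε * η (rep v)).trans
      (mul_le_mul_of_nonneg_left (Finset.sum_le_sum fun u _ => siteBound_add_abs_le hε h _)
        zero_le_two)
  have hmeas := (continuous_nfree_ham (S := S) hβ hM ε h).measurable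
  have hgi : ∀ i, Function.Injective fun v : Torus d M => rep (blockSite K M c (i, v)) := fun i =>
    rep_injective.comp (hinj.comp (Prod.mk_right_injective i))
  have iK := (siteLipschitz_normFreeEnergy (S := S) hβ hε h hK).integrable hν
  have iM := (siteLipschitz_normFreeEnergy (S := S) hβ hε h hM).integrable hν
  have ii : ∀ i, Integrable (fun η : Fields d =>
      nfree β (S.ham M fun v => h + ε * η (rep (blockSite K M c (i, v))))) (fieldLaw d ν) :=
    fun i => integrable_comp_sites ν hmeas rep_injective (hgi i) iM
  -- A block reads the fields at distinct sites, so its mean free energy is that of Γ_M wherever it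
  -- lies.
  have ei : ∀ i, ∫ η : Fields d, nfree β (S.ham M fun v => h + ε * η (rep (blockSite K M c (i, v))))
      ∂(fieldLaw d ν) = ∫ η, S.normFreeEnergy β ε h M η ∂(fieldLaw d ν) :=
    fun i => integral_comp_sites ν hmeas (hgi i) rep_injective
  have iabs : ∀ x, Integrable (fun η : Fields d => S.siteBound + |h| + ε * |η x|) (fieldLaw d ν) :=
    fun x => (integrable_const _).add
      ((((memLp_eval ν hν x).integrable one_le_two).abs).const_mul ε)
  have e1 : ∫ η, (S.normFreeEnergy β ε h K η - ∑ i : Fin d → Fin m,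
      nfree β (S.ham M fun v => h + ε * η (rep (blockSite K M c (i, v))))) ∂(fieldLaw d ν)
      = ∫ η, S.normFreeEnergy β ε h K η ∂(fieldLaw d ν)
        - (m : ℝ) ^ d * ∫ η, S.normFreeEnergy β ε h M η ∂(fieldLaw d ν) := by
    rw [integral_sub iK (integrable_finsetSum _ fun i _ => ii i),
      integral_finsetSum _ fun i _ => ii i]
    simp only [ei, Finset.sum_const, Finset.card_univ, Fintype.card_fun, Fintype.card_fin,
      nsmul_eq_mul, Nat.cast_pow]
  rw [← e1]
  have e2 : ∫ η : Fields d, 2 * ∑ u ∈ bad, (S.siteBound + |h| + ε * |η (rep u)|) ∂(fieldLaw d ν)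
      = 2 * bad.card * (S.siteBound + |h| + ε * ∫ t, |t| ∂ν) := by
    rw [integral_const_mul, integral_finsetSum _ fun u _ => iabs (rep u)]
    have : ∀ u : Torus d K, ∫ η : Fields d, (S.siteBound + |h| + ε * |η (rep u)|) ∂(fieldLaw d ν)
        = S.siteBound + |h| + ε * ∫ t, |t| ∂ν := fun u => by
      rw [integral_add (integrable_const _)
        ((((memLp_eval ν hν (rep u)).integrable one_le_two).abs).const_mul ε),
        integral_const_mul, integral_abs_eval hν]
      simp
    simp only [this, Finset.sum_const, nsmul_eq_mul]
    ring
  have hcard : (bad.card : ℝ)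
      = ((2 * K + 1 : ℕ) : ℝ) ^ d - (m : ℝ) ^ d * ((2 * (M - S.radius) + 1 : ℕ) : ℝ) ^ d := by
    have h1 : bad.card = Fintype.card (Torus d K) - ((Finset.univ.filter
        fun p : (Fin d → Fin m) × Torus d M => rep p.2 ∈ box d (M - S.radius)).image
          (blockSite K M c)).card := by
      rw [← Finset.card_compl]
      congr 1
      ext u
      simp [hbad]
    have h2 : (Finset.univ.filter
        fun p : (Fin d → Fin m) × Torus d M => rep p.2 ∈ box d (M - S.radius)).card
        = m ^ d * (2 * (M - S.radius) + 1) ^ d := by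
      have e : (Finset.univ.filter
          fun p : (Fin d → Fin m) × Torus d M => rep p.2 ∈ box d (M - S.radius))
          = Finset.univ ×ˢ (Finset.univ.filter fun v : Torus d M => rep v ∈ box d (M - S.radius)) := by
        ext p
        simp
      rw [e, Finset.card_product, card_filter_rep_mem_box (Nat.sub_le _ _)]
      simp
    have h3 := Finset.card_le_univ ((Finset.univ.filter
        fun p : (Fin d → Fin m) × Torus d M => rep p.2 ∈ box d (M - S.radius)).image
          (blockSite K M c))
    rw [h1, Nat.cast_sub h3, Finset.card_image_of_injective _ hinj, h2, card_torus]
    push_cast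
    ring
  rw [← hcard, ← e2]
  refine (abs_integral_le_integral_abs).trans (integral_mono
    (iK.sub (integrable_finsetSum _ fun i _ => ii i)).abs ?_ pt)
  exact (integrable_finsetSum _ fun u _ => iabs (rep u)).const_mul 2

/-- Convergence of the mean free energy densities. -/
lemma exists_tendsto_mean (hν : MemLp id 2 ν) (hβ : β ≠ 0) (hε : 0 ≤ ε)
    (h : ℝ) : ∃ l, Tendsto (fun K : ℕ => (∫ η, S.normFreeEnergy β ε h K η ∂(fieldLaw d ν))
      / ((box d K).card : ℝ)) atTop (𝓝 l) := by
  set a := S.siteBound + |h| + ε * ∫ t, |t| ∂ν with ha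
  set E : ℕ → ℝ := fun K => ∫ η, S.normFreeEnergy β ε h K η ∂(fieldLaw d ν) with hE
  set R := S.radius with hR
  -- The error per site that survives K → ∞ at fixed M is the boundary fraction of a block. A block
  -- size M making it less than e gives the density to which all large K are compared.
  have lim0 : Tendsto (fun M : ℕ => 2 * (1 - (((2 * (M - R) + 1 : ℕ) : ℝ) / (2 * M + 1 : ℕ)) ^ d) * a)
      atTop (𝓝 0) := by
    have h1 : Tendsto (fun M : ℕ => ((2 * (M - R) + 1 : ℕ) : ℝ) / (2 * M + 1 : ℕ)) atTop (𝓝 1) := by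
      have h0 : Tendsto (fun M : ℕ => (1 : ℝ) - (2 * R) * ((2 * M + 1 : ℕ) : ℝ)⁻¹) atTop
          (𝓝 (1 - 2 * R * 0)) := by
        refine tendsto_const_nhds.sub (Tendsto.const_mul _ ?_)
        refine tendsto_inv_atTop_zero.comp (tendsto_natCast_atTop_atTop.comp ?_)
        exact tendsto_atTop_mono (fun K => by simp only [id]; omega) tendsto_id
      rw [mul_zero, sub_zero] at h0
      refine h0.congr' ?_
      filter_upwards [eventually_ge_atTop R] with M hM
      rw [eq_div_iff (by positivity), sub_mul, mul_assoc, inv_mul_cancel₀ (by positivity)]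
      push_cast [Nat.cast_sub hM]
      ring
    have h2 := (((h1.pow d).const_sub 1).const_mul 2).mul_const a
    simpa using h2
  refine exists_tendsto_of_forall_eventually_near fun e he => ?_
  obtain ⟨M, hMe, hM⟩ := ((lim0.eventually (gt_mem_nhds he)).and (eventually_ge_atTop R)).exists
  refine ⟨E M / ((box d M).card : ℝ), ?_⟩
  have hρ := (tendsto_floor_ratio M).pow d
  rw [one_pow] at hρ
  set ρ : ℕ → ℝ := fun K =>
    ((((2 * K + 1) / (2 * M + 1) * (2 * M + 1) : ℕ) : ℝ) / (2 * K + 1 : ℕ)) ^ d with hρdef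
  set q := (((2 * (M - R) + 1 : ℕ) : ℝ) / (2 * M + 1 : ℕ)) ^ d with hq
  have lim1 : Tendsto (fun K => 2 * (1 - ρ K * q) * a + |ρ K - 1| * |E M / ((box d M).card : ℝ)|)
      atTop (𝓝 (2 * (1 - 1 * q) * a + |1 - 1| * |E M / ((box d M).card : ℝ)|)) :=
    (((hρ.mul_const q).const_sub 1).const_mul 2 |>.mul_const a).add
      ((hρ.sub_const 1).abs.mul_const _)
  rw [sub_self, abs_zero, zero_mul, add_zero, one_mul] at lim1
  filter_upwards [lim1.eventually (gt_mem_nhds hMe), eventually_ge_atTop R] with K hKe hK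
  refine le_trans ?_ hKe.le
  have hb := abs_integral_normFreeEnergy_sub_le (S := S) hν hβ hε h hK hM
    (Nat.div_mul_le_self (2 * K + 1) (2 * M + 1))
  rw [← ha, ← hR] at hb
  set m := (2 * K + 1) / (2 * M + 1) with hm
  have pK : (0 : ℝ) < ((2 * K + 1 : ℕ) : ℝ) ^ d := by positivity
  have pM : (0 : ℝ) < ((2 * M + 1 : ℕ) : ℝ) ^ d := by positivity
  have hb2 := div_le_div_of_nonneg_right hb pK.le
  rw [← abs_of_pos pK, ← abs_div, abs_of_pos pK, sub_div] at hb2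
  have e1 : (m : ℝ) ^ d * E M / ((2 * K + 1 : ℕ) : ℝ) ^ d = ρ K * (E M / ((box d M).card : ℝ)) := by
    simp only [hρdef, card_box, ← hm]
    push_cast
    rw [div_pow, mul_pow]
    push_cast at pK pM
    field_simp
  have e2 : 2 * (((2 * K + 1 : ℕ) : ℝ) ^ d - (m : ℝ) ^ d * ((2 * (M - R) + 1 : ℕ) : ℝ) ^ d) * a
      / ((2 * K + 1 : ℕ) : ℝ) ^ d = 2 * (1 - ρ K * q) * a := by
    simp only [hρdef, hq, ← hm]
    push_cast
    rw [div_pow, div_pow, mul_pow]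
    push_cast at pK pM
    field_simp
  rw [e2] at hb2
  have hb3 : |E K / ((box d K).card : ℝ) - ρ K * (E M / ((box d M).card : ℝ))|
      ≤ 2 * (1 - ρ K * q) * a := by
    rw [← e1]
    rw [card_box]
    push_cast at hb2 ⊢
    exact hb2
  have e3 : E K / ((box d K).card : ℝ) - E M / ((box d M).card : ℝ)
      = (E K / ((box d K).card : ℝ) - ρ K * (E M / ((box d M).card : ℝ)))
        + (ρ K - 1) * (E M / ((box d M).card : ℝ)) := by ring
  rw [e3]
  refine (abs_add_le _ _).trans (add_le_add hb3 ?_)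
  rw [abs_mul]

lemma integral_boxBound (hν : MemLp id 2 ν) (h : ℝ) (L : ℕ) :
    ∫ η, S.boxBound ε h L η ∂(fieldLaw d ν)
      = (box d L).card * (S.siteBound + |h| + ε * ∫ t, |t| ∂ν) := by
  have i1 : ∀ x, Integrable (fun η : Fields d => ε * |η x|) (fieldLaw d ν) := fun x =>
    (((memLp_eval ν hν x).integrable one_le_two).abs).const_mul ε
  have i2 : ∀ x, Integrable (fun η : Fields d => S.siteBound + |h| + ε * |η x|) (fieldLaw d ν) :=
    fun x => (integrable_const _).add (i1 x)
  unfold boxBound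
  rw [integral_finsetSum _ fun x _ => i2 x]
  have : ∀ x : Fin d → ℤ, ∫ η : Fields d, (S.siteBound + |h| + ε * |η x|) ∂(fieldLaw d ν)
      = S.siteBound + |h| + ε * ∫ t, |t| ∂ν := fun x => by
    rw [integral_add (integrable_const _) (i1 x), integral_const_mul, integral_abs_eval hν]
    simp
  simp only [this, Finset.sum_const, nsmul_eq_mul]

/-- Almost sure convergence of the free energy densities at one value of the field `h`. -/
lemma ae_tendsto_normFreeEnergy (hd : 1 ≤ d) (hν : MemLp id 2 ν) (hβ : β ≠ 0) (hε : 0 ≤ ε)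
    {h l : ℝ} (hl : Tendsto (fun K : ℕ => (∫ η, S.normFreeEnergy β ε h K η ∂(fieldLaw d ν))
      / ((box d K).card : ℝ)) atTop (𝓝 l)) :
    ∀ᵐ η ∂(fieldLaw d ν), Tendsto (fun K : ℕ => S.normFreeEnergy β ε h K η
      / ((box d K).card : ℝ)) atTop (𝓝 l) := by
  have hsq : Tendsto (fun n : ℕ => n ^ 2) atTop atTop := tendsto_pow_atTop two_ne_zero
  filter_upwards [ae_tendsto_centered_div_card hd hν hε
      (fun K (hK : S.radius ≤ K) => siteLipschitz_normFreeEnergy (S := S) hβ hε h hK),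
    ae_tendsto_centered_div_card (N := 0) hd hν hε
      (fun K _ => siteLipschitz_boxBound (S := S) hε h K)] with η h1 h2
  have c1 := h1.add (hl.comp hsq)
  have c2 := h2.add (tendsto_const_nhds (x := S.siteBound + |h| + ε * ∫ t, |t| ∂ν))
  rw [zero_add] at c1 c2
  have := tendsto_div_of_tendsto_squares d (x := fun K => S.normFreeEnergy β ε h K η)
    (N := fun K => S.boxBound ε h K η) (R := S.radius) (boxBound_mono hε h η)
    (fun K M hM hMK => abs_normFreeEnergy_sub_le hβ hε h η hM hMK)
    (c1.congr fun n => ?_) (c2.congr fun n => ?_)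
  · simpa only [card_box] using this
  · simp only [Function.comp_apply, card_box]
    ring
  · rw [integral_boxBound hν, card_box]
    have : (((2 * n ^ 2 + 1) ^ d : ℕ) : ℝ) ≠ 0 := by positivity
    field_simp
    ring

/-- Existence of the free energy density, which is also the limit of the mean densities. -/
lemma exists_freeEnergyDensity (hd : 1 ≤ d) (hν : MemLp id 2 ν) (hβ : β ≠ 0) (hε : 0 ≤ ε) :
    ∃ F : ℝ → ℝ, IsFreeEnergyDensity S ν β ε F ∧ ∀ h, Tendsto (fun K : ℕ =>
      (∫ η, S.freeEnergy β ε h K η ∂(fieldLaw d ν)) / ((box d K).card : ℝ)) atTop (𝓝 (F h)) := by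
  choose l hl using fun h => exists_tendsto_mean (S := S) hν hβ hε h
  set b := (β.toReal)⁻¹ * Real.log (Fintype.card σ) with hb
  have hB : ∀ K, (0 : ℝ) < ((box d K).card : ℝ) := fun K => by rw [card_box]; positivity
  have hmean : ∀ h, Tendsto (fun K : ℕ =>
      (∫ η, S.freeEnergy β ε h K η ∂(fieldLaw d ν)) / ((box d K).card : ℝ)) atTop
      (𝓝 (l h - b)) := by
    intro h
    refine ((hl h).sub_const b).congr' ?_
    filter_upwards [eventually_ge_atTop S.radius] with K hK
    simp only [normFreeEnergy_eq]
    rw [integral_add ((siteLipschitz_freeEnergy hβ hε h hK).integrable hν) (integrable_const _)]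
    simp only [integral_const, probReal_univ, smul_eq_mul, one_mul]
    have := (hB K).ne'
    field_simp
    ring
  refine ⟨fun h => l h - b, ?_, hmean⟩
  -- One null set serves all rational fields; since the densities are 1-Lipschitz in h, it serves
  -- all real fields too.
  have hq : ∀ᵐ η ∂(fieldLaw d ν), ∀ r : ℚ, Tendsto (fun K : ℕ => S.freeEnergy β ε r K η
      / ((box d K).card : ℝ)) atTop (𝓝 (l r - b)) := by
    refine ae_all_iff.2 fun r => ?_
    filter_upwards [ae_tendsto_normFreeEnergy hd hν hβ hε (hl r)] with η hη
    refine (hη.sub_const b).congr fun K => ?_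
    rw [normFreeEnergy_eq]
    have := (hB K).ne'
    field_simp
    ring
  have hFL : ∀ h h', |(l h - b) - (l h' - b)| ≤ |h - h'| := by
    intro h h'
    refine le_of_tendsto ((hmean h).sub (hmean h')).abs ?_
    filter_upwards [eventually_ge_atTop S.radius] with K hK
    rw [← sub_div, abs_div, abs_of_pos (hB K), div_le_iff₀ (hB K),
      ← integral_sub ((siteLipschitz_freeEnergy hβ hε h hK).integrable hν)
        ((siteLipschitz_freeEnergy hβ hε h' hK).integrable hν)]
    refine (abs_integral_le_integral_abs).trans ?_
    calc _ ≤ ∫ _η : Fields d, ((box d K).card : ℝ) * |h - h'| ∂(fieldLaw d ν) :=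
          integral_mono (((siteLipschitz_freeEnergy hβ hε h hK).integrable hν).sub
            ((siteLipschitz_freeEnergy hβ hε h' hK).integrable hν)).abs (integrable_const _)
            fun η => abs_freeEnergy_sub_le hβ h h' hK η
      _ = _ := by simp [mul_comm]
  filter_upwards [hq] with η hη h
  refine Metric.tendsto_atTop'.2 fun e he => ?_
  obtain ⟨r, hr1, hr2⟩ := exists_rat_btwn (show h < h + e / 3 by linarith)
  have hrr : |h - r| < e / 3 := by rw [abs_lt]; constructor <;> linarith
  obtain ⟨N, hN⟩ := Metric.tendsto_atTop'.1 (hη r) (e / 3) (by positivity)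
  refine ⟨max N S.radius, fun K hK => ?_⟩
  have k1 := hN K (lt_of_le_of_lt (le_max_left _ _) hK)
  have k2 := abs_freeEnergy_sub_le (ε := ε) hβ h r ((le_max_right N S.radius).trans hK.le) η
  have k3 := hFL h r
  have k4 : |S.freeEnergy β ε h K η / ((box d K).card : ℝ)
      - S.freeEnergy β ε r K η / ((box d K).card : ℝ)| ≤ |h - r| := by
    rw [← sub_div, abs_div, abs_of_pos (hB K), div_le_iff₀ (hB K), mul_comm]
    exact k2
  rw [Real.dist_eq, abs_lt] at k1 ⊢
  rw [abs_le] at k3 k4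
  constructor <;> linarith

end LatticeSystem

end DisorderedLattice

namespace DisorderedLattice

/-! ### Concave functions of one variable and limits of their slopes -/

section Supergradient

/-- `p t` is a supergradient of `φ` at every point `t`. -/
def IsSupergrad (φ p : ℝ → ℝ) : Prop := ∀ t u, φ u ≤ φ t + p t * (u - t)

namespace IsSupergrad

variable {φ p : ℝ → ℝ}

lemma antitone (h : IsSupergrad φ p) : Antitone p := fun t u htu => by
  rcases htu.eq_or_lt with rfl | htu
  · exact le_rfl
  have h1 := h t u
  have h2 := h u t
  refine le_of_mul_le_mul_right ?_ (sub_pos.2 htu)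
  linarith

lemma abs_sub_sub_le (h : IsSupergrad φ p) (t u : ℝ) :
    |φ u - φ t - p t * (u - t)| ≤ |p u - p t| * |u - t| := by
  have h1 := h t u
  have h2 := h u t
  rw [← abs_mul, abs_of_nonpos (by linarith)]
  refine le_trans ?_ (neg_le_abs _)
  linarith

lemma abs_sub_le (h : IsSupergrad φ p) {c : ℝ} (hc : ∀ t, |p t| ≤ c) (t u : ℝ) :
    |φ u - φ t| ≤ c * |u - t| := by
  have key : ∀ t u, φ u - φ t ≤ c * |u - t| := fun t u => by
    have h1 := le_abs_self (p t * (u - t))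
    rw [abs_mul] at h1
    have h2 := mul_le_mul_of_nonneg_right (hc t) (abs_nonneg (u - t))
    linarith [h t u]
  refine abs_le.2 ⟨?_, key t u⟩
  have := key u t
  rw [abs_sub_comm] at this
  linarith

lemma continuous (h : IsSupergrad φ p) {c : ℝ} (hc : ∀ t, |p t| ≤ c) : Continuous φ := by
  have hc0 : 0 ≤ c := (abs_nonneg _).trans (hc 0)
  refine (LipschitzWith.of_dist_le_mul (K := c.toNNReal) fun u t => ?_).continuous
  rw [Real.dist_eq, Real.dist_eq, Real.coe_toNNReal c hc0]
  exact h.abs_sub_le hc t u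

lemma hasDerivAt (h : IsSupergrad φ p) {t : ℝ} (ht : ContinuousAt p t) :
    HasDerivAt φ (p t) t := by
  rw [hasDerivAt_iff_isLittleO, Asymptotics.isLittleO_iff]
  intro e he
  filter_upwards [Metric.tendsto_nhds.1 ht e he] with u hu
  rw [Real.dist_eq] at hu
  simp only [smul_eq_mul, Real.norm_eq_abs]
  rw [mul_comm (u - t)]
  exact (h.abs_sub_sub_le t u).trans (mul_le_mul_of_nonneg_right hu.le (abs_nonneg _))

/-- A supergradient is monotone, so it has countably many discontinuities, and off them it is the
derivative of φ. -/
lemma integral_eq (h : IsSupergrad φ p) {c : ℝ} (hc : ∀ t, |p t| ≤ c) (a b : ℝ) :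
    ∫ t in a..b, p t = φ b - φ a :=
  integral_eq_of_hasDerivAt_off_countable φ p h.antitone.countable_not_continuousAt
    (h.continuous hc).continuousOn
    (fun _ hx => h.hasDerivAt (not_not.1 hx.2))
    h.antitone.intervalIntegrable

/-- Supergradients of convergent functions converge where the limit is differentiable. -/
lemma tendsto_of_continuousAt (h : IsSupergrad φ p) {φ' p' : ℕ → ℝ → ℝ}
    (h' : ∀ j, IsSupergrad (φ' j) (p' j)) (hlim : ∀ t, Tendsto (fun j => φ' j t) atTop (𝓝 (φ t)))
    {t : ℝ} (ht : ContinuousAt p t) : Tendsto (fun j => p' j t) atTop (𝓝 (p t)) := by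
  refine tendsto_order.2 ⟨fun a ha => ?_, fun a ha => ?_⟩
  -- The chord of φ from t to s has slope at least p s > a. The chords of φ' j converge to it, and
  -- p' j t is at least the slope of its chord. The upper bound uses a point to the left of t.
  · obtain ⟨s, hs, hts⟩ : ∃ s, a < p s ∧ t < s :=
      ((ht.eventually (lt_mem_nhds ha)).filter_mono (nhdsWithin_le_nhds (s := Set.Ioi t)) |>.and
        self_mem_nhdsWithin).exists
    have hst := sub_pos.2 hts
    have h1 : a * (s - t) < φ s - φ t := by
      have := h s t
      nlinarith
    filter_upwards [((hlim s).sub (hlim t)).eventually (lt_mem_nhds h1)] with j hj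
    have := h' j t s
    refine lt_of_mul_lt_mul_right ?_ hst.le
    linarith
  · obtain ⟨s, hs, hts⟩ : ∃ s, p s < a ∧ s < t :=
      ((ht.eventually (gt_mem_nhds ha)).filter_mono (nhdsWithin_le_nhds (s := Set.Iio t)) |>.and
        self_mem_nhdsWithin).exists
    have hst := sub_pos.2 hts
    have h1 : φ t - φ s < a * (t - s) := by
      have := h s t
      nlinarith
    filter_upwards [((hlim t).sub (hlim s)).eventually (gt_mem_nhds h1)] with j hj
    have := h' j t s
    refine lt_of_mul_lt_mul_right ?_ hst.le
    linarith

/-- A pointwise limit of functions with bounded supergradients has bounded supergradients. -/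
lemma exists_of_tendsto {φ' p' : ℕ → ℝ → ℝ} (h' : ∀ j, IsSupergrad (φ' j) (p' j))
    (hlim : ∀ t, Tendsto (fun j => φ' j t) atTop (𝓝 (φ t))) {c : ℝ} (hc : ∀ j t, |p' j t| ≤ c) :
    ∃ p, IsSupergrad φ p ∧ (∀ t, |p t| ≤ c) ∧
      ∀ C, (∀ j t u, |p' j t - p' j u| ≤ C * |t - u|) → ∀ t u, |p t - p u| ≤ C * |t - u| := by
  -- Along an ultrafilter the bounded slopes converge at every t simultaneously, and every
  -- non-strict inequality passes to the limit.
  set ℱ : Ultrafilter ℕ := hyperfilter ℕ with hF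
  have hle : (ℱ : Filter ℕ) ≤ atTop := by
    rw [← Nat.cofinite_eq_atTop]; exact hyperfilter_le_cofinite
  have hex : ∀ t, ∃ a, Tendsto (fun j => p' j t) ℱ (𝓝 a) := by
    intro t
    obtain ⟨a, -, ha⟩ := (isCompact_Icc (a := -c) (b := c)).ultrafilter_le_nhds
      (ℱ.map fun j => p' j t)
      (le_principal_iff.2 (Ultrafilter.mem_map.2 (Filter.univ_mem' fun j => abs_le.1 (hc j t))))
    exact ⟨a, ha⟩
  choose p hp using hex
  refine ⟨p, fun t u => ?_, fun t => ?_, fun C hC t u => ?_⟩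
  · exact le_of_tendsto_of_tendsto' ((hlim u).mono_left hle)
      (((hlim t).mono_left hle).add ((hp t).mul_const _)) fun j => h' j t u
  · exact le_of_tendsto' (hp t).abs fun j => hc j t
  · exact le_of_tendsto' ((hp t).sub (hp u)).abs fun j => hC j t u

/-- One-sided derivatives, as limits of supergradients. -/
lemma exists_hasDerivWithinAt_Ioi (h : IsSupergrad φ p) {c : ℝ} (hc : ∀ t, |p t| ≤ c) (t : ℝ) :
    ∃ D, Tendsto p (𝓝[>] t) (𝓝 D) ∧ HasDerivWithinAt φ D (Set.Ioi t) t := by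
  have hbdd : BddAbove (p '' Set.Ioi t) :=
    ⟨c, by rintro _ ⟨u, -, rfl⟩; exact (le_abs_self _).trans (hc u)⟩
  have hD := h.antitone.tendsto_nhdsGT t
  refine ⟨_, hD, ?_⟩
  set D := sSup (p '' Set.Ioi t)
  rw [hasDerivWithinAt_iff_tendsto_slope' (by simp)]
  refine tendsto_of_tendsto_of_tendsto_of_le_of_le' hD tendsto_const_nhds ?_ ?_
  · filter_upwards [self_mem_nhdsWithin] with u hu
    have hut : 0 < u - t := sub_pos.2 hu
    rw [slope_def_field, le_div_iff₀ hut]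
    have := h u t
    linarith
  · filter_upwards [self_mem_nhdsWithin] with u hu
    have hut : 0 < u - t := sub_pos.2 hu
    rw [slope_def_field, div_le_iff₀ hut]
    have hcont : Tendsto (fun s => φ u - φ s) (𝓝[>] t) (𝓝 (φ u - φ t)) :=
      (((h.continuous hc).tendsto t).const_sub _).mono_left nhdsWithin_le_nhds
    have hcont' : Tendsto (fun s => D * (u - s)) (𝓝[>] t) (𝓝 (D * (u - t))) :=
      ((((continuous_id.tendsto t).const_sub u).const_mul D)).mono_left nhdsWithin_le_nhds
    refine le_of_tendsto_of_tendsto hcont hcont' ?_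
    filter_upwards [self_mem_nhdsWithin,
      (gt_mem_nhds (show t < u from hu)).filter_mono nhdsWithin_le_nhds] with s hs hsu
    have h1 := h s u
    have h2 : p s ≤ D := le_csSup hbdd ⟨s, hs, rfl⟩
    have := mul_le_mul_of_nonneg_right h2 (sub_pos.2 hsu).le
    linarith

lemma reflect (h : IsSupergrad φ p) : IsSupergrad (fun t => φ (-t)) (fun t => -p (-t)) :=
  fun t u => by
    have := h (-t) (-u)
    simp only
    linarith

lemma exists_hasDerivWithinAt_Iio (h : IsSupergrad φ p) {c : ℝ} (hc : ∀ t, |p t| ≤ c) (t : ℝ) :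
    ∃ D, Tendsto p (𝓝[<] t) (𝓝 D) ∧ HasDerivWithinAt φ D (Set.Iio t) t := by
  obtain ⟨D, h1, h2⟩ := h.reflect.exists_hasDerivWithinAt_Ioi
    (c := c) (fun t => by rw [abs_neg]; exact hc _) (-t)
  have hneg : Tendsto (fun s : ℝ => -s) (𝓝[<] t) (𝓝[>] (-t)) := tendsto_neg_nhdsLT
  refine ⟨-D, ?_, ?_⟩
  · have := (h1.comp hneg).neg
    refine this.congr fun s => ?_
    simp
  · rw [hasDerivWithinAt_iff_tendsto_slope' (by simp)] at h2 ⊢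
    refine (h2.comp hneg).neg.congr fun s => ?_
    simp only [Function.comp_apply, slope_def_field, neg_neg]
    rw [← div_neg]
    congr 1
    ring

end IsSupergrad

lemma tendsto_integral_of_supergrad {φ p : ℝ → ℝ} {φ' p' : ℕ → ℝ → ℝ} {ν : Measure ℝ}
    [IsProbabilityMeasure ν] (h : IsSupergrad φ p)
    (h' : ∀ j, IsSupergrad (φ' j) (p' j)) (hlim : ∀ t, Tendsto (fun j => φ' j t) atTop (𝓝 (φ t)))
    {c : ℝ} (hc : ∀ j t, |p' j t| ≤ c) (hν : ∀ᵐ t ∂ν, ContinuousAt p t) :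
    Tendsto (fun j => ∫ t, p' j t ∂ν) atTop (𝓝 (∫ t, p t ∂ν)) := by
  refine tendsto_integral_of_dominated_convergence (fun _ => c)
    (fun j => (h' j).antitone.measurable.aestronglyMeasurable) (integrable_const _)
    (fun j => Eventually.of_forall (hc j)) ?_
  filter_upwards [hν] with t ht
  exact h.tendsto_of_continuousAt h' hlim ht

lemma ae_continuousAt_of_antitone {p : ℝ → ℝ} (hp : Antitone p) {ν : Measure ℝ}
    (hν : ν ≪ volume) : ∀ᵐ t ∂ν, ContinuousAt p t := by
  have h0 : volume {t | ¬ ContinuousAt p t} = 0 :=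
    hp.countable_not_continuousAt.measure_zero volume
  exact hν h0

lemma integrable_of_supergrad {φ p : ℝ → ℝ} (h : IsSupergrad φ p) {c : ℝ} (hc : ∀ t, |p t| ≤ c)
    (ν : Measure ℝ) [IsProbabilityMeasure ν] : Integrable p ν :=
  Integrable.of_bound h.antitone.measurable.aestronglyMeasurable c (Eventually.of_forall hc)

/-- Difference quotients bound limits of supergradients. -/
lemma le_of_tendsto_supergrad {φ p : ℝ → ℝ} (h : IsSupergrad φ p) {φ' : ℕ → ℝ → ℝ}
    (hlim : ∀ t, Tendsto (fun j => φ' j t) atTop (𝓝 (φ t))) {e : ℝ} (he : 0 ≤ e) {q : ℕ → ℝ} {t E : ℝ}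
    (hq : ∀ j u, φ' j u ≤ φ' j t + q j * (u - t))
    (hE : Tendsto (fun j => e * q j) atTop (𝓝 E)) {s : ℝ} :
    (s < t → E ≤ e * p s) ∧ (t < s → e * p s ≤ E) := by
  -- Only e * q j is assumed to converge. This matters for e = 0, where the slopes q j themselves
  -- need not have a limit.
  have key : E * (t - s) ≤ e * (φ t - φ s) := by
    refine le_of_tendsto_of_tendsto' (hE.mul_const _) (((hlim t).sub (hlim s)).const_mul e)
      fun j => ?_
    have := mul_le_mul_of_nonneg_left (hq j s) he
    linarith
  have h2 := mul_le_mul_of_nonneg_left (h s t) he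
  refine ⟨fun hs => ?_, fun hs => ?_⟩
  · refine le_of_mul_le_mul_right ?_ (sub_pos.2 hs)
    linarith
  · refine le_of_mul_le_mul_right ?_ (sub_pos.2 hs)
    linarith

end Supergradient

/-! ### Compactness of Lipschitz functions of the fields -/

section SiteLipschitzLimits

variable {d : ℕ} {ν : Measure ℝ} [IsProbabilityMeasure ν]

/-- Arzelà–Ascoli for pointwise limits: compactness of a countable product gives convergence on a
countable dense set, and equicontinuity extends it to all η. -/
lemma exists_subseq_tendsto {ι : Type*} [Countable ι] {u : ℕ → ι → Fields d → ℝ}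
    {s : ι → Finset (Fin d → ℤ)} {c : ℝ} (hu : ∀ n i, SiteLipschitz (u n i) (s i) c)
    {b : ι → ℝ} (hb : ∀ n i, |u n i 0| ≤ b i) :
    ∃ φ : ℕ → ℕ, StrictMono φ ∧ ∃ U : ι → Fields d → ℝ, ∀ i η,
      Tendsto (fun n => u (φ n) i η) atTop (𝓝 (U i η)) := by
  obtain ⟨D, hDc, hDd⟩ := TopologicalSpace.exists_countable_dense (Fields d)
  have := hDc.to_subtype
  set B : ι × D → ℝ := fun p => b p.1 + c * ∑ x ∈ s p.1, |(p.2 : Fields d) x|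
  have hcomp : IsCompact (Set.pi Set.univ fun p : ι × D => Set.Icc (-B p) (B p)) :=
    isCompact_univ_pi fun p => isCompact_Icc
  obtain ⟨a, -, φ, hφ, ha⟩ := hcomp.tendsto_subseq (x := fun n p => u n p.1 p.2) fun n p _ => by
    rw [Set.mem_Icc, ← abs_le]
    exact ((hu n p.1).abs_le _).trans (add_le_add_left (hb n p.1) _)
  rw [tendsto_pi_nhds] at ha
  refine ⟨φ, hφ, ?_⟩
  have key : ∀ i η, ∃ l, Tendsto (fun n => u (φ n) i η) atTop (𝓝 l) := by
    intro i η
    refine exists_tendsto_of_forall_eventually_near fun e he => ?_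
    have hcont : Continuous fun q : Fields d => c * ∑ x ∈ s i, |η x - q x| := by fun_prop
    have hη : c * ∑ x ∈ s i, |η x - η x| < e / 2 := by simpa using by positivity
    obtain ⟨q, hqD, hq⟩ := hDd.exists_mem_open (isOpen_lt hcont continuous_const) ⟨η, hη⟩
    refine ⟨a (i, ⟨q, hqD⟩), ?_⟩
    filter_upwards [Metric.tendsto_nhds.1 (ha (i, ⟨q, hqD⟩)) (e / 2) (by positivity)] with n hn
    have h1 := hu (φ n) i η q
    rw [Real.dist_eq] at hn
    simp only [Function.comp_apply] at hn
    have h2 : c * ∑ x ∈ s i, |η x - q x| < e / 2 := hq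
    have h3 := abs_add_le (u (φ n) i η - u (φ n) i q) (u (φ n) i q - a (i, ⟨q, hqD⟩))
    rw [sub_add_sub_cancel] at h3
    linarith
  choose U hU using key
  exact ⟨U, hU⟩

lemma SiteLipschitz.of_tendsto {u : ℕ → Fields d → ℝ} {U : Fields d → ℝ}
    {s : Finset (Fin d → ℤ)} {c : ℝ} (hu : ∀ n, SiteLipschitz (u n) s c)
    (h : ∀ η, Tendsto (fun n => u n η) atTop (𝓝 (U η))) : SiteLipschitz U s c := fun η η' =>
  le_of_tendsto' ((h η).sub (h η')).abs fun n => hu n η η'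

lemma tendsto_integral_of_siteLipschitz (hν : MemLp id 2 ν) {u : ℕ → Fields d → ℝ}
    {U : Fields d → ℝ} {s : Finset (Fin d → ℤ)} {c b : ℝ} (hu : ∀ n, SiteLipschitz (u n) s c)
    (hb : ∀ n, |u n 0| ≤ b) (h : ∀ η, Tendsto (fun n => u n η) atTop (𝓝 (U η))) :
    Tendsto (fun n => ∫ η, u n η ∂(fieldLaw d ν)) atTop (𝓝 (∫ η, U η ∂(fieldLaw d ν))) := by
  refine tendsto_integral_of_dominated_convergence (fun η => b + c * ∑ x ∈ s, |η x|)
    (fun n => (hu n).measurable.aestronglyMeasurable) ?_ (fun n => Eventually.of_forall fun η => ?_)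
    (Eventually.of_forall h)
  · exact (integrable_const b).add ((integrable_finsetSum s fun x _ =>
      ((memLp_eval ν hν x).integrable one_le_two).abs).const_mul c)
  · exact ((hu n).abs_le η).trans (add_le_add_left (hb n) _)

lemma tendsto_condAv_of_siteLipschitz (hν : MemLp id 2 ν) {u : ℕ → Fields d → ℝ}
    {U : Fields d → ℝ} {s : Finset (Fin d → ℤ)} {c b : ℝ} (hc : 0 ≤ c)
    (hu : ∀ n, SiteLipschitz (u n) s c)
    (hb : ∀ n, |u n 0| ≤ b) (h : ∀ η, Tendsto (fun n => u n η) atTop (𝓝 (U η)))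
    (Λ : Finset (Fin d → ℤ)) (η : Fields d) :
    Tendsto (fun n => condAv ν Λ (u n) η) atTop (𝓝 (condAv ν Λ U η)) :=
  tendsto_integral_of_siteLipschitz hν (u := fun n ω => u n (splice Λ η ω))
    (b := b + c * ∑ x ∈ s, |splice Λ η 0 x|) (fun n => (hu n).comp_splice_left hc Λ η)
    (fun n => ((hu n).abs_le _).trans (add_le_add_left (hb n) _)) fun _ => h _

lemma condAv_condAv {f : Fields d → ℝ} {s : Finset (Fin d → ℤ)} {c : ℝ} (hc : 0 ≤ c)
    (hν : MemLp id 2 ν) (hf : SiteLipschitz f s c) {Λ Λ' : Finset (Fin d → ℤ)} (h : Λ ⊆ Λ')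
    (η : Fields d) : condAv ν Λ (condAv ν Λ' f) η = condAv ν Λ f η := by
  have h1 := integral_condAv ((hf.comp_splice_left hc Λ η).integrable hν) Λ'
  rw [condAv, condAv, ← h1]
  refine integral_congr_ae (Eventually.of_forall fun ω => ?_)
  refine integral_congr_ae (Eventually.of_forall fun ω' => ?_)
  simp only
  congr 1
  funext x
  simp only [splice]
  by_cases hx : x ∈ Λ
  · simp [hx, h hx]
  · simp [hx]

lemma lipSeminorm_le_of_siteLipschitz {f : Fields d → ℝ} {s : Finset (Fin d → ℤ)} {c : ℝ}
    (hc : 0 ≤ c) (hf : SiteLipschitz f s c) : lipSeminorm f ≤ ENNReal.ofReal c := by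
  refine iSup_le fun η => iSup_le fun η' => iSup_le fun _ => iSup_le fun _ => ?_
  refine ENNReal.div_le_of_le_mul ?_
  refine (ENNReal.ofReal_le_ofReal (hf η η')).trans ?_
  rw [ENNReal.ofReal_mul hc, ENNReal.ofReal_sum_of_nonneg fun _ _ => abs_nonneg _]
  exact mul_le_mul_right (ENNReal.sum_le_tsum (f := fun x => ENNReal.ofReal |(η - η') x|) s) _

end SiteLipschitzLimits

end DisorderedLattice

namespace DisorderedLattice

/-! ### Centered free energies in finite volume and their one-site slopes -/

namespace LatticeSystem

variable {σ : Type*} [Fintype σ] [DecidableEq σ] [Nonempty σ] {d : ℕ} {S : LatticeSystem d σ}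
  {β : ℝ≥0∞} {ε : ℝ} {ν : Measure ℝ} [IsProbabilityMeasure ν]

lemma freeEnergy_le (hβ : β ≠ 0) (h h' : ℝ) (K : ℕ) (η η' : Fields d) :
    S.freeEnergy β ε h' K η' ≤ S.freeEnergy β ε h K η
      + ∑ v, ((h' - h) + ε * (η' (rep v) - η (rep v))) * S.stateKappa β ε h K η v := by
  have hle := S.freeOf_ham_le hβ (K := K) (fun v => h + ε * η (rep v))
    (fun v => h' + ε * η' (rep v))
  simp only [freeEnergy_eq, stateKappa_eq]
  refine hle.trans (le_of_eq ?_)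
  congr 1
  exact Finset.sum_congr rfl fun v _ => by ring

lemma abs_stateKappa_le {K : ℕ} (hK : S.radius ≤ K) (h : ℝ) (η : Fields d) (v : Torus d K) :
    |S.stateKappa β ε h K η v| ≤ 1 := by
  rw [stateKappa_eq]
  exact abs_stateOf_torusKappa_le hK β _ v

lemma measurable_stateOf_ham (h : ℝ) {K : ℕ} (v : Torus d K) :
    Measurable fun ξ : Torus d K → ℝ =>
      stateOf β (S.ham K fun w => h + ε * ξ w) (S.torusKappa K v) :=
  measurable_stateOf ((S.continuous_ham K).comp
    (by fun_prop : Continuous fun (ξ : Torus d K → ℝ) w => h + ε * ξ w))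
    (fun _ => S.ham_isHermitian K _) β _

lemma measurable_stateKappa (h : ℝ) {K : ℕ} (v : Torus d K) :
    Measurable fun η : Fields d => S.stateKappa β ε h K η v := by
  simp only [stateKappa_eq]
  exact (measurable_stateOf_ham h v).comp
    (measurable_pi_lambda _ fun w => measurable_pi_apply (rep w))

lemma integrable_stateKappa {K : ℕ} (hK : S.radius ≤ K) (h : ℝ) (v : Torus d K) :
    Integrable (fun η : Fields d => S.stateKappa β ε h K η v) (fieldLaw d ν) :=
  Integrable.of_bound (measurable_stateKappa h v).aestronglyMeasurable 1
    (Eventually.of_forall fun η => abs_stateKappa_le hK h η v)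

/-- The mean of `⟨κ_v⟩` does not depend on the site `v`. -/
lemma integral_stateKappa (h : ℝ) {K : ℕ} (v : Torus d K) :
    ∫ η, S.stateKappa β ε h K η v ∂(fieldLaw d ν)
      = ∫ η, S.stateKappa β ε h K η 0 ∂(fieldLaw d ν) := by
  have e1 : ∀ η : Fields d, S.stateKappa β ε h K η v
      = stateOf β (S.ham K fun w => h + ε * η (rep (w + v))) (S.torusKappa K 0) := fun η => by
    rw [S.stateOf_ham_translate β 0 v fun w => h + ε * η (rep w), zero_add, stateKappa_eq]
  simp only [e1]
  simp only [stateKappa_eq]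
  exact integral_comp_sites ν (measurable_stateOf_ham h 0)
    (rep_injective.comp (add_left_injective v)) rep_injective

/-- The mean of `⟨κ_0⟩` is a supergradient of the mean free energy density. -/
lemma mean_freeEnergy_le (hν : MemLp id 2 ν) (hβ : β ≠ 0) (hε : 0 ≤ ε) {K : ℕ}
    (hK : S.radius ≤ K) :
    IsSupergrad (fun h => (∫ η, S.freeEnergy β ε h K η ∂(fieldLaw d ν)) / ((box d K).card : ℝ))
      (fun h => ∫ η, S.stateKappa β ε h K η 0 ∂(fieldLaw d ν)) := fun h h' => by
  have hB : (0 : ℝ) < ((box d K).card : ℝ) := by rw [card_box]; positivity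
  have i1 := (siteLipschitz_freeEnergy (S := S) hβ hε h hK).integrable hν
  have i2 := (siteLipschitz_freeEnergy (S := S) hβ hε h' hK).integrable hν
  have i3 : ∀ v : Torus d K, Integrable (fun η : Fields d => (h' - h) * S.stateKappa β ε h K η v)
      (fieldLaw d ν) := fun v => (integrable_stateKappa hK h v).const_mul _
  have key : ∫ η, S.freeEnergy β ε h' K η ∂(fieldLaw d ν)
      ≤ ∫ η, (S.freeEnergy β ε h K η
        + ∑ v, (h' - h) * S.stateKappa β ε h K η v) ∂(fieldLaw d ν) := by
    refine integral_mono i2 (i1.add (integrable_finsetSum _ fun v _ => i3 v)) fun η => ?_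
    have := freeEnergy_le (S := S) (ε := ε) hβ h h' K η η
    simpa only [sub_self, mul_zero, add_zero] using this
  rw [integral_add i1 (integrable_finsetSum _ fun v _ => i3 v),
    integral_finsetSum _ fun v _ => i3 v] at key
  simp only [integral_const_mul, integral_stateKappa, Finset.sum_const, Finset.card_univ,
    card_torus, nsmul_eq_mul] at key
  rw [div_le_iff₀ hB, add_mul, div_mul_cancel₀ _ hB.ne', card_box]
  linarith

lemma abs_integral_stateKappa_le {K : ℕ} (hK : S.radius ≤ K) (h : ℝ) (v : Torus d K) :
    |∫ η, S.stateKappa β ε h K η v ∂(fieldLaw d ν)| ≤ 1 := by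
  refine abs_integral_le_integral_abs.trans ?_
  calc _ ≤ ∫ _η : Fields d, (1 : ℝ) ∂(fieldLaw d ν) :=
        integral_mono (integrable_stateKappa hK h v).abs (integrable_const _)
          fun η => abs_stateKappa_le hK h η v
    _ = 1 := by simp

/-- Conditional averages of the free energy are covariant under translations. -/
lemma condAv_freeEnergy_translate (hβ : β ≠ 0) (h : ℝ) {K : ℕ} (hK : S.radius ≤ K)
    {Λ Λ' : Finset (Fin d → ℤ)} {x : Fin d → ℤ} (hΛ : translateSet (-x) Λ' = Λ)
    (hΛK : Λ ⊆ box d K) (hΛK' : Λ' ⊆ box d K) (η : Fields d) :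
    condAv ν Λ (S.freeEnergy β ε h K) η = condAv ν Λ' (S.freeEnergy β ε h K) (shiftField x η) := by
  have hmem : ∀ y, y ∈ Λ ↔ y + x ∈ Λ' := by
    intro y
    rw [← hΛ, translateSet, Finset.mem_map]
    constructor
    · rintro ⟨z, hz, rfl⟩
      simpa [addRightEmbedding] using hz
    · exact fun hy => ⟨y + x, hy, by simp [addRightEmbedding]⟩
  -- Both Λ and its translate lie in Γ_K, so the torus translation does not wrap on the frozen
  -- sites. It may wrap elsewhere, but those fields are integrated out.
  have hrep : ∀ v : Torus d K, rep (v + proj K x) ∈ Λ' ↔ rep v ∈ Λ := by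
    intro v
    constructor
    · intro hv
      have h1 : rep (v + proj K x) - x ∈ Λ := by rw [hmem]; simpa using hv
      have h2 : proj K (rep (v + proj K x) - x) = v := by
        have h3 := proj_add (K := K) (rep (v + proj K x) - x) x
        rw [sub_add_cancel, proj_rep] at h3
        exact (add_right_cancel h3).symm
      rw [← h2, rep_proj (hΛK h1)]
      exact h1
    · intro hv
      have h1 := (hmem _).1 hv
      rw [rep_add_proj (hΛK' h1)]
      exact h1
  set Ψ : (Torus d K → ℝ) → ℝ := fun ξ =>
    freeOf β (S.ham K fun v => h + ε * (if rep v ∈ Λ then η (rep v) else ξ v)) with hΨ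
  have hΨm : Measurable Ψ := by
    refine ((continuous_freeOf_ham hβ hK).comp (continuous_pi fun v => ?_)).measurable
    split_ifs <;> fun_prop
  have e1 : ∀ ω, S.freeEnergy β ε h K (splice Λ η ω) = Ψ fun v => ω (rep v) := fun ω => by
    rw [freeEnergy_eq]
    rfl
  have e2 : ∀ ω, S.freeEnergy β ε h K (splice Λ' (shiftField x η) ω)
      = Ψ fun v => ω (rep (v + proj K x)) := fun ω => by
    rw [freeEnergy_eq, ← S.freeOf_ham_translate β (proj K x)]
    simp only [hΨ]
    congr 2
    funext v
    congr 2
    simp only [splice, hrep v]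
    split_ifs with hv
    · rw [shiftField, rep_add_proj (hΛK' ((hmem _).1 hv)), add_sub_cancel_right]
    · rfl
  unfold condAv
  simp only [e1, e2]
  exact integral_comp_sites ν hΨm rep_injective
    (rep_injective.comp (add_left_injective (proj K x)))

variable (S β ε ν) in
/-- Centered conditional average of the free energy, given the fields in `Λ`. -/
noncomputable def centeredFree (h : ℝ) (K : ℕ) (Λ : Finset (Fin d → ℤ)) (η : Fields d) : ℝ :=
  condAv ν Λ (S.freeEnergy β ε h K) η - ∫ ω, S.freeEnergy β ε h K ω ∂(fieldLaw d ν)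

lemma siteLipschitz_centeredFree (hν : MemLp id 2 ν) (hβ : β ≠ 0) (hε : 0 ≤ ε) (h : ℝ) {K : ℕ}
    (hK : S.radius ≤ K) (Λ : Finset (Fin d → ℤ)) :
    SiteLipschitz (S.centeredFree β ε ν h K Λ) Λ ε := fun η η' => by
  rw [centeredFree, centeredFree, sub_sub_sub_cancel_right]
  exact (((siteLipschitz_freeEnergy hβ hε h hK).condAv hε hν Λ).mono
    Finset.inter_subset_right hε) η η'

lemma integral_centeredFree (hν : MemLp id 2 ν) (hβ : β ≠ 0) (hε : 0 ≤ ε) (h : ℝ) {K : ℕ}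
    (hK : S.radius ≤ K) (Λ : Finset (Fin d → ℤ)) :
    ∫ η, S.centeredFree β ε ν h K Λ η ∂(fieldLaw d ν) = 0 := by
  have hL := siteLipschitz_freeEnergy (S := S) hβ hε h hK
  unfold centeredFree
  rw [integral_sub ((hL.condAv hε hν Λ).integrable hν) (integrable_const _),
    integral_condAv (hL.integrable hν)]
  simp

/-- A Lipschitz function of mean zero cannot be large at 0. The bound is independent of K and h, as
compactness requires. -/
lemma abs_centeredFree_zero_le (hν : MemLp id 2 ν) (hβ : β ≠ 0) (hε : 0 ≤ ε) (h : ℝ) {K : ℕ}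
    (hK : S.radius ≤ K) (Λ : Finset (Fin d → ℤ)) :
    |S.centeredFree β ε ν h K Λ 0| ≤ ε * (Λ.card * ∫ t, |t| ∂ν) := by
  have hL := siteLipschitz_centeredFree (S := S) hν hβ hε h hK Λ
  have hi := hL.integrable hν
  have e : S.centeredFree β ε ν h K Λ 0 = ∫ η, (S.centeredFree β ε ν h K Λ 0
      - S.centeredFree β ε ν h K Λ η) ∂(fieldLaw d ν) := by
    rw [integral_sub (integrable_const _) hi, integral_centeredFree hν hβ hε h hK]
    simp
  have iabs : ∀ x : Fin d → ℤ, Integrable (fun η : Fields d => |η x|) (fieldLaw d ν) := fun x =>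
    ((memLp_eval ν hν x).integrable one_le_two).abs
  rw [e]
  refine abs_integral_le_integral_abs.trans ?_
  calc _ ≤ ∫ η : Fields d, ε * ∑ x ∈ Λ, |η x| ∂(fieldLaw d ν) := by
        refine integral_mono ((integrable_const _).sub hi).abs
          ((integrable_finsetSum _ fun x _ => iabs x).const_mul ε) fun η => ?_
        have := hL 0 η
        simpa using this
    _ = _ := by
        rw [integral_const_mul, integral_finsetSum _ fun x _ => iabs x]
        simp only [integral_abs_eval hν, Finset.sum_const, nsmul_eq_mul]

lemma condAv_centeredFree (hν : MemLp id 2 ν) (hβ : β ≠ 0) (hε : 0 ≤ ε) (h : ℝ) {K : ℕ}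
    (hK : S.radius ≤ K) {Λ Λ' Λ₀ : Finset (Fin d → ℤ)} {x : Fin d → ℤ}
    (hΛ : translateSet (-x) Λ' = Λ) (hΛ₀ : Λ ⊆ Λ₀) (hΛK : Λ ⊆ box d K) (hΛK' : Λ' ⊆ box d K)
    (η : Fields d) :
    condAv ν Λ (S.centeredFree β ε ν h K Λ₀) η
      = S.centeredFree β ε ν h K Λ' (shiftField x η) := by
  have hL := siteLipschitz_freeEnergy (S := S) hβ hε h hK
  rw [centeredFree, ← condAv_freeEnergy_translate hβ h hK hΛ hΛK hΛK' η,
    ← condAv_condAv hε hν hL hΛ₀ η]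
  have hi := ((hL.condAv hε hν Λ₀).comp_splice_left hε Λ η).integrable hν
  conv_lhs => unfold condAv centeredFree
  rw [integral_sub hi (integrable_const _)]
  simp [condAv]

lemma resetField_splice (L : ℕ) (η ω : Fields d) :
    resetField L (splice (box d L) η ω) = splice (box d L) 0 ω := by
  funext y
  simp only [resetField, splice]
  split_ifs <;> rfl

/-- After averaging off Γ_L the reset terms are constants, namely conditional averages at η = 0, and
centering removes them. -/
lemma centeredDiff_eq (hν : MemLp id 2 ν) (hβ : β ≠ 0) (hε : 0 ≤ ε) (h δ : ℝ) {K : ℕ}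
    (hK : S.radius ≤ K) (L : ℕ) (η : Fields d) :
    centeredDiff S ν β ε h L K δ η = (1 / 2) * (S.centeredFree β ε ν (h + δ) K (box d L) η
      - S.centeredFree β ε ν (h - δ) K (box d L) η) := by
  have hp := siteLipschitz_freeEnergy (S := S) hβ hε (h + δ) hK
  have hm := siteLipschitz_freeEnergy (S := S) hβ hε (h - δ) hK
  have e : ∀ η, secondDiff S ν β ε h L K δ η = (1 / 2) *
      (condAv ν (box d L) (S.freeEnergy β ε (h + δ) K) η
        - condAv ν (box d L) (S.freeEnergy β ε (h + δ) K) 0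
        - condAv ν (box d L) (S.freeEnergy β ε (h - δ) K) η
        + condAv ν (box d L) (S.freeEnergy β ε (h - δ) K) 0) := by
    intro η
    have i1 := (hp.comp_splice_left hε (box d L) η).integrable hν
    have i2 := (hp.comp_splice_left hε (box d L) 0).integrable hν
    have i3 := (hm.comp_splice_left hε (box d L) η).integrable hν
    have i4 := (hm.comp_splice_left hε (box d L) 0).integrable hν
    unfold secondDiff condAv
    simp only [resetField_splice]
    congr 1
    have i12 := i1.sub i2
    have i123 := i12.sub i3
    have k1 := integral_sub i1 i2
    have k2 := integral_sub i12 i3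
    have k3 := integral_add i123 i4
    simp only [Pi.sub_apply] at k1 k2 k3
    rw [k3, k2, k1]
  have j1 := (hp.condAv hε hν (box d L)).integrable hν
  have j2 := (hm.condAv hε hν (box d L)).integrable hν
  have e2 : ∫ η, secondDiff S ν β ε h L K δ η ∂(fieldLaw d ν) = (1 / 2) *
      (∫ η, S.freeEnergy β ε (h + δ) K η ∂(fieldLaw d ν)
        - condAv ν (box d L) (S.freeEnergy β ε (h + δ) K) 0
        - ∫ η, S.freeEnergy β ε (h - δ) K η ∂(fieldLaw d ν)
        + condAv ν (box d L) (S.freeEnergy β ε (h - δ) K) 0) := by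
    simp only [e]
    have j3 := j1.sub (integrable_const (condAv ν (box d L) (S.freeEnergy β ε (h + δ) K) 0))
    have j4 := j3.sub j2
    have k1 := integral_sub j1
      (integrable_const (condAv ν (box d L) (S.freeEnergy β ε (h + δ) K) 0))
    have k2 := integral_sub j3 j2
    have k3 := integral_add j4
      (integrable_const (condAv ν (box d L) (S.freeEnergy β ε (h - δ) K) 0))
    simp only [Pi.sub_apply] at k1 k2 k3
    rw [integral_const_mul, k3, k2, k1, integral_condAv (hp.integrable hν),
      integral_condAv (hm.integrable hν)]
    simp
  rw [centeredDiff, e, e2, centeredFree, centeredFree]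
  ring

/-- The field that equals `t` at the origin and `ω` elsewhere. -/
noncomputable def originField (t : ℝ) (ω : Fields d) : Fields d := splice (box d 0) (fun _ => t) ω

lemma originField_zero (t : ℝ) (ω : Fields d) : originField t ω 0 = t := by
  simp [originField, splice, box_zero]

lemma originField_of_ne {x : Fin d → ℤ} (hx : x ≠ 0) (t : ℝ) (ω : Fields d) :
    originField t ω x = ω x := by
  simp [originField, splice, box_zero, hx]

variable (S β ε ν) in
/-- The derivative in `t` of the free energy, averaged with the field at the origin equal to `t`. -/
noncomputable def originSlope (h : ℝ) (K : ℕ) (t : ℝ) : ℝ :=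
  ε * ∫ ω, S.stateKappa β ε h K (originField t ω) 0 ∂(fieldLaw d ν)

lemma measurable_originField :
    Measurable fun p : ℝ × Fields d => originField p.1 p.2 := by
  refine measurable_pi_lambda _ fun x => ?_
  unfold originField splice
  split_ifs
  · exact measurable_fst
  · exact (measurable_pi_apply x).comp measurable_snd

lemma integrable_stateKappa_originField {K : ℕ} (hK : S.radius ≤ K) (h t : ℝ) :
    Integrable (fun ω : Fields d => S.stateKappa β ε h K (originField t ω) 0) (fieldLaw d ν) :=
  Integrable.of_bound ((measurable_stateKappa h 0).comp
    (measurable_originField.comp measurable_prodMk_left)).aestronglyMeasurable 1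
    (Eventually.of_forall fun _ => abs_stateKappa_le hK h _ 0)

lemma abs_originSlope_le (hε : 0 ≤ ε) {K : ℕ} (hK : S.radius ≤ K) (h t : ℝ) :
    |S.originSlope β ε ν h K t| ≤ ε := by
  rw [originSlope, abs_mul, abs_of_nonneg hε]
  refine mul_le_of_le_one_right hε (abs_integral_le_integral_abs.trans ?_)
  calc _ ≤ ∫ _ω : Fields d, (1 : ℝ) ∂(fieldLaw d ν) :=
        integral_mono (integrable_stateKappa_originField hK h t).abs (integrable_const _)
          fun ω => abs_stateKappa_le hK h _ 0
    _ = 1 := by simp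

lemma isSupergrad_originSlope (hν : MemLp id 2 ν) (hβ : β ≠ 0) (hε : 0 ≤ ε) {K : ℕ}
    (hK : S.radius ≤ K) (h : ℝ) :
    IsSupergrad (fun t => S.centeredFree β ε ν h K (box d 0) fun _ => t)
      (S.originSlope β ε ν h K) := fun t u => by
  have hL := siteLipschitz_freeEnergy (S := S) hβ hε h hK
  have i1 := (hL.comp_splice_left hε (box d 0) fun _ => t).integrable hν
  have i2 := (hL.comp_splice_left hε (box d 0) fun _ => u).integrable hν
  have i3 := (integrable_stateKappa_originField (β := β) (ε := ε) (ν := ν) hK h t).const_mul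
    (ε * (u - t))
  have pt : ∀ ω : Fields d, S.freeEnergy β ε h K (originField u ω)
      ≤ S.freeEnergy β ε h K (originField t ω)
        + ε * (u - t) * S.stateKappa β ε h K (originField t ω) 0 := by
    intro ω
    refine (freeEnergy_le (S := S) (ε := ε) hβ h h K (originField t ω) (originField u ω)).trans
      (le_of_eq ?_)
    congr 1
    rw [Finset.sum_eq_single 0]
    · rw [rep_zero, originField_zero, originField_zero]
      ring
    · intro v _ hv
      have hr : rep v ≠ 0 := fun e => hv (rep_injective (e.trans rep_zero.symm))
      rw [originField_of_ne hr, originField_of_ne hr]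
      ring
    · exact fun h0 => absurd (Finset.mem_univ _) h0
  have key := integral_mono i2 (i1.add i3) pt
  rw [integral_add' i1 i3, integral_const_mul] at key
  simp only [centeredFree, condAv, originSlope]
  linarith

/-- One ε is the prefactor of the slope; the other arises because moving t to u changes the field at
the origin by ε(u − t). -/
lemma abs_originSlope_sub_le (hν : MemLp id 2 ν) (hβ : β ≠ 0) (hβ' : β ≠ ⊤) (hε : 0 ≤ ε) {K : ℕ}
    (hK : S.radius ≤ K) (h t u : ℝ) :
    |S.originSlope β ε ν h K t - S.originSlope β ε ν h K u|
      ≤ 2 * (β.toReal * ε ^ 2) * |t - u| := by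
  wlog htu : t ≤ u generalizing t u
  · rw [abs_sub_comm, abs_sub_comm t u]
    exact this u t (le_of_not_ge htu)
  have hanti := (isSupergrad_originSlope (S := S) hν hβ hε hK h).antitone htu
  rw [abs_of_nonneg (sub_nonneg.2 hanti), abs_sub_comm, abs_of_nonneg (sub_nonneg.2 htu)]
  have hr : 0 ≤ ε * (u - t) := mul_nonneg hε (sub_nonneg.2 htu)
  have i1 := integrable_stateKappa_originField (S := S) (β := β) (ε := ε) (ν := ν) hK h t
  have i2 := integrable_stateKappa_originField (S := S) (β := β) (ε := ε) (ν := ν) hK h u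
  rw [originSlope, originSlope, ← mul_sub, ← integral_sub i1 i2]
  have key : ∫ ω : Fields d, (S.stateKappa β ε h K (originField t ω) 0
      - S.stateKappa β ε h K (originField u ω) 0) ∂(fieldLaw d ν)
      ≤ ∫ _ω : Fields d, 2 * β.toReal * (ε * (u - t)) ∂(fieldLaw d ν) := by
    refine integral_mono (i1.sub i2) (integrable_const _) fun ω => ?_
    have hv := stateOf_sub_stateOf_update_le (S := S) hβ hβ' hK
      (fun v => h + ε * originField t ω (rep v)) 0 hr
    have e : (fun v : Torus d K => h + ε * originField t ω (rep v)) + Pi.single 0 (ε * (u - t))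
        = fun v => h + ε * originField u ω (rep v) := by
      funext v
      rw [Pi.add_apply]
      by_cases hv0 : v = 0
      · subst hv0
        rw [Pi.single_eq_same, rep_zero, originField_zero, originField_zero]
        ring
      · have hr : rep v ≠ 0 := fun e => hv0 (rep_injective (e.trans rep_zero.symm))
        rw [Pi.single_eq_of_ne hv0, originField_of_ne hr, originField_of_ne hr, add_zero]
    rw [e] at hv
    simp only [stateKappa_eq]
    exact hv
  simp only [integral_const, probReal_univ, smul_eq_mul, one_mul] at key
  calc _ ≤ ε * (2 * β.toReal * (ε * (u - t))) := mul_le_mul_of_nonneg_left key hε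
    _ = _ := by ring

/-- Averaging over the field at the origin as well restores the full average; this links the
one-site slope to the slope of the free energy density. -/
lemma integral_originSlope (hν : MemLp id 2 ν) (hβ : β ≠ 0) (hε : 0 ≤ ε) {K : ℕ} (hK : S.radius ≤ K) (h : ℝ) :
    ∫ t, S.originSlope β ε ν h K t ∂ν
      = ε * ∫ η, S.stateKappa β ε h K η 0 ∂(fieldLaw d ν) := by
  have hev := measurePreserving_eval (d := d) ν 0
  have e1 : ∀ η : Fields d, S.originSlope β ε ν h K (η 0)
      = ε * condAv ν (box d 0) (fun η => S.stateKappa β ε h K η 0) η := by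
    intro η
    have e : ∀ ω : Fields d, originField (η 0) ω = splice (box d 0) η ω := fun ω => by
      funext x
      by_cases hx : x = 0
      · subst hx
        rw [originField_zero]
        simp [splice, box_zero]
      · rw [originField_of_ne hx]
        simp [splice, box_zero, hx]
    simp only [originSlope, condAv, e]
  have hm : AEStronglyMeasurable (S.originSlope β ε ν h K) ν :=
    (isSupergrad_originSlope hν hβ hε hK h).antitone.measurable.aestronglyMeasurable
  have e2 := integral_map (μ := fieldLaw d ν) hev.measurable.aemeasurable
    (f := S.originSlope β ε ν h K) (by rw [hev.map_eq]; exact hm)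
  rw [hev.map_eq] at e2
  rw [e2]
  simp only [e1]
  rw [integral_const_mul, integral_condAv (integrable_stateKappa hK h 0)]

lemma originSlope_mono (hε : 0 ≤ ε) {K : ℕ} (hK : S.radius ≤ K) {h h' t : ℝ}
    (hs : ∀ η : Fields d, S.stateKappa β ε h' K η 0 ≤ S.stateKappa β ε h K η 0) :
    S.originSlope β ε ν h' K t ≤ S.originSlope β ε ν h K t :=
  mul_le_mul_of_nonneg_left (integral_mono (integrable_stateKappa_originField hK h' t)
    (integrable_stateKappa_originField hK h t) fun _ => hs _) hε

end LatticeSystem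

lemma IsSupergrad.sub_le_sub_of_le {φ ψ p q : ℝ → ℝ} (hφ : IsSupergrad φ p)
    (hψ : IsSupergrad ψ q) {c : ℝ} (hp : ∀ t, |p t| ≤ c) (hq : ∀ t, |q t| ≤ c)
    (hpq : ∀ t, q t ≤ p t) {a b : ℝ} (hab : a ≤ b) : ψ b - ψ a ≤ φ b - φ a := by
  rw [← hφ.integral_eq hp, ← hψ.integral_eq hq]
  exact intervalIntegral.integral_mono hab hψ.antitone.intervalIntegrable
    hφ.antitone.intervalIntegrable hpq

end DisorderedLattice

namespace DisorderedLattice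

/-! ### Properties of the families (G_L) that are stable under limits and half-differences -/

section Families

variable {d : ℕ} {ν : Measure ℝ} [IsProbabilityMeasure ν] {ε : ℝ}

variable (ν ε) in
/-- A family of mean zero Lipschitz functions of the fields in the boxes `Γ_L`. -/
structure IsCenteredFamily (g : ℕ → Fields d → ℝ) : Prop where
  lip : ∀ L, SiteLipschitz (g L) (box d L) ε
  bound : ∀ L, |g L 0| ≤ ε * ((box d L).card * ∫ t, |t| ∂ν)
  mean : ∀ L, ∫ η, g L η ∂(fieldLaw d ν) = 0

variable (ν) in
/-- Averaging `g_L` over the fields outside a translate of `Γ_{L'}` gives the translate of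
`g_{L'}`. -/
def IsCovariant (g : ℕ → Fields d → ℝ) (L L' : ℕ) (x : Fin d → ℤ) : Prop :=
  ∀ η, condAv ν (translateSet (-x) (box d L')) (g L) η = g L' (shiftField x η)

variable {u : ℕ → ℕ → Fields d → ℝ} {U : ℕ → Fields d → ℝ}

lemma IsCenteredFamily.of_tendsto (hν : MemLp id 2 ν) (hu : ∀ n, IsCenteredFamily ν ε (u n))
    (h : ∀ L η, Tendsto (fun n => u n L η) atTop (𝓝 (U L η))) : IsCenteredFamily ν ε U where
  lip L := SiteLipschitz.of_tendsto (fun n => (hu n).lip L) (h L)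
  bound L := le_of_tendsto' (h L 0).abs fun n => (hu n).bound L
  mean L := by
    have := tendsto_integral_of_siteLipschitz hν (fun n => (hu n).lip L) (fun n => (hu n).bound L)
      (h L)
    simp only [(hu _).mean L] at this
    exact tendsto_nhds_unique this tendsto_const_nhds

lemma IsCovariant.of_tendsto (hν : MemLp id 2 ν) (hε : 0 ≤ ε)
    (hu : ∀ n, IsCenteredFamily ν ε (u n))
    (h : ∀ L η, Tendsto (fun n => u n L η) atTop (𝓝 (U L η))) {L L' : ℕ} {x : Fin d → ℤ}
    (hc : ∀ᶠ n in atTop, IsCovariant ν (u n) L L' x) : IsCovariant ν U L L' x := fun η =>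
  tendsto_nhds_unique
    ((tendsto_condAv_of_siteLipschitz hν hε (fun n => (hu n).lip L) (fun n => (hu n).bound L)
      (h L) _ η).congr' (hc.mono fun _ hn => hn η)) (h L' _)

lemma IsCovariant.half_sub (hν : MemLp id 2 ν) (hε : 0 ≤ ε) {g g' : ℕ → Fields d → ℝ}
    (hg : IsCenteredFamily ν ε g) (hg' : IsCenteredFamily ν ε g') {L L' : ℕ} {x : Fin d → ℤ}
    (h : IsCovariant ν g L L' x) (h' : IsCovariant ν g' L L' x) :
    IsCovariant ν (fun L η => (1 / 2) * (g L η - g' L η)) L L' x := fun η => by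
  simp only [← h η, ← h' η, condAv]
  rw [integral_const_mul, integral_sub (((hg.lip L).comp_splice_left hε _ η).integrable hν)
    (((hg'.lip L).comp_splice_left hε _ η).integrable hν)]

lemma SiteLipschitz.half_sub {f f' : Fields d → ℝ} {s : Finset (Fin d → ℤ)} {c : ℝ}
    (hf : SiteLipschitz f s c) (hf' : SiteLipschitz f' s c) :
    SiteLipschitz (fun η => (1 / 2) * (f η - f' η)) s c := fun η η' => by
  have h1 := _root_.abs_le.1 (hf η η')
  have h2 := _root_.abs_le.1 (hf' η η')
  simp only [_root_.abs_le]
  constructor <;> linarith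

end Families

/-! ### Iterated limits of the centered free energies -/

namespace LatticeSystem

variable {σ : Type*} [Fintype σ] [DecidableEq σ] [Nonempty σ] {d : ℕ} {S : LatticeSystem d σ}
  {β : ℝ≥0∞} {ε : ℝ} {ν : Measure ℝ} [IsProbabilityMeasure ν]

lemma isCenteredFamily_centeredFree (hν : MemLp id 2 ν) (hβ : β ≠ 0) (hε : 0 ≤ ε) (h : ℝ) {K : ℕ}
    (hK : S.radius ≤ K) :
    IsCenteredFamily ν ε fun L => S.centeredFree β ε ν h K (box d L) where
  lip _ := siteLipschitz_centeredFree hν hβ hε h hK _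
  bound _ := abs_centeredFree_zero_le hν hβ hε h hK _
  mean _ := integral_centeredFree hν hβ hε h hK _

lemma isCovariant_centeredFree (hν : MemLp id 2 ν) (hβ : β ≠ 0) (hε : 0 ≤ ε) (h : ℝ) {K L L' : ℕ}
    {x : Fin d → ℤ} (hK : S.radius ≤ K) (hL : translateSet (-x) (box d L') ⊆ box d L)
    (hLK : L ≤ K) (hLK' : L' ≤ K) :
    IsCovariant ν (fun L => S.centeredFree β ε ν h K (box d L)) L L' x := fun η =>
  condAv_centeredFree hν hβ hε h hK rfl hL (hL.trans (box_subset_box hLK)) (box_subset_box hLK') η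

/-- Simultaneous iterated limits of the centered free energies along subsequences. -/
lemma exists_iterated_limits (S : LatticeSystem d σ) (hν : MemLp id 2 ν) (hβ : β ≠ 0)
    (hε : 0 ≤ ε) (θ : Bool → ℕ → ℝ) :
    ∃ (K : ℕ → ℕ) (ψ : ℕ → ℕ) (V : Bool → ℕ → ℕ → Fields d → ℝ) (W : Bool → ℕ → Fields d → ℝ),
      (∀ j, S.radius ≤ K j) ∧ Tendsto K atTop atTop ∧ StrictMono ψ ∧
      (∀ b i L η, Tendsto (fun j => S.centeredFree β ε ν (θ b (ψ i)) (K j) (box d L) η) atTop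
        (𝓝 (V b i L η))) ∧
      ∀ b L η, Tendsto (fun i => V b i L η) atTop (𝓝 (W b L η)) := by
  have hR : ∀ j, S.radius ≤ S.radius + j := fun j => Nat.le_add_right _ _
  -- The triples (sign, index of δ, L) are countable, so one sequence of volumes serves them all; a
  -- second extraction in the index of δ follows. Starting at `radius` makes the finite volume
  -- bounds hold for every j.
  obtain ⟨φ, hφ, V, hV⟩ := exists_subseq_tendsto (ι := Bool × ℕ × ℕ)
    (u := fun j p => S.centeredFree β ε ν (θ p.1 p.2.1) (S.radius + j) (box d p.2.2))
    (s := fun p => box d p.2.2) (c := ε)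
    (fun j p => (isCenteredFamily_centeredFree hν hβ hε _ (hR j)).lip p.2.2)
    (b := fun p => ε * ((box d p.2.2).card * ∫ t, |t| ∂ν))
    (fun j p => (isCenteredFamily_centeredFree hν hβ hε _ (hR j)).bound p.2.2)
  have hVc : ∀ b i, IsCenteredFamily ν ε fun L => V (b, i, L) := fun b i =>
    IsCenteredFamily.of_tendsto hν
      (fun j => isCenteredFamily_centeredFree hν hβ hε (θ b i) (hR (φ j)))
      fun L η => hV (b, i, L) η
  obtain ⟨ψ, hψ, W, hW⟩ := exists_subseq_tendsto (ι := Bool × ℕ)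
    (u := fun i p => V (p.1, i, p.2)) (s := fun p => box d p.2) (c := ε)
    (fun i p => (hVc p.1 i).lip p.2) (b := fun p => ε * ((box d p.2).card * ∫ t, |t| ∂ν))
    (fun i p => (hVc p.1 i).bound p.2)
  exact ⟨fun j => S.radius + φ j, ψ, fun b i L => V (b, ψ i, L), fun b L => W (b, L),
    fun j => hR _, tendsto_atTop_mono (fun j => Nat.le_add_left _ _) hφ.tendsto_atTop, hψ,
    fun b i L η => hV (b, ψ i, L) η, fun b L η => hW (b, L) η⟩

variable {θ : ℕ → ℝ} {K : ℕ → ℕ} {V : ℕ → ℕ → Fields d → ℝ} {W : ℕ → Fields d → ℝ}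

lemma isCenteredFamily_limits (hν : MemLp id 2 ν) (hβ : β ≠ 0) (hε : 0 ≤ ε)
    (hK : ∀ j, S.radius ≤ K j)
    (hV : ∀ i L η, Tendsto (fun j => S.centeredFree β ε ν (θ i) (K j) (box d L) η) atTop
      (𝓝 (V i L η)))
    (hW : ∀ L η, Tendsto (fun i => V i L η) atTop (𝓝 (W L η))) : IsCenteredFamily ν ε W :=
  IsCenteredFamily.of_tendsto hν (fun i => IsCenteredFamily.of_tendsto hν
    (fun j => isCenteredFamily_centeredFree hν hβ hε (θ i) (hK j)) (hV i)) hW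

lemma isCovariant_limits (hν : MemLp id 2 ν) (hβ : β ≠ 0) (hε : 0 ≤ ε)
    (hK : ∀ j, S.radius ≤ K j) (hKtop : Tendsto K atTop atTop)
    (hV : ∀ i L η, Tendsto (fun j => S.centeredFree β ε ν (θ i) (K j) (box d L) η) atTop
      (𝓝 (V i L η)))
    (hW : ∀ L η, Tendsto (fun i => V i L η) atTop (𝓝 (W L η))) {L L' : ℕ} {x : Fin d → ℤ}
    (hL : translateSet (-x) (box d L') ⊆ box d L) : IsCovariant ν W L L' x := by
  refine IsCovariant.of_tendsto hν hε (fun i => IsCenteredFamily.of_tendsto hν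
    (fun j => isCenteredFamily_centeredFree hν hβ hε (θ i) (hK j)) (hV i)) hW
    (Eventually.of_forall fun i => ?_)
  refine IsCovariant.of_tendsto hν hε
    (fun j => isCenteredFamily_centeredFree hν hβ hε (θ i) (hK j)) (hV i) ?_
  filter_upwards [hKtop.eventually_ge_atTop L, hKtop.eventually_ge_atTop L'] with j hj hj'
  exact isCovariant_centeredFree hν hβ hε (θ i) (hK j) hL hj hj'

/-- Supergradients of the one-site limit function, with the mean of the slopes. -/
lemma exists_slope_limits (hν : MemLp id 2 ν) (hβ : β ≠ 0) (hac : β = ⊤ → ν ≪ volume)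
    (hε : 0 ≤ ε) (hK : ∀ j, S.radius ≤ K j)
    (hV : ∀ i L η, Tendsto (fun j => S.centeredFree β ε ν (θ i) (K j) (box d L) η) atTop
      (𝓝 (V i L η)))
    (hW : ∀ L η, Tendsto (fun i => V i L η) atTop (𝓝 (W L η))) :
    ∃ p : ℝ → ℝ, IsSupergrad (fun t => W 0 fun _ => t) p ∧ (∀ t, |p t| ≤ ε) ∧
      (β ≠ ⊤ → ∀ t u, |p t - p u| ≤ 2 * (β.toReal * ε ^ 2) * |t - u|) ∧
      ∃ E : ℕ → ℝ, (∀ i, Tendsto (fun j => ε * ∫ η, S.stateKappa β ε (θ i) (K j) η 0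
        ∂(fieldLaw d ν)) atTop (𝓝 (E i))) ∧ Tendsto E atTop (𝓝 (∫ t, p t ∂ν)) := by
  have hsup := fun i j => isSupergrad_originSlope (S := S) hν hβ hε (hK j) (θ i)
  have hbd := fun i j => abs_originSlope_le (S := S) (β := β) (ν := ν) hε (hK j) (θ i)
  -- Convergence of the mean slopes needs ν to give no mass to the jumps of the limit slope: there
  -- are none if β < ∞, and countably many, hence a null set, if β = ∞ and ν has a density.
  have hcts : ∀ {φ p : ℝ → ℝ}, IsSupergrad φ p →
      (β ≠ ⊤ → ∀ t u, |p t - p u| ≤ 2 * (β.toReal * ε ^ 2) * |t - u|) →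
      ∀ᵐ t ∂ν, ContinuousAt p t := by
    intro φ p hp hlip
    by_cases hβ' : β = ⊤
    · exact ae_continuousAt_of_antitone hp.antitone (hac hβ')
    · refine Eventually.of_forall fun t => ?_
      refine (LipschitzWith.of_dist_le_mul (K := (2 * (β.toReal * ε ^ 2)).toNNReal)
        fun u s => ?_).continuous.continuousAt
      rw [Real.dist_eq, Real.dist_eq, Real.coe_toNNReal _ (by positivity)]
      exact hlip hβ' u s
  choose q hq hqc hqL using fun i => IsSupergrad.exists_of_tendsto (hsup i)
    (fun t => hV i 0 fun _ => t) (hbd i)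
  have hqL' : β ≠ ⊤ → ∀ i t u, |q i t - q i u| ≤ 2 * (β.toReal * ε ^ 2) * |t - u| :=
    fun hβ' i => hqL i _ fun j t u => abs_originSlope_sub_le hν hβ hβ' hε (hK j) (θ i) t u
  obtain ⟨p, hp, hpc, hpL⟩ := IsSupergrad.exists_of_tendsto hq (fun t => hW 0 fun _ => t) hqc
  have hpL' : β ≠ ⊤ → ∀ t u, |p t - p u| ≤ 2 * (β.toReal * ε ^ 2) * |t - u| :=
    fun hβ' => hpL _ (hqL' hβ')
  refine ⟨p, hp, hpc, hpL', fun i => ∫ t, q i t ∂ν, fun i => ?_, ?_⟩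
  · have := tendsto_integral_of_supergrad (hq i) (hsup i) (fun t => hV i 0 fun _ => t) (hbd i)
      (hcts (hq i) fun hβ' => hqL' hβ' i)
    exact this.congr fun j => integral_originSlope hν hβ hε (hK j) (θ i)
  · exact tendsto_integral_of_supergrad hp hq (fun t => hW 0 fun _ => t) hqc (hcts hp hpL')

/-- The limiting increments of the one-site function inherit an ordering of `⟨κ_0⟩`. -/
lemma limits_sub_le_sub (hν : MemLp id 2 ν) (hβ : β ≠ 0) (hε : 0 ≤ ε)
    (hK : ∀ j, S.radius ≤ K j)
    (hV : ∀ i L η, Tendsto (fun j => S.centeredFree β ε ν (θ i) (K j) (box d L) η) atTop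
      (𝓝 (V i L η)))
    (hW : ∀ L η, Tendsto (fun i => V i L η) atTop (𝓝 (W L η)))
    {θ' : ℕ → ℝ} {V' : ℕ → ℕ → Fields d → ℝ} {W' : ℕ → Fields d → ℝ}
    (hV' : ∀ i L η, Tendsto (fun j => S.centeredFree β ε ν (θ' i) (K j) (box d L) η) atTop
      (𝓝 (V' i L η)))
    (hW' : ∀ L η, Tendsto (fun i => V' i L η) atTop (𝓝 (W' L η)))
    (hle : ∀ i, ∀ᶠ j in atTop, ∀ η : Fields d,
      S.stateKappa β ε (θ' i) (K j) η 0 ≤ S.stateKappa β ε (θ i) (K j) η 0)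
    {a b : ℝ} (hab : a ≤ b) :
    W' 0 (fun _ => b) - W' 0 (fun _ => a) ≤ W 0 (fun _ => b) - W 0 (fun _ => a) := by
  refine le_of_tendsto_of_tendsto' ((hW' 0 _).sub (hW' 0 _)) ((hW 0 _).sub (hW 0 _)) fun i => ?_
  refine le_of_tendsto_of_tendsto ((hV' i 0 _).sub (hV' i 0 _)) ((hV i 0 _).sub (hV i 0 _)) ?_
  filter_upwards [hle i] with j hj
  exact (isSupergrad_originSlope (S := S) hν hβ hε (hK j) (θ i)).sub_le_sub_of_le
    (isSupergrad_originSlope (S := S) hν hβ hε (hK j) (θ' i))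
    (abs_originSlope_le hε (hK j) (θ i)) (abs_originSlope_le hε (hK j) (θ' i))
    (fun t => originSlope_mono hε (hK j) hj) hab

/-- The free energy density has bounded supergradients, and these control the limits of the mean
of `⟨κ_0⟩` at nearby fields. -/
lemma exists_supergrad_freeEnergyDensity (S : LatticeSystem d σ) (hν : MemLp id 2 ν) (hβ : β ≠ 0)
    (hε : 0 ≤ ε) {F : ℝ → ℝ}
    (hF : ∀ h, Tendsto (fun K => (∫ η, S.freeEnergy β ε h K η ∂(fieldLaw d ν))
      / ((box d K).card : ℝ)) atTop (𝓝 (F h))) :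
    ∃ P : ℝ → ℝ, IsSupergrad F P ∧ (∀ t, |P t| ≤ 1) ∧ ∀ {K : ℕ → ℕ} {t E : ℝ},
      (∀ j, S.radius ≤ K j) → Tendsto K atTop atTop →
      Tendsto (fun j => ε * ∫ η, S.stateKappa β ε t (K j) η 0 ∂(fieldLaw d ν)) atTop (𝓝 E) →
      ∀ s, (s < t → E ≤ ε * P s) ∧ (t < s → ε * P s ≤ E) := by
  have hR : ∀ j, S.radius ≤ j + S.radius := fun j => Nat.le_add_left _ _
  obtain ⟨P, hP, hPc, -⟩ := IsSupergrad.exists_of_tendsto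
    (fun j => mean_freeEnergy_le (S := S) hν hβ hε (hR j))
    (fun t => (hF t).comp (tendsto_add_atTop_nat S.radius))
    (fun j t => abs_integral_stateKappa_le (hR j) t 0)
  refine ⟨P, hP, hPc, fun {K t E} hK hKtop hE s => ?_⟩
  exact le_of_tendsto_supergrad hP (fun u => (hF u).comp hKtop) hε
    (fun j u => mean_freeEnergy_le hν hβ hε (hK j) t u) hE

end LatticeSystem

end DisorderedLattice

/-! ### Assembly of the main theorem -/

open DisorderedLattice DisorderedLattice.LatticeSystem

theorem mainTheorem4 {d : ℕ} (hd : 1 ≤ d) {σ : Type*} [Fintype σ] [DecidableEq σ] [Nonempty σ]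
    (S : DisorderedLattice.LatticeSystem d σ)
    (ν : MeasureTheory.Measure ℝ) [MeasureTheory.IsProbabilityMeasure ν]
    (hν : MeasureTheory.MemLp id 2 ν)
    (β : ENNReal) (hβ : β ≠ 0) (hac : β = ⊤ → ν ≪ MeasureTheory.volume)
    (ε : ℝ) (hε : 0 ≤ ε) :
    ∃ F : ℝ → ℝ, DisorderedLattice.IsFreeEnergyDensity S ν β ε F ∧
      ∀ h : ℝ, ∃ (K : ℕ → ℕ) (δ : ℕ → ℝ) (G : ℕ → DisorderedLattice.Fields d → ℝ),
        Tendsto K atTop atTop ∧ (∀ i, 0 < δ i) ∧ Tendsto δ atTop (𝓝 0) ∧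
        -- the iterated limits exist
        (∃ Gδ : ℕ → ℕ → DisorderedLattice.Fields d → ℝ, ∀ L η,
          (∀ i, Tendsto (fun j => DisorderedLattice.centeredDiff S ν β ε h L (K j) (δ i) η)
            atTop (𝓝 (Gδ L i η))) ∧
          Tendsto (fun i => Gδ L i η) atTop (𝓝 (G L η))) ∧
        -- mean zero
        (∀ L, MeasureTheory.Integrable (G L) (DisorderedLattice.fieldLaw d ν) ∧
          ∫ η, G L η ∂(DisorderedLattice.fieldLaw d ν) = 0) ∧
        -- locality
        (∀ L η η', (∀ x ∈ DisorderedLattice.box d L, η x = η' x) → G L η = G L η') ∧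
        -- Lipschitz bound
        (∀ L, DisorderedLattice.lipSeminorm (G L) ≤ ENNReal.ofReal ε) ∧
        -- martingale property and translation covariance
        (∀ (L L' : ℕ) (x : Fin d → ℤ) (Λ : Finset (Fin d → ℤ)),
          DisorderedLattice.translateSet (-x) (DisorderedLattice.box d L') = Λ →
          Λ ⊆ DisorderedLattice.box d L →
          ∀ η, DisorderedLattice.condAv ν Λ (G L) η
            = G L' (DisorderedLattice.shiftField x η)) ∧
        -- the derivative of the one-site function
        (∃ G' : ℝ → ℝ,
          DisorderedLattice.IsDistribDeriv (DisorderedLattice.oneSite G) G' ∧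
          (β ≠ ⊤ → LipschitzWith (Real.toNNReal (β.toReal * ε ^ 2)) G') ∧
          MeasureTheory.Integrable (fun η => G' (η 0)) (DisorderedLattice.fieldLaw d ν) ∧
          ∃ Dplus Dminus : ℝ,
            HasDerivWithinAt F Dplus (Set.Ioi h) h ∧
            HasDerivWithinAt F Dminus (Set.Iio h) h ∧
            ∫ η, G' (η 0) ∂(DisorderedLattice.fieldLaw d ν) = ε / 2 * (Dplus - Dminus)) ∧
        -- monotonicity
        (S.WeakFKG β ε → Monotone (DisorderedLattice.oneSite G)) ∧
        (S.WeakFKGNeg β ε → Antitone (DisorderedLattice.oneSite G)) := by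
  obtain ⟨F, hF, hmean⟩ := S.exists_freeEnergyDensity hd hν hβ hε
  obtain ⟨P, hP, hPc, hPE⟩ := S.exists_supergrad_freeEnergyDensity hν hβ hε hmean
  refine ⟨F, hF, fun h => ?_⟩
  obtain ⟨δ₀, -, hδ₀pos, hδ₀⟩ := exists_seq_strictAnti_tendsto (0 : ℝ)
  obtain ⟨K, ψ, V, W, hK, hKtop, hψ, hV, hW⟩ := S.exists_iterated_limits hν hβ hε
    fun b i => cond b (h + δ₀ i) (h - δ₀ i)
  have hδpos : ∀ i, 0 < δ₀ (ψ i) := fun i => hδ₀pos _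
  have hδ : Tendsto (fun i => δ₀ (ψ i)) atTop (𝓝 0) := hδ₀.comp hψ.tendsto_atTop
  set δ : ℕ → ℝ := fun i => δ₀ (ψ i)
  have hVp : ∀ i L η, Tendsto (fun j => S.centeredFree β ε ν (h + δ i) (K j) (box d L) η) atTop
    (𝓝 (V true i L η)) := hV true
  have hVm : ∀ i L η, Tendsto (fun j => S.centeredFree β ε ν (h - δ i) (K j) (box d L) η) atTop
    (𝓝 (V false i L η)) := hV false
  have hcp := isCenteredFamily_limits hν hβ hε hK hVp (hW true)
  have hcm := isCenteredFamily_limits hν hβ hε hK hVm (hW false)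
  have hG : ∀ L, SiteLipschitz (fun η => (1 / 2) * (W true L η - W false L η)) (box d L) ε :=
    fun L => (hcp.lip L).half_sub (hcm.lip L)
  obtain ⟨p, hp, hpc, hpL, E, hE, hEp⟩ := exists_slope_limits hν hβ hac hε hK hVp (hW true)
  obtain ⟨q, hq, hqc, hqL, E', hE', hEq⟩ := exists_slope_limits hν hβ hac hε hK hVm (hW false)
  have hpi := integrable_of_supergrad hp hpc ν
  have hqi := integrable_of_supergrad hq hqc ν
  obtain ⟨Dp, hDp, hDp'⟩ := hP.exists_hasDerivWithinAt_Ioi hPc h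
  obtain ⟨Dm, hDm, hDm'⟩ := hP.exists_hasDerivWithinAt_Iio hPc h
  -- E i is a limit of mean slopes at h + δ i. By monotonicity it lies between ε P at h + 2δ i and
  -- at h + δ i / 2, points on either side of h + δ i that both approach h from the right.
  have right : ∀ c : ℝ, 0 < c → Tendsto (fun i => ε * P (h + c * δ i)) atTop (𝓝 (ε * Dp)) := by
    intro c hc
    refine (hDp.comp (tendsto_nhdsWithin_iff.2 ⟨?_, Eventually.of_forall fun i => ?_⟩)).const_mul ε
    · simpa using (hδ.const_mul c).const_add h
    · exact lt_add_of_pos_right _ (mul_pos hc (hδpos i))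
  have left : ∀ c : ℝ, 0 < c → Tendsto (fun i => ε * P (h - c * δ i)) atTop (𝓝 (ε * Dm)) := by
    intro c hc
    refine (hDm.comp (tendsto_nhdsWithin_iff.2 ⟨?_, Eventually.of_forall fun i => ?_⟩)).const_mul ε
    · simpa using (hδ.const_mul c).const_sub h
    · exact sub_lt_self _ (mul_pos hc (hδpos i))
  have intp : ∫ t, p t ∂ν = ε * Dp := by
    refine tendsto_nhds_unique hEp (tendsto_of_tendsto_of_tendsto_of_le_of_le (right 2 (by norm_num))
      (right (1 / 2) (by norm_num)) (fun i => ?_) fun i => ?_)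
    · exact (hPE hK hKtop (hE i) _).2 (by linarith [hδpos i])
    · exact (hPE hK hKtop (hE i) _).1 (by linarith [hδpos i])
  have intq : ∫ t, q t ∂ν = ε * Dm := by
    refine tendsto_nhds_unique hEq (tendsto_of_tendsto_of_tendsto_of_le_of_le
      (left (1 / 2) (by norm_num)) (left 2 (by norm_num)) (fun i => ?_) fun i => ?_)
    · exact (hPE hK hKtop (hE' i) _).2 (by linarith [hδpos i])
    · exact (hPE hK hKtop (hE' i) _).1 (by linarith [hδpos i])
  have hev := measurePreserving_eval (d := d) ν 0
  have hgi : Integrable (fun t => (1 / 2) * (p t - q t)) ν := (hpi.sub hqi).const_mul _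
  refine ⟨K, δ, fun L η => (1 / 2) * (W true L η - W false L η), hKtop, hδpos, hδ,
    ⟨fun L i η => (1 / 2) * (V true i L η - V false i L η), fun L η => ⟨fun i => ?_, ?_⟩⟩,
    fun L => ⟨(hG L).integrable hν, ?_⟩, fun L η η' hη => (hG L).congr hη,
    fun L => lipSeminorm_le_of_siteLipschitz hε (hG L), ?_,
    ⟨fun t => (1 / 2) * (p t - q t), ⟨?_, fun a b => ?_⟩, fun hβ' => ?_, ?_,
      Dp, Dm, hDp', hDm', ?_⟩, fun hfkg a b hab => ?_, fun hfkg a b hab => ?_⟩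
  · simp only [centeredDiff_eq hν hβ hε h (δ i) (hK _)]
    exact ((hVp i L η).sub (hVm i L η)).const_mul _
  · exact ((hW true L η).sub (hW false L η)).const_mul _
  · rw [integral_const_mul, integral_sub ((hcp.lip L).integrable hν) ((hcm.lip L).integrable hν),
      hcp.mean, hcm.mean]
    simp
  · rintro L L' x Λ rfl hL η
    exact IsCovariant.half_sub hν hε hcp hcm (isCovariant_limits hν hβ hε hK hKtop hVp (hW true) hL)
      (isCovariant_limits hν hβ hε hK hKtop hVm (hW false) hL) η
  · exact (hp.antitone.locallyIntegrable.sub hq.antitone.locallyIntegrable).smul (1 / 2 : ℝ)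
  · rw [intervalIntegral.integral_const_mul,
      intervalIntegral.integral_sub hp.antitone.intervalIntegrable hq.antitone.intervalIntegrable,
      hp.integral_eq hpc, hq.integral_eq hqc]
    simp only [oneSite]
    ring
  · refine LipschitzWith.of_dist_le_mul fun t u => ?_
    rw [Real.dist_eq, Real.dist_eq, Real.coe_toNNReal _ (by positivity)]
    wlog htu : t ≤ u generalizing t u
    · rw [abs_sub_comm, abs_sub_comm t u]
      exact this u t (le_of_not_ge htu)
    -- Both p and q decrease from t to u by at most 2βε²|t − u|. Their decrements have the same
    -- sign, so they differ by no more than that, and the factor 1/2 yields βε².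
    have h1 := (abs_le.1 (hpL hβ' t u)).2
    have h2 := (abs_le.1 (hqL hβ' t u)).2
    have h3 := hp.antitone htu
    have h4 := hq.antitone htu
    rw [abs_le]
    constructor <;> linarith
  · exact hev.integrable_comp_of_integrable hgi
  · have e := integral_map (μ := fieldLaw d ν) hev.measurable.aemeasurable
      (f := fun t => (1 / 2) * (p t - q t)) (by rw [hev.map_eq]; exact hgi.aestronglyMeasurable)
    rw [hev.map_eq] at e
    rw [← e, integral_const_mul, integral_sub hpi hqi, intp, intq]
    ring
  -- Weak FKG compares the uniform fields h − δ and h + δ at the same η: the slopes at h + δ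
  -- dominate, so G_0 has nonnegative increments.
  · have := limits_sub_le_sub hν hβ hε hK hVp (hW true) hVm (hW false)
      (fun i => (hKtop.eventually hfkg).mono fun j hj η =>
        hj 0 _ _ η η (by linarith [hδpos i]) fun _ _ => le_rfl) hab
    simp only [oneSite]
    linarith
  · have := limits_sub_le_sub hν hβ hε hK hVm (hW false) hVp (hW true)
      (fun i => (hKtop.eventually hfkg).mono fun j hj η =>
        hj 0 _ _ η η (by linarith [hδpos i]) fun _ _ => le_rfl) hab
    simp only [oneSite]
    linarith
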